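/- **Setting.** Use cylindrical coordinates $(x,r,\varphi)$ in $\mathbb R^3$, let $\Delta_\perp$ be the Laplacian in the transversal plane, and let $k\in\mathbb C$ with $\operatorname{Re}k>0$, $\operatorname{Im}k\ge 0$, and $\theta\in\mathbb R$. The body occupies $r\le f(x)$, $X_1\le x\le X_2$, with $X_1<X_2\le\infty$ (if $X_2=\infty$ the body is half-infinite). Here $f$ is continuous, $f>0$ and $C^1$ with bounded derivative $\dot f$ on $(X_1,X_2)$, $f(X_1)=0$, and $f(X_2)=0$ if $X_2<\infty$; the surface $\Gamma$ is $r=f(x)$, $X_1<x<X_2$. The incident wave is $u^{\rm in}=\exp\{ik(\theta r\cos\varphi-x\theta^2/2)\}$, and $u=u^{\rm in}+u^{\rm sc}$ is a solution of the parabolic scattering problem outside the body: * $u$ is continuous outside the body and up to $\Gamma$, and off the planes $x=X_1$, $x=X_2$ it is $C^1$ in $x$ and $C^2$ in the transversal variables (with jointly continuous derivatives) and satisfies $\left(\partial_x+\frac1{2ik}\Delta_\perp\right)u=0$; * $N[u]=0$ on $\Gamma$ (as a boundary value from outside), where $N=\partial_r-ik\dot f$; * $u^{\rm sc}=0$ for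 $x<X_1$; * $|\nabla_\perp u|^2+|u|^2$ is integrable over every bounded part of the exterior; * radiation condition (limiting absorption): if $\operatorname{Im}k>0$, then $u^{\rm sc}\to0$ as $r\to\infty$, locally uniformly in $x$; if $k$ is real, then $u$ is the limit as $\varepsilon\to0^+$, uniform on bounded parts of the exterior together with $\Gamma$, of fields $u_\varepsilon$ which solve the problem for $k+i\varepsilon$. Put $U(x,\varphi)=u(x,f(x),\varphi)$, and for $x<x_*$ $$g({\rm r}_*,{\rm r})=\frac{k}{2\pi i(x_*-x)}\exp\left\{\frac{ik}{2}\,\frac{r_*^2+r^2-2r_*r\cos(\varphi_*-\varphi)}{x_*-x}\right\},\qquad \bar N=\partial_r+ik\dot f ,$$ where $\bar N$ acts on the second argument of $g$ and is evaluated at ${\rm r}=(x,f(x),\varphi)$. **Statement.** 1. *Reconstruction.* If $\operatorname{Im}k>0$, then for every point ${\rm r}_*=(x_*,r_*,\varphi_*)$ outside the body $$u({\rm r}_*)=\frac{i}{2k}\int_0^{2\pi}\!\!\int_{X_1}^{\min(x_*,X_2)}\bar N[g({\rm r}_*,{\rm r})]\,U(x,\varphi)f(x)\,dx\,d\varphi+u^{\rm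 in}({\rm r}_*),$$ where the integrand is integrable and the integral is zero if $x_*\le X_1$. If $k$ is real, then for every such ${\rm r}_*$ and every family $u_\varepsilon$ as in the radiation condition, $u({\rm r}_*)-u^{\rm in}({\rm r}_*)$ is the limit, as $\varepsilon\to0^+$, of the integral term formed with $k+i\varepsilon$ and the surface values of $u_\varepsilon$. 2. *Finite body.* Let $X_2<\infty$ and $\operatorname{Im}k\ge0$. For every ${\rm r}_*$ with $x_*>X_2$ $$u^{\rm sc}({\rm r}_*)=\frac{i}{2k}\int_0^{2\pi}\!\!\int_{X_1}^{X_2}\bar N[g({\rm r}_*,{\rm r})]\,U(x,\varphi)f(x)\,dx\,d\varphi ,$$ with an integrable integrand. Moreover, for fixed $\theta_*\ge0$ and $\varphi_*$, as $L\to\infty$, $$u^{\rm sc}(L,L\theta_*,\varphi_*)=\frac{k}{2\pi iL}\exp\left\{\frac{ikL\theta_*^2}{2}\right\}\bigl(T(\theta_*,\varphi_*)+O(1/L)\bigr),$$ where the directivity $T$ is given by the (absolutely convergent) integral $$T(\theta_*,\varphi_*)=\frac12\int_0^{2\pi}\!\!\int_{X_1}^{X_2}\bigl(\theta_*\cos(\varphi-\varphi_*)-\dot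 f(x)\bigr)\exp\bigl\{ik\bigl(-\theta_*f(x)\cos(\varphi_*-\varphi)+x\theta_*^2/2\bigr)\bigr\}\,U(x,\varphi)f(x)\,dx\,d\varphi .$$ -/

import Mathlib

open MeasureTheory Filter Topology

noncomputable section

namespace ParabolicScattering

/-- The transversal plane, with its Euclidean structure. -/
abbrev Plane := EuclideanSpace ℝ (Fin 2)

/-- The point of the transversal plane with polar coordinates `r`, `φ`. -/
def pol (r φ : ℝ) : Plane := !₂[r * Real.cos φ, r * Real.sin φ]

/-- `r = f x` is the surface of a body of revolution around the segment `X₁ ≤ x ≤ X₂`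
(`X₂ = ⊤` for a half-infinite body). The body is closed up by its tips on the axis, its surface is
smooth away from the tips, and its slope is bounded. -/
structure IsProfile (f : ℝ → ℝ) (X₁ : ℝ) (X₂ : EReal) : Prop where
  lt : (X₁ : EReal) < X₂
  continuousOn : ContinuousOn f {x : ℝ | X₁ ≤ x ∧ (x : EReal) ≤ X₂}
  front : f X₁ = 0
  rear : ∀ b : ℝ, X₂ = (b : EReal) → f b = 0
  pos : ∀ x : ℝ, X₁ < x → (x : EReal) < X₂ → 0 < f x
  smooth : ContDiffOn ℝ 1 f {x : ℝ | X₁ < x ∧ (x : EReal) < X₂}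
  slope : ∃ C : ℝ, ∀ x : ℝ, X₁ < x → (x : EReal) < X₂ → |deriv f x| ≤ C

/-- The space outside the (closed) body. A point is a pair of its longitudinal coordinate and its
projection onto the transversal plane. -/
def exterior (f : ℝ → ℝ) (X₁ : ℝ) (X₂ : EReal) : Set (ℝ × Plane) :=
  {p | X₁ ≤ p.1 → (p.1 : EReal) ≤ X₂ → f p.1 < ‖p.2‖}

/-- The surface of the body, without the tips. -/
def surface (f : ℝ → ℝ) (X₁ : ℝ) (X₂ : EReal) : Set (ℝ × Plane) :=
  {p | X₁ < p.1 ∧ (p.1 : EReal) < X₂ ∧ ‖p.2‖ = f p.1}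

/-- The part of the exterior off the two transversal planes through the tips. -/
def offTips (f : ℝ → ℝ) (X₁ : ℝ) (X₂ : EReal) : Set (ℝ × Plane) :=
  {p ∈ exterior f X₁ X₂ | p.1 ≠ X₁ ∧ (p.1 : EReal) ≠ X₂}

/-- The incident plane wave in the parabolic approximation,
`exp (i k (θ r cos φ - x θ² / 2))`; the coordinate `y 0` is `r cos φ`. -/
def uIn (k : ℂ) (θ : ℝ) (x : ℝ) (y : Plane) : ℂ :=
  Complex.exp (Complex.I * k * ((θ * y 0 - x * θ ^ 2 / 2 : ℝ) : ℂ))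

/-- The boundary operator `N = ∂/∂r - i k f'`, at cylindrical coordinates `x`, `r`, `φ`. -/
def opN (k : ℂ) (f : ℝ → ℝ) (u : ℝ → Plane → ℂ) (x r φ : ℝ) : ℂ :=
  deriv (fun ρ : ℝ => u x (pol ρ φ)) r - Complex.I * k * ((deriv f x : ℝ) : ℂ) * u x (pol r φ)

/-- `u` is a total field outside the body, for the wavenumber `k` and the angle of incidence `θ`:
every requirement of the scattering problem except for the radiation condition. -/
structure IsTotalField (k : ℂ) (θ : ℝ) (f : ℝ → ℝ) (X₁ : ℝ) (X₂ : EReal)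
    (u : ℝ → Plane → ℂ) : Prop where
  /-- `u` is continuous outside the body, up to the surface (without the tips). -/
  continuousOn : ContinuousOn (fun p : ℝ × Plane => u p.1 p.2)
    (exterior f X₁ X₂ ∪ surface f X₁ X₂)
  /-- Off the transversal planes of the tips the derivatives in the equation are classical. -/
  contDiffAt : ∀ p ∈ offTips f X₁ X₂, ContDiffAt ℝ 2 (u p.1) p.2
  differentiableAt : ∀ p ∈ offTips f X₁ X₂, DifferentiableAt ℝ (fun x => u x p.2) p.1
  continuousOn_grad : ContinuousOn (fun p : ℝ × Plane => fderiv ℝ (u p.1) p.2)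
    (offTips f X₁ X₂)
  continuousOn_hess : ContinuousOn (fun p : ℝ × Plane => iteratedFDeriv ℝ 2 (u p.1) p.2)
    (offTips f X₁ X₂)
  continuousOn_deriv : ContinuousOn (fun p : ℝ × Plane => deriv (fun x => u x p.2) p.1)
    (offTips f X₁ X₂)
  /-- The parabolic equation. -/
  equation : ∀ p ∈ offTips f X₁ X₂,
    deriv (fun x => u x p.2) p.1 +
      1 / (2 * Complex.I * k) * (Laplacian.laplacian (u p.1) : Plane → ℂ) p.2 = 0
  /-- The Neumann condition `N[u] (x, f x, φ) = 0`, a boundary value from outside the body. -/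
  neumann : ∀ x φ : ℝ, X₁ < x → (x : EReal) < X₂ →
    Tendsto (fun q : ℝ × ℝ × ℝ => opN k f u q.1 q.2.1 q.2.2)
      (𝓝[{q : ℝ × ℝ × ℝ | f q.1 < q.2.1}] (x, f x, φ)) (𝓝 0)
  /-- The initial condition: there is no scattered field in front of the body. -/
  initial : ∀ x : ℝ, x < X₁ → ∀ y : Plane, u x y - uIn k θ x y = 0
  /-- Meixner's condition: the energy is locally integrable, up to the surface and the tips. -/
  meixner : ∀ R : ℝ, IntegrableOn
    (fun p : ℝ × Plane => ‖fderiv ℝ (u p.1) p.2‖ ^ 2 + ‖u p.1 p.2‖ ^ 2)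
    (exterior f X₁ X₂ ∩ Metric.closedBall 0 R)

/-- The scattered field decays as `r → ∞`, locally uniformly in `x`. -/
def ScatteredDecays (k : ℂ) (θ : ℝ) (f : ℝ → ℝ) (X₁ : ℝ) (X₂ : EReal)
    (u : ℝ → Plane → ℂ) : Prop :=
  ∀ a b η : ℝ, 0 < η → ∃ R : ℝ, ∀ x ∈ Set.Icc a b, ∀ y : Plane, R ≤ ‖y‖ →
    (x, y) ∈ exterior f X₁ X₂ → ‖u x y - uIn k θ x y‖ < η

/-- `u` is the limit, uniform on bounded parts of the exterior with its surface, of the fields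
`v ε` for the wavenumbers `k + i ε`, whose scattered parts decay, as `ε → 0+`. -/
def IsAbsorptionLimit (k : ℂ) (θ : ℝ) (f : ℝ → ℝ) (X₁ : ℝ) (X₂ : EReal)
    (v : ℝ → ℝ → Plane → ℂ) (u : ℝ → Plane → ℂ) : Prop :=
  (∀ᶠ ε : ℝ in 𝓝[>] (0 : ℝ), IsTotalField (k + Complex.I * (ε : ℝ)) θ f X₁ X₂ (v ε) ∧
      ScatteredDecays (k + Complex.I * (ε : ℝ)) θ f X₁ X₂ (v ε)) ∧
    ∀ R : ℝ, TendstoUniformlyOn (fun ε (p : ℝ × Plane) => v ε p.1 p.2) (fun p => u p.1 p.2)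
      (𝓝[>] (0 : ℝ)) ((exterior f X₁ X₂ ∪ surface f X₁ X₂) ∩ Metric.closedBall 0 R)

/-- The radiation condition, in the form of the limiting absorption principle: decay of the
scattered field for `Im k > 0`, and a limit of such fields for real `k`. -/
def Radiates (k : ℂ) (θ : ℝ) (f : ℝ → ℝ) (X₁ : ℝ) (X₂ : EReal)
    (u : ℝ → Plane → ℂ) : Prop :=
  (0 < k.im ∧ ScatteredDecays k θ f X₁ X₂ u) ∨
    (k.im = 0 ∧ ∃ v : ℝ → ℝ → Plane → ℂ, IsAbsorptionLimit k θ f X₁ X₂ v u)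

/-- Green's function of the parabolic equation: observation point `(x', r', φ')`, source
`(x, r, φ)`, both in cylindrical coordinates. -/
def green (k : ℂ) (x' r' φ' x r φ : ℝ) : ℂ :=
  if x < x' then
    k / (2 * Real.pi * Complex.I * ((x' - x : ℝ) : ℂ)) *
      Complex.exp (Complex.I * k / 2 *
        (((r' ^ 2 + r ^ 2 - 2 * r' * r * Real.cos (φ' - φ)) / (x' - x) : ℝ) : ℂ))
  else 0

/-- `N̄[g(r', ·)]` at the surface point `(x, f x, φ)`, where `N̄ = ∂/∂r + i k f'` acts on the
second argument of Green's function. -/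
def barNGreen (k : ℂ) (f : ℝ → ℝ) (x' r' φ' x φ : ℝ) : ℂ :=
  deriv (fun r : ℝ => green k x' r' φ' x r φ) (f x) +
    Complex.I * k * ((deriv f x : ℝ) : ℂ) * green k x' r' φ' x (f x) φ

/-- The field on the surface, `U (x, φ) = u (x, f x, φ)`. -/
def surfaceField (f : ℝ → ℝ) (u : ℝ → Plane → ℂ) (x φ : ℝ) : ℂ := u x (pol (f x) φ)

/-- The integrand `N̄[g(r', ·)] U f` of the reconstruction formula. -/
def kirchhoffIntegrand (k : ℂ) (f : ℝ → ℝ) (u : ℝ → Plane → ℂ) (x' r' φ' x φ : ℝ) : ℂ :=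
  barNGreen k f x' r' φ' x φ * surfaceField f u x φ * (f x : ℂ)

/-- The part of the axis of the body behind which the observation plane `x'` lies. -/
def axisUpTo (X₁ : ℝ) (X₂ : EReal) (x' : ℝ) : Set ℝ :=
  {x : ℝ | X₁ < x ∧ (x : EReal) < X₂ ∧ x < x'}

/-- `i / (2 k) ∫∫ N̄[g(r', ·)] U f dx dφ` over the part of the surface up to `x'`. -/
def kirchhoff (k : ℂ) (f : ℝ → ℝ) (X₁ : ℝ) (X₂ : EReal) (u : ℝ → Plane → ℂ)
    (x' r' φ' : ℝ) : ℂ :=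
  Complex.I / (2 * k) * ∫ φ in (0 : ℝ)..(2 * Real.pi), ∫ x in axisUpTo X₁ X₂ x',
    kirchhoffIntegrand k f u x' r' φ' x φ

/-- The integrand of the directivity, in direction `θ'`, `φ'`. -/
def directivityIntegrand (k : ℂ) (f : ℝ → ℝ) (u : ℝ → Plane → ℂ) (θ' φ' x φ : ℝ) : ℂ :=
  ((θ' * Real.cos (φ - φ') - deriv f x : ℝ) : ℂ) *
    Complex.exp (Complex.I * k *
      ((-θ' * f x * Real.cos (φ' - φ) + x * θ' ^ 2 / 2 : ℝ) : ℂ)) *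
    surfaceField f u x φ * (f x : ℂ)

/-- The directivity of a body on the axis segment from `X₁` to `b`. -/
def directivity (k : ℂ) (f : ℝ → ℝ) (X₁ b : ℝ) (u : ℝ → Plane → ℂ) (θ' φ' : ℝ) : ℂ :=
  1 / 2 * ∫ φ in (0 : ℝ)..(2 * Real.pi), ∫ x in X₁..b, directivityIntegrand k f u θ' φ' x φ

/-- The amplitude `k / (2 π i L) exp (i k L θ'² / 2)` of the far field. -/
def farAmplitude (k : ℂ) (θ' L : ℝ) : ℂ :=
  k / (2 * Real.pi * Complex.I * (L : ℂ)) *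
    Complex.exp (Complex.I * k * ((L * θ' ^ 2 / 2 : ℝ) : ℂ))

end ParabolicScattering

end

namespace ParabolicScattering

/-! Suppose first that Im k > 0 and fix the observation point (xs, ys). The field satisfies ∂ₓu =
(i/2k)Δu, while Green's function, in its source point, solves the adjoint equation ∂ₓg = -(i/2k)Δg.
The integral P(x) of u g over the exterior part of the plane at x (`planeIntegral`) can therefore
change with x only through the surface. Where the plane cuts the body, Green's formula and N[u] = 0
give P'(x) = (i/2k) ∫ N̄[g] U f dφ (`surface_identity`); in slabs that miss the body P is constant
(`planeIntegral_const`). In front of the body P is the incident field at the observation point,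
because g propagates a plane wave into itself (`integral_kernel_mul_uIn`). As x tends to xs along
suitable planes, P tends to u(xs, ys), because g has mass 1 and an L¹ norm that does not depend on
xs - x (`approx_identity`). If P does not jump at the tips, integrating P' gives the reconstruction
formula (`eq_kirchhoff`).

The hypotheses give no direct access to Green's formula, so u g is multiplied by a cutoff depending
on x and ‖y‖². Since g solves the adjoint equation, only derivatives of the cutoff act as sources
(`cutoffSource`, `green_identity`). Three limits remove the cutoff. At infinity, Im k > 0 makes g a
Gaussian, while u grows at most exponentially, as the incident wave does; the outer cutoff costs
O(1/R²) (`green_identity_inner`). At the surface, the gradient of u is not assumed to have a limit;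
only N[u] is. One integration by parts puts the source into a form with the first derivative of the
cutoff alone (`flux`). That derivative concentrates on the surface, and there the flux is a
combination of u, which is continuous, and of N[u], which tends to 0 (`tendsto_flux`). At the tips
only Meixner's condition is available. The body lies in a cone there, so a cutoff of squared radius
τ in a slab of thickness of order τ covers it. Thin slabs carry little energy, and well chosen
planes in them do too, so the jump of P across the slab is arbitrarily small (`tip_crossing`). The
same condition and a trace inequality make the field integrable over the surface
(`integrableOn_surface`); as N̄[g] is bounded there (`exists_barNGreen_bound`), the integrand is
integrable.

For real k the first part follows from the formula for the absorbing fields, whose left-hand sides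
converge. Behind a finite body the kernel is bounded uniformly in the wavenumber, and uniform
convergence of the fields on the surface gives dominated convergence, so the formula itself holds
(`eq_kirchhoff_behind`). The far field is the expansion of the kernel in 1/(L - x), with an error
that is uniform over the surface (`exists_far_kernel_bound`). -/

/-- The coordinate vectors of the transversal plane. -/
noncomputable abbrev basisVec (i : Fin 2) : Plane := EuclideanSpace.single i (1 : ℝ)

/-! ### Plane geometry, directional derivatives and integration by parts -/

lemma norm_sq_plane (y : Plane) : ‖y‖ ^ 2 = y 0 ^ 2 + y 1 ^ 2 := by
  rw [EuclideanSpace.norm_sq_eq]; simp [Fin.sum_univ_two]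

lemma norm_sq_pol_sub_pol (r φ r' φ' : ℝ) :
    ‖pol r φ - pol r' φ'‖ ^ 2 = r' ^ 2 + r ^ 2 - 2 * r' * r * Real.cos (φ' - φ) := by
  rw [norm_sq_plane, Real.cos_sub]
  simp only [pol, PiLp.sub_apply]
  simp
  linear_combination r ^ 2 * Real.sin_sq_add_cos_sq φ + r' ^ 2 * Real.sin_sq_add_cos_sq φ'

lemma norm_pol (r φ : ℝ) : ‖pol r φ‖ = |r| := by
  have : ‖pol r φ‖ ^ 2 = r ^ 2 := by
    rw [norm_sq_plane]; simp only [pol]; simp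
    linear_combination r ^ 2 * Real.sin_sq_add_cos_sq φ
  rw [← Real.sqrt_sq (norm_nonneg _), this, Real.sqrt_sq_eq_abs]

lemma continuous_pol : Continuous fun q : ℝ × ℝ => pol q.1 q.2 := by
  unfold pol
  fun_prop

lemma hasLineDerivAt_norm_sq_sub (a y : Plane) (i : Fin 2) :
    HasLineDerivAt ℝ (fun y : Plane => ‖y - a‖ ^ 2) (2 * (y i - a i)) y (basisVec i) := by
  have h := ((hasStrictFDerivAt_norm_sq (y - a)).hasFDerivAt.comp y
    ((hasFDerivAt_id y).sub_const a)).hasLineDerivAt (basisVec i)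
  convert! h using 1
  simp [EuclideanSpace.inner_single_right]

lemma hasLineDerivAt_coord (y : Plane) (a : ℝ) (i : Fin 2) :
    HasLineDerivAt ℝ (fun y : Plane => y i - a) 1 y (basisVec i) := by
  have : HasDerivAt (fun t : ℝ => y i + t - a) 1 0 := by
    simpa using ((hasDerivAt_id (0:ℝ)).const_add (y i)).sub_const a
  simpa [HasLineDerivAt] using this

lemma _root_.HasLineDerivAt.comp_real {F : Type*} [NormedAddCommGroup F] [NormedSpace ℝ F]
    {f : Plane → ℝ} {f' : ℝ} {y v : Plane}
    {h : ℝ → F} {h' : F} (hh : HasDerivAt h h' (f y)) (hf : HasLineDerivAt ℝ f f' y v) :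
    HasLineDerivAt ℝ (fun y => h (f y)) (f' • h') y v := by
  unfold HasLineDerivAt at *
  exact HasDerivAt.scomp_of_eq (0:ℝ) hh hf (by simp)

lemma _root_.HasLineDerivAt.mulC {f g : Plane → ℂ} {f' g' : ℂ} {y v : Plane}
    (hf : HasLineDerivAt ℝ f f' y v) (hg : HasLineDerivAt ℝ g g' y v) :
    HasLineDerivAt ℝ (fun y => f y * g y) (f' * g y + f y * g') y v := by
  unfold HasLineDerivAt at *
  exact (HasDerivAt.mul hf hg).congr_deriv (by simp)

/-- A product is jointly continuous if the first factor is continuous on an open set `E` off which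
the second one vanishes locally. -/
lemma continuousOn_mul_of_vanish {X : Type*} [TopologicalSpace X] {E O : Set X} (hE : IsOpen E)
    (hO : IsOpen O)
    {φ c : X → ℂ} (hφ : ContinuousOn φ E) (hc : ContinuousOn c O)
    (h0 : ∀ p ∈ O, p ∉ E → ∀ᶠ q in 𝓝 p, c q = 0) : ContinuousOn (fun p => φ p * c p) O := by
  intro p hp
  apply ContinuousAt.continuousWithinAt
  by_cases h : p ∈ E
  · exact (hφ.continuousAt (hE.mem_nhds h)).mul (hc.continuousAt (hO.mem_nhds hp))
  · have : (fun _ => (0 : ℂ)) =ᶠ[𝓝 p] fun p => φ p * c p := by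
      filter_upwards [h0 p hp h] with q hq
      simp [hq]
    exact (continuousAt_const.congr this)

/-- Vanishing near every point outside `Ω`, and not only at the point, is what keeps the closed
support inside `Ω`. -/
lemma tsupport_subset_of_eventually {X : Type*} [TopologicalSpace X] {Ω : Set X} {ψ : X → ℂ}
    (h : ∀ y ∉ Ω, ∀ᶠ z in 𝓝 y, ψ z = 0) : tsupport ψ ⊆ Ω := by
  intro y hy
  by_contra hn
  exact (notMem_tsupport_iff_eventuallyEq.2 (h y hn)) hy

lemma tsupport_lineDeriv_subset {ψ ψ1 : Plane → ℂ} {e : Plane}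
    (h : ∀ y, HasLineDerivAt ℝ ψ (ψ1 y) y e) : tsupport ψ1 ⊆ tsupport ψ := by
  apply tsupport_subset_of_eventually
  intro y hy
  have := (notMem_tsupport_iff_eventuallyEq.1 hy).eventually_nhds
  filter_upwards [this] with z hz
  have h1 : HasLineDerivAt ℝ ψ 0 z e := by
    have : HasLineDerivAt ℝ (fun _ : Plane => (0:ℂ)) 0 z e := by
      unfold HasLineDerivAt
      exact hasDerivAt_const _ _
    exact HasLineDerivAt.congr_of_eventuallyEq this hz
  rw [← (h z).lineDeriv, h1.lineDeriv]

lemma integrable_mul_of_tsupport {ψ w : Plane → ℂ} {Ω : Set Plane} (hΩ : IsOpen Ω)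
    (hψ : Continuous ψ) (hw : ContinuousOn w Ω) (hc : HasCompactSupport ψ)
    (hs : tsupport ψ ⊆ Ω) : Integrable (fun y => ψ y * w y) := by
  refine Continuous.integrable_of_hasCompactSupport ?_ hc.mul_right
  refine ContinuousOn.continuous_of_tsupport_subset (hψ.continuousOn.mul hw) hΩ ?_
  exact (tsupport_mul_subset_left).trans hs

/-- `ψ` has compact support in `Ω`, so no boundary term arises although `w` is arbitrary outside
`Ω`. In this way the field, which means nothing inside the body, can be integrated over the whole
plane. -/
lemma integral_mul_lineDeriv {w w1 ψ ψ1 e} {Ω : Set Plane} (hΩ : IsOpen Ω)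
    (hw : ∀ y ∈ Ω, HasLineDerivAt ℝ w (w1 y) y e)
    (cw : ContinuousOn w Ω) (cw1 : ContinuousOn w1 Ω)
    (hψ : ∀ y : Plane, HasLineDerivAt ℝ ψ (ψ1 y) y e) (cψ : Continuous ψ) (cψ1 : Continuous ψ1)
    (hc : HasCompactSupport ψ) (hs : tsupport ψ ⊆ Ω) :
    ∫ y, ψ y * w1 y = -∫ y, ψ1 y * (w y : ℂ) := by
  have hs1 := tsupport_lineDeriv_subset hψ
  exact integral_bilinear_hasLineDerivAt_right_eq_neg_left_of_integrable
    (B := ContinuousLinearMap.mul ℝ ℂ) (v := e)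
    (integrable_mul_of_tsupport hΩ cψ1 cw (hc.mono' (subset_tsupport _ |>.trans hs1))
      (hs1.trans hs))
    (integrable_mul_of_tsupport hΩ cψ cw1 hc hs) (integrable_mul_of_tsupport hΩ cψ cw hc hs)
    (fun y _ => hψ y) (fun y hy => hw y (hs hy))

lemma integral_mul_lineDeriv_twice {w w1 w2 ψ ψ1 ψ2 e} {Ω : Set Plane} (hΩ : IsOpen Ω)
    (hw : ∀ y ∈ Ω, HasLineDerivAt ℝ w (w1 y) y e)
    (hw1 : ∀ y ∈ Ω, HasLineDerivAt ℝ w1 (w2 y) y e)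
    (cw : ContinuousOn w Ω) (cw1 : ContinuousOn w1 Ω) (cw2 : ContinuousOn w2 Ω)
    (hψ : ∀ y : Plane, HasLineDerivAt ℝ ψ (ψ1 y) y e)
    (hψ1 : ∀ y : Plane, HasLineDerivAt ℝ ψ1 (ψ2 y) y e)
    (cψ : Continuous ψ) (cψ1 : Continuous ψ1) (cψ2 : Continuous ψ2)
    (hc : HasCompactSupport ψ) (hs : tsupport ψ ⊆ Ω) :
    ∫ y, ψ y * w2 y = ∫ y, ψ2 y * (w y : ℂ) := by
  have hs1 := tsupport_lineDeriv_subset hψ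
  rw [integral_mul_lineDeriv hΩ hw1 cw1 cw2 hψ cψ cψ1 hc hs,
    integral_mul_lineDeriv hΩ hw cw cw1 hψ1 cψ1 cψ2
      (hc.mono' (subset_tsupport _ |>.trans hs1)) (hs1.trans hs), neg_neg]

lemma laplacian_eq_sum (w : Plane → ℂ) (y : Plane) :
    (Laplacian.laplacian w : Plane → ℂ) y =
      ∑ i, iteratedFDeriv ℝ 2 w y ![basisVec i, basisVec i] := by
  rw [InnerProductSpace.laplacian_eq_iteratedFDeriv_orthonormalBasis w
    (EuclideanSpace.basisFun (Fin 2) ℝ)]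
  simp

lemma hasLineDerivAt_fderiv_apply {w : Plane → ℂ} {y : Plane} (h : ContDiffAt ℝ 2 w y)
    (e : Plane) :
    HasLineDerivAt ℝ (fun y => fderiv ℝ w y e) (iteratedFDeriv ℝ 2 w y ![e, e]) y e := by
  have h1 : DifferentiableAt ℝ (fderiv ℝ w) y :=
    (h.fderiv_right (m := 1) (by norm_num)).differentiableAt (by norm_num)
  have h2 := (h1.hasFDerivAt.clm_apply (hasFDerivAt_const e y)).hasLineDerivAt e
  convert! h2 using 1
  simp [iteratedFDeriv_two_apply]

/-! ### Green's function, and the exterior as an open set -/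

/-- Green's function, in Cartesian coordinates of the transversal plane. -/
noncomputable def kernel (k : ℂ) (xs : ℝ) (ys : Plane) (x : ℝ) (y : Plane) : ℂ :=
  k / (2 * Real.pi * Complex.I * ((xs - x : ℝ) : ℂ)) *
    Complex.exp (Complex.I * k / (2 * ((xs - x : ℝ) : ℂ)) * ((‖y - ys‖ ^ 2 : ℝ) : ℂ))

lemma hasLineDerivAt_kernel (k : ℂ) {xs x : ℝ} (hx : x < xs) (ys y : Plane) (i : Fin 2) :
    HasLineDerivAt ℝ (kernel k xs ys x)
      (kernel k xs ys x y * (Complex.I * k / ((xs - x : ℝ) : ℂ) * ((y i - ys i : ℝ) : ℂ)))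
      y (basisVec i) := by
  have hs : ((xs - x : ℝ) : ℂ) ≠ 0 := by exact_mod_cast (sub_pos.2 hx).ne'
  have h1 : HasDerivAt (fun t : ℝ => k / (2 * Real.pi * Complex.I * ((xs - x : ℝ) : ℂ)) *
    Complex.exp (Complex.I * k / (2 * ((xs - x : ℝ) : ℂ)) * (t : ℂ)))
      (k / (2 * Real.pi * Complex.I * ((xs - x : ℝ) : ℂ)) *
      (Complex.exp (Complex.I * k / (2 * ((xs - x : ℝ) : ℂ)) * ((‖y - ys‖ ^ 2 : ℝ) : ℂ)) *
       (Complex.I * k / (2 * ((xs - x : ℝ) : ℂ)) * 1))) (‖y - ys‖ ^ 2) := by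
    refine HasDerivAt.const_mul _ (HasDerivAt.cexp ?_)
    exact HasDerivAt.const_mul _ (hasDerivAt_id _).ofReal_comp
  have := HasLineDerivAt.comp_real (f := fun y : Plane => ‖y - ys‖ ^ 2) h1
    (hasLineDerivAt_norm_sq_sub ys y i)
  convert! this using 1
  simp only [kernel, Complex.real_smul]
  generalize ((xs - x : ℝ) : ℂ) = s at *
  push_cast
  field_simp

lemma hasDerivAt_kernel (k : ℂ) {xs x : ℝ} (hx : x < xs) (ys y : Plane) :
    HasDerivAt (fun x => kernel k xs ys x y)
      (kernel k xs ys x y * (1 / ((xs - x : ℝ) : ℂ) + Complex.I * k / 2 *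
        ((‖y - ys‖ ^ 2 : ℝ) : ℂ) / ((xs - x : ℝ) : ℂ) ^ 2)) x := by
  have hs : ((xs - x : ℝ) : ℂ) ≠ 0 := by exact_mod_cast (sub_pos.2 hx).ne'
  have hS : HasDerivAt (fun x : ℝ => ((xs - x : ℝ) : ℂ)) (-1) x := by
    simpa using ((hasDerivAt_id x).const_sub xs).ofReal_comp
  have hpi : (Real.pi : ℂ) ≠ 0 := by exact_mod_cast Real.pi_ne_zero
  have h1 := ((hasDerivAt_const x k).div (hS.const_mul (2 * Real.pi * Complex.I))
    (mul_ne_zero (by simp [hpi]) hs)).mul (((((hasDerivAt_const x (Complex.I * k)).div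
      (hS.const_mul 2) (mul_ne_zero two_ne_zero hs)).mul_const ((‖y - ys‖ ^ 2 : ℝ) : ℂ))).cexp)
  refine h1.congr_deriv ?_
  simp only [kernel]
  have hI := Complex.I_ne_zero
  simp only [Pi.div_apply]
  generalize ((xs - x : ℝ) : ℂ) = s at *
  generalize Complex.exp _ = E
  field_simp
  ring

lemma continuousOn_kernel (k : ℂ) (xs : ℝ) (ys : Plane) :
    ContinuousOn (fun p : ℝ × Plane => kernel k xs ys p.1 p.2) (Set.Iio xs ×ˢ Set.univ) := by
  have hpi : (Real.pi : ℂ) ≠ 0 := by exact_mod_cast Real.pi_ne_zero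
  have hs : ∀ p ∈ Set.Iio xs ×ˢ (Set.univ : Set Plane), ((xs - p.1 : ℝ) : ℂ) ≠ 0 := fun p hp => by
    exact_mod_cast (sub_pos.2 hp.1).ne'
  unfold kernel
  refine ContinuousOn.mul ?_ (ContinuousOn.cexp (ContinuousOn.mul ?_ ?_))
  · exact ContinuousOn.div (by fun_prop) (by fun_prop) fun p hp => 
      mul_ne_zero (by simp [hpi]) (hs p hp)
  · exact ContinuousOn.div (by fun_prop) (by fun_prop) fun p hp => 
      mul_ne_zero two_ne_zero (hs p hp)
  · fun_prop

/-- The complement is closed because `f` is continuous on the closed axis segment, tips included. -/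
lemma isOpen_exterior {f : ℝ → ℝ} {X₁ : ℝ} {X₂ : EReal} (hf : IsProfile f X₁ X₂) :
    IsOpen (exterior f X₁ X₂) := by
  rw [← isClosed_compl_iff]
  have hc : IsClosed {x : ℝ | X₁ ≤ x ∧ (x : EReal) ≤ X₂} :=
    (isClosed_Ici).inter (isClosed_Iic.preimage continuous_coe_real_ereal)
  have h1 : (exterior f X₁ X₂)ᶜ =
      {p : ℝ × Plane | p.1 ∈ {x : ℝ | X₁ ≤ x ∧ (x : EReal) ≤ X₂} ∧ ‖p.2‖ ≤ f p.1} := by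
    ext p
    simp [exterior, and_assoc]
  rw [h1]
  have := (hc.preimage (continuous_fst (X := ℝ) (Y := Plane))).isClosed_le
    (f := fun p => ‖p.2‖) (g := fun p => f p.1) (by fun_prop)
    (ContinuousOn.comp (g := f) (f := Prod.fst) hf.continuousOn continuousOn_fst fun p hp => hp)
  exact this

lemma isOpen_offTips {f : ℝ → ℝ} {X₁ : ℝ} {X₂ : EReal} (hf : IsProfile f X₁ X₂) :
    IsOpen (offTips f X₁ X₂) := by
  refine (isOpen_exterior hf).inter (IsOpen.inter ?_ ?_)
  · exact isOpen_ne.preimage (continuous_fst (X := ℝ) (Y := Plane))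
  · exact isOpen_ne.preimage (continuous_coe_real_ereal.comp (continuous_fst (X := ℝ) (Y := Plane)))

/-! ### Radial cutoffs multiplied by Green's function -/

/-- A cutoff `H x (‖y‖ ^ 2)`, for `x` in the open set `J`, which vanishes near the complement of `E`
and for large `‖y‖`; the other functions are its derivatives. -/
structure IsCutoff (J : Set ℝ) (E : Set (ℝ × Plane)) (H Hx Hs Hss : ℝ → ℝ → ℝ) : Prop where
  isOpen : IsOpen J
  cont : ContinuousOn (fun q : ℝ × ℝ => H q.1 q.2) (J ×ˢ Set.univ)
  cont_x : ContinuousOn (fun q : ℝ × ℝ => Hx q.1 q.2) (J ×ˢ Set.univ)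
  cont_s : ContinuousOn (fun q : ℝ × ℝ => Hs q.1 q.2) (J ×ˢ Set.univ)
  cont_ss : ContinuousOn (fun q : ℝ × ℝ => Hss q.1 q.2) (J ×ˢ Set.univ)
  deriv_x : ∀ x ∈ J, ∀ s, HasDerivAt (fun x => H x s) (Hx x s) x
  deriv_s : ∀ x ∈ J, ∀ s, HasDerivAt (H x) (Hs x s) s
  deriv_ss : ∀ x ∈ J, ∀ s, HasDerivAt (Hs x) (Hss x s) s
  vanish : ∀ x ∈ J, ∀ y : Plane, (x, y) ∉ E → ∀ᶠ q : ℝ × ℝ in 𝓝 (x, ‖y‖ ^ 2),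
    H q.1 q.2 = 0 ∧ Hx q.1 q.2 = 0 ∧ Hs q.1 q.2 = 0 ∧ Hss q.1 q.2 = 0
  bounded : ∃ r : ℝ, 0 ≤ r ∧ ∀ x ∈ J, ∀ s, r ^ 2 < s →
    H x s = 0 ∧ Hx x s = 0 ∧ Hs x s = 0 ∧ Hss x s = 0

/-- `y ⬝ (y - a)`. -/
def dotSub (a y : Plane) : ℝ := y 0 * (y 0 - a 0) + y 1 * (y 1 - a 1)

lemma continuous_dotSub (a : Plane) : Continuous (dotSub a) := by
  unfold dotSub; fun_prop

/-- The function into which the backward parabolic operator takes the product of a cutoff and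
Green's function. -/
noncomputable def cutoffSource (k : ℂ) (xs : ℝ) (ys : Plane) (Hx Hs Hss : ℝ → ℝ → ℝ) (x : ℝ)
    (y : Plane) : ℂ :=
  kernel k xs ys x y * ((Hx x (‖y‖ ^ 2) : ℂ) + Complex.I / (2 * k) *
    (4 * (Hs x (‖y‖ ^ 2) : ℂ) + 4 * ((‖y‖ ^ 2 : ℝ) : ℂ) * (Hss x (‖y‖ ^ 2) : ℂ) +
      4 * (Hs x (‖y‖ ^ 2) : ℂ) * (Complex.I * k / ((xs - x : ℝ) : ℂ)) * (dotSub ys y : ℂ)))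

section

variable {J : Set ℝ} {E : Set (ℝ × Plane)} {H Hx Hs Hss : ℝ → ℝ → ℝ}

lemma continuousOn_radial {G : ℝ → ℝ → ℝ}
    (h : ContinuousOn (fun q : ℝ × ℝ => G q.1 q.2) (J ×ˢ Set.univ)) :
    ContinuousOn (fun p : ℝ × Plane => (G p.1 (‖p.2‖ ^ 2) : ℂ)) (J ×ˢ Set.univ) := by
  refine Complex.continuous_ofReal.comp_continuousOn ?_
  exact h.comp (f := fun p : ℝ × Plane => (p.1, ‖p.2‖ ^ 2)) (by fun_prop) fun p hp => ⟨hp.1, trivial⟩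

lemma tendsto_radial (x : ℝ) (y : Plane) :
    Tendsto (fun p : ℝ × Plane => (p.1, ‖p.2‖ ^ 2)) (𝓝 (x, y)) (𝓝 (x, ‖y‖ ^ 2)) :=
  Continuous.tendsto (by fun_prop) (x, y)

lemma IsCutoff.continuousOn_source (h : IsCutoff J E H Hx Hs Hss) (k : ℂ) {xs : ℝ}
    (hJ : J ⊆ Set.Iio xs) (ys : Plane) :
    ContinuousOn (fun p : ℝ × Plane => cutoffSource k xs ys Hx Hs Hss p.1 p.2)
      (J ×ˢ Set.univ) := by
  have hk := (continuousOn_kernel k xs ys).mono (Set.prod_mono hJ (subset_refl _))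
  have hs : ∀ p ∈ J ×ˢ (Set.univ : Set Plane), ((xs - p.1 : ℝ) : ℂ) ≠ 0 := fun p hp => by
    exact_mod_cast (sub_pos.2 (hJ hp.1)).ne'
  unfold cutoffSource
  have h1 := continuousOn_radial h.cont_x
  have h2 := continuousOn_radial h.cont_s
  have h3 := continuousOn_radial h.cont_ss
  have h4 : ContinuousOn (fun p : ℝ × Plane => Complex.I * k / ((xs - p.1 : ℝ) : ℂ))
      (J ×ˢ Set.univ) := ContinuousOn.div (by fun_prop) (by fun_prop) hs
  have h5 : ContinuousOn (fun p : ℝ × Plane => (dotSub ys p.2 : ℂ)) (J ×ˢ Set.univ) :=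
    (Complex.continuous_ofReal.comp ((continuous_dotSub ys).comp continuous_snd)).continuousOn
  have h6 : ContinuousOn (fun p : ℝ × Plane => ((‖p.2‖ ^ 2 : ℝ) : ℂ)) (J ×ˢ Set.univ) := by
    fun_prop
  exact hk.mul (h1.add (continuousOn_const.mul (((continuousOn_const.mul h2).add
    ((continuousOn_const.mul h6).mul h3)).add (((continuousOn_const.mul h2).mul h4).mul h5))))

lemma hasLineDerivAt_radial {G : ℝ → ℝ} {G' : ℝ} {y : Plane} (h : HasDerivAt G G' (‖y‖ ^ 2))
    (i : Fin 2) :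
    HasLineDerivAt ℝ (fun y : Plane => (G (‖y‖ ^ 2) : ℂ)) (2 * (y i : ℂ) * (G' : ℂ)) y
      (basisVec i) := by
  have h1 := hasLineDerivAt_norm_sq_sub 0 y i
  simp only [sub_zero] at h1
  have := HasLineDerivAt.comp_real (f := fun y : Plane => ‖y‖ ^ 2) h.ofReal_comp h1
  convert! this using 1
  simp

lemma hasLineDerivAt_coordC (y : Plane) (a : ℝ) (i : Fin 2) :
    HasLineDerivAt ℝ (fun y : Plane => ((y i - a : ℝ) : ℂ)) 1 y (basisVec i) := by
  have := HasLineDerivAt.comp_real (h := fun t : ℝ => (t : ℂ)) (h' := 1)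
    (f := fun y : Plane => y i - a) (hasDerivAt_id _).ofReal_comp (hasLineDerivAt_coord y a i)
  convert! this using 1
  simp

lemma HasLineDerivAt.congr_value {g : Plane → ℂ} {a b : ℂ} {y v : Plane}
    (h : HasLineDerivAt ℝ g a y v) (hab : a = b) : HasLineDerivAt ℝ g b y v := hab ▸ h

lemma hasLineDerivAt_const_mulC {f : Plane → ℂ} {f' : ℂ} {y v : Plane} (c : ℂ)
    (hf : HasLineDerivAt ℝ f f' y v) : HasLineDerivAt ℝ (fun y => c * f y) (c * f') y v := by
  unfold HasLineDerivAt at *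
  exact hf.const_mul c

lemma hasLineDerivAt_addC {f g : Plane → ℂ} {f' g' : ℂ} {y v : Plane}
    (hf : HasLineDerivAt ℝ f f' y v) (hg : HasLineDerivAt ℝ g g' y v) :
    HasLineDerivAt ℝ (fun y => f y + g y) (f' + g') y v := by
  unfold HasLineDerivAt at *
  exact hf.add hg

/-- First derivatives of the product of a cutoff and Green's function. -/
noncomputable def cutoffKernelD (k : ℂ) (xs : ℝ) (ys : Plane) (H Hs : ℝ → ℝ → ℝ) (x : ℝ) (i : Fin 2)
    (y : Plane) : ℂ :=
  kernel k xs ys x y * (2 * ((y i - 0 : ℝ) : ℂ) * (Hs x (‖y‖ ^ 2) : ℂ) + (H x (‖y‖ ^ 2) : ℂ) *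
    (Complex.I * k / ((xs - x : ℝ) : ℂ) * ((y i - ys i : ℝ) : ℂ)))

/-- Second derivatives of the product of a cutoff and Green's function. -/
noncomputable def cutoffKernelDD (k : ℂ) (xs : ℝ) (ys : Plane) (H Hs Hss : ℝ → ℝ → ℝ) (x : ℝ)
    (i : Fin 2) (y : Plane) : ℂ :=
  kernel k xs ys x y * (2 * (Hs x (‖y‖ ^ 2) : ℂ) + 4 * (y i : ℂ) ^ 2 * (Hss x (‖y‖ ^ 2) : ℂ) +
    4 * (y i : ℂ) * (Hs x (‖y‖ ^ 2) : ℂ) *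
      (Complex.I * k / ((xs - x : ℝ) : ℂ) * ((y i - ys i : ℝ) : ℂ)) +
    (H x (‖y‖ ^ 2) : ℂ) * ((Complex.I * k / ((xs - x : ℝ) : ℂ) * ((y i - ys i : ℝ) : ℂ)) ^ 2 +
      Complex.I * k / ((xs - x : ℝ) : ℂ)))

lemma IsCutoff.hasLineDerivAt (h : IsCutoff J E H Hx Hs Hss) (k : ℂ) {xs x : ℝ} (ys : Plane)
    (hx : x ∈ J) (hxs : x < xs) (i : Fin 2) (y : Plane) :
    HasLineDerivAt ℝ (fun y => kernel k xs ys x y * (H x (‖y‖ ^ 2) : ℂ))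
      (cutoffKernelD k xs ys H Hs x i y) y (basisVec i) := by
  refine HasLineDerivAt.congr_value ((hasLineDerivAt_kernel k hxs ys y i).mulC
    (hasLineDerivAt_radial (h.deriv_s x hx _) i)) ?_
  simp only [cutoffKernelD, sub_zero]
  ring

lemma IsCutoff.hasLineDerivAt_D (h : IsCutoff J E H Hx Hs Hss) (k : ℂ) {xs x : ℝ} (ys : Plane)
    (hx : x ∈ J) (hxs : x < xs) (i : Fin 2) (y : Plane) :
    HasLineDerivAt ℝ (cutoffKernelD k xs ys H Hs x i)
      (cutoffKernelDD k xs ys H Hs Hss x i y) y (basisVec i) := by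
  have h1 := (hasLineDerivAt_const_mulC 2 (hasLineDerivAt_coordC y 0 i)).mulC
    (hasLineDerivAt_radial (h.deriv_ss x hx (‖y‖ ^ 2)) i)
  have h2 := (hasLineDerivAt_radial (h.deriv_s x hx (‖y‖ ^ 2)) i).mulC
    (hasLineDerivAt_const_mulC (Complex.I * k / ((xs - x : ℝ) : ℂ))
      (hasLineDerivAt_coordC y (ys i) i))
  refine HasLineDerivAt.congr_value ((hasLineDerivAt_kernel k hxs ys y i).mulC
    (hasLineDerivAt_addC h1 h2)) ?_
  simp only [cutoffKernelDD, sub_zero]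
  ring

lemma continuous_slice {G : ℝ → Plane → ℂ} {x : ℝ} (hx : x ∈ J)
    (h : ContinuousOn (fun p : ℝ × Plane => G p.1 p.2) (J ×ˢ Set.univ)) : Continuous (G x) := by
  rw [← continuousOn_univ]
  exact h.comp (f := fun y : Plane => (x, y)) (by fun_prop) fun y _ => ⟨hx, trivial⟩

lemma continuous_kernel (k : ℂ) {xs x : ℝ} (hx : x < xs) (ys : Plane) :
    Continuous (kernel k xs ys x) :=
  continuous_slice (J := Set.Iio xs) hx (continuousOn_kernel k xs ys)

lemma IsCutoff.continuous_D (h : IsCutoff J E H Hx Hs Hss) (k : ℂ) {xs x : ℝ} (ys : Plane)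
    (hx : x ∈ J) (hxs : x < xs) (i : Fin 2) : Continuous (cutoffKernelD k xs ys H Hs x i) := by
  unfold cutoffKernelD
  have h1 := continuous_slice hx (G := fun x y => (H x (‖y‖ ^ 2) : ℂ)) (continuousOn_radial h.cont)
  have h2 := continuous_slice hx (G := fun x y => (Hs x (‖y‖ ^ 2) : ℂ))
    (continuousOn_radial h.cont_s)
  have h3 := continuous_kernel k hxs ys
  fun_prop

lemma IsCutoff.continuous_DD (h : IsCutoff J E H Hx Hs Hss) (k : ℂ) {xs x : ℝ} (ys : Plane)
    (hx : x ∈ J) (hxs : x < xs) (i : Fin 2) :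
    Continuous (cutoffKernelDD k xs ys H Hs Hss x i) := by
  unfold cutoffKernelDD
  have h1 := continuous_slice hx (G := fun x y => (H x (‖y‖ ^ 2) : ℂ)) (continuousOn_radial h.cont)
  have h2 := continuous_slice hx (G := fun x y => (Hs x (‖y‖ ^ 2) : ℂ))
    (continuousOn_radial h.cont_s)
  have h2 := continuous_slice hx (G := fun x y => (Hss x (‖y‖ ^ 2) : ℂ))
    (continuousOn_radial h.cont_ss)
  have h3 := continuous_kernel k hxs ys
  fun_prop

lemma IsCutoff.eventually_zero (h : IsCutoff J E H Hx Hs Hss) {x : ℝ} (hx : x ∈ J) {y : Plane}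
    (hy : (x, y) ∉ E) : ∀ᶠ p : ℝ × Plane in 𝓝 (x, y), H p.1 (‖p.2‖ ^ 2) = 0 ∧
      Hx p.1 (‖p.2‖ ^ 2) = 0 ∧ Hs p.1 (‖p.2‖ ^ 2) = 0 ∧ Hss p.1 (‖p.2‖ ^ 2) = 0 :=
  (tendsto_radial x y).eventually (h.vanish x hx y hy)

lemma IsCutoff.eventually_zero_slice (h : IsCutoff J E H Hx Hs Hss) {x : ℝ} (hx : x ∈ J) {y : Plane}
    (hy : (x, y) ∉ E) : ∀ᶠ z in 𝓝 y, H x (‖z‖ ^ 2) = 0 ∧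
      Hx x (‖z‖ ^ 2) = 0 ∧ Hs x (‖z‖ ^ 2) = 0 ∧ Hss x (‖z‖ ^ 2) = 0 :=
  (Continuous.tendsto (f := fun z : Plane => (x, z)) (by fun_prop) y).eventually
    (h.eventually_zero hx hy)

lemma IsCutoff.hasCompactSupport (h : IsCutoff J E H Hx Hs Hss) {x : ℝ} (hx : x ∈ J)
    {ψ : Plane → ℂ}
    (h0 : ∀ y : Plane, (H x (‖y‖ ^ 2) = 0 ∧ Hx x (‖y‖ ^ 2) = 0 ∧ Hs x (‖y‖ ^ 2) = 0 ∧
      Hss x (‖y‖ ^ 2) = 0) → ψ y = 0) : HasCompactSupport ψ := by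
  obtain ⟨r, hr, h1⟩ := h.bounded
  refine HasCompactSupport.intro (isCompact_closedBall (0 : Plane) r) fun y hy => ?_
  refine h0 y (h1 x hx _ ?_)
  rw [mem_closedBall_zero_iff, not_le] at hy
  exact pow_lt_pow_left₀ hy hr two_ne_zero

end

/-! ### Green's identity with a compactly supported cutoff -/

section

variable {k : ℂ} {θ : ℝ} {f : ℝ → ℝ} {X₁ : ℝ} {X₂ : EReal} {u : ℝ → Plane → ℂ}
  {J : Set ℝ} {H Hx Hs Hss : ℝ → ℝ → ℝ}

lemma slice_offTips {x : ℝ} (h1 : x ≠ X₁) (h2 : (x : EReal) ≠ X₂) {y : Plane}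
    (hy : (x, y) ∈ exterior f X₁ X₂) : (x, y) ∈ offTips f X₁ X₂ := ⟨hy, h1, h2⟩

lemma isOpen_slice (hf : IsProfile f X₁ X₂) (x : ℝ) : IsOpen {y : Plane | (x, y) ∈ offTips f X₁ X₂} :=
  (isOpen_offTips hf).preimage (f := fun y : Plane => (x, y)) (by fun_prop)

lemma IsTotalField.continuousOn_offTips (hu : IsTotalField k θ f X₁ X₂ u) :
    ContinuousOn (fun p : ℝ × Plane => u p.1 p.2) (offTips f X₁ X₂) :=
  hu.continuousOn.mono fun _ hp => Or.inl hp.1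

lemma continuousOn_slice {G : ℝ × Plane → ℂ}
    (h : ContinuousOn G (offTips f X₁ X₂)) (x : ℝ) :
    ContinuousOn (fun y => G (x, y)) {y : Plane | (x, y) ∈ offTips f X₁ X₂} :=
  h.comp (f := fun y : Plane => (x, y)) (by fun_prop) fun _ hy => hy

/-- The Laplacian of the field can be moved to a cutoff Green's function. -/
lemma IsTotalField.integral_laplacian (hf : IsProfile f X₁ X₂) (hu : IsTotalField k θ f X₁ X₂ u)
    (hH : IsCutoff J (exterior f X₁ X₂) H Hx Hs Hss) {xs x : ℝ} (ys : Plane) (hx : x ∈ J)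
    (hxs : x < xs) (h1 : x ≠ X₁) (h2 : (x : EReal) ≠ X₂) :
    ∫ y, kernel k xs ys x y * (H x (‖y‖ ^ 2) : ℂ) * (Laplacian.laplacian (u x) : Plane → ℂ) y =
      ∫ y, (∑ i, cutoffKernelDD k xs ys H Hs Hss x i y) * u x y := by
  set Ω := {y : Plane | (x, y) ∈ offTips f X₁ X₂}
  have hΩ : IsOpen Ω := isOpen_slice hf x
  have hout : ∀ y ∉ Ω, (x, y) ∉ exterior f X₁ X₂ := fun y hy hy' =>
    hy (slice_offTips h1 h2 hy')
  have cu := continuousOn_slice hu.continuousOn_offTips x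
  have cu1 : ∀ e, ContinuousOn (fun y => fderiv ℝ (u x) y e) Ω := fun e =>
    continuousOn_slice (G := fun p => fderiv ℝ (u p.1) p.2 e)
      (hu.continuousOn_grad.clm_apply continuousOn_const) x
  have cu2 : ∀ e, ContinuousOn (fun y => iteratedFDeriv ℝ 2 (u x) y ![e, e]) Ω := fun e =>
    continuousOn_slice (G := fun p => iteratedFDeriv ℝ 2 (u p.1) p.2 ![e, e])
      ((ContinuousMultilinearMap.apply ℝ (fun _ : Fin 2 => Plane) ℂ ![e, e]).continuous.comp_continuousOn
        hu.continuousOn_hess) x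
  have cψ : Continuous fun y => kernel k xs ys x y * (H x (‖y‖ ^ 2) : ℂ) :=
    (continuous_kernel k hxs ys).mul
      (continuous_slice hx (G := fun x y => (H x (‖y‖ ^ 2) : ℂ)) (continuousOn_radial hH.cont))
  have hψs : tsupport (fun y => kernel k xs ys x y * (H x (‖y‖ ^ 2) : ℂ)) ⊆ Ω := by
    refine tsupport_subset_of_eventually fun y hy => ?_
    filter_upwards [hH.eventually_zero_slice hx (hout y hy)] with z hz
    simp [hz.1]
  have hψc : HasCompactSupport (fun y => kernel k xs ys x y * (H x (‖y‖ ^ 2) : ℂ)) :=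
    hH.hasCompactSupport hx fun y hy => by simp [hy.1]
  have hDc : ∀ i, HasCompactSupport (cutoffKernelDD k xs ys H Hs Hss x i) := fun i =>
    hH.hasCompactSupport hx fun y hy => by simp [cutoffKernelDD, hy]
  have hDs : ∀ i, tsupport (cutoffKernelDD k xs ys H Hs Hss x i) ⊆ Ω := fun i => by
    refine tsupport_subset_of_eventually fun y hy => ?_
    filter_upwards [hH.eventually_zero_slice hx (hout y hy)] with z hz
    simp [cutoffKernelDD, hz]
  have key : ∀ i, ∫ y, kernel k xs ys x y * (H x (‖y‖ ^ 2) : ℂ) *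
      iteratedFDeriv ℝ 2 (u x) y ![basisVec i, basisVec i] =
      ∫ y, cutoffKernelDD k xs ys H Hs Hss x i y * u x y := fun i =>
    integral_mul_lineDeriv_twice (e := basisVec i) hΩ
      (fun y hy => ((hu.contDiffAt (x, y) hy).differentiableAt
        (by norm_num)).hasFDerivAt.hasLineDerivAt _)
      (fun y hy => hasLineDerivAt_fderiv_apply (hu.contDiffAt (x, y) hy) _) cu (cu1 _) (cu2 _)
      (hH.hasLineDerivAt k ys hx hxs i) (hH.hasLineDerivAt_D k ys hx hxs i) cψ
      (hH.continuous_D k ys hx hxs i) (hH.continuous_DD k ys hx hxs i) hψc hψs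
  simp_rw [laplacian_eq_sum, Finset.mul_sum, Finset.sum_mul]
  rw [integral_finsetSum, integral_finsetSum]
  · exact Finset.sum_congr rfl fun i _ => key i
  · exact fun i _ => integrable_mul_of_tsupport hΩ (hH.continuous_DD k ys hx hxs i) cu (hDc i) (hDs i)
  · exact fun i _ => integrable_mul_of_tsupport hΩ cψ (cu2 _) hψc hψs

/-- Green's function solves the adjoint equation, so the terms proportional to `H` cancel and only
those with a derivative of `H` survive. -/
lemma sum_cutoffKernelDD (hk : k ≠ 0) {xs x : ℝ} (hxs : x < xs) (ys y : Plane) :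
    Complex.I / (2 * k) * ∑ i, cutoffKernelDD k xs ys H Hs Hss x i y +
      kernel k xs ys x y * (Hx x (‖y‖ ^ 2) : ℂ) + kernel k xs ys x y *
        (1 / ((xs - x : ℝ) : ℂ) + Complex.I * k / 2 *
        ((‖y - ys‖ ^ 2 : ℝ) : ℂ) / ((xs - x : ℝ) : ℂ) ^ 2) * (H x (‖y‖ ^ 2) : ℂ) =
      cutoffSource k xs ys Hx Hs Hss x y := by
  have hs : ((xs - x : ℝ) : ℂ) ≠ 0 := by exact_mod_cast (sub_pos.2 hxs).ne'
  simp only [cutoffKernelDD, cutoffSource, Fin.sum_univ_two, dotSub]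
  rw [norm_sq_plane (y - ys)]
  generalize (H x (‖y‖ ^ 2)) = A
  generalize (Hs x (‖y‖ ^ 2)) = B
  generalize (Hss x (‖y‖ ^ 2)) = C
  generalize (Hx x (‖y‖ ^ 2)) = A'
  rw [norm_sq_plane y]
  generalize ((xs - x : ℝ) : ℂ) = s at *
  generalize kernel k xs ys x y = g
  simp only [PiLp.sub_apply]
  push_cast
  have hI : Complex.I ^ 2 = -1 := Complex.I_sq
  field_simp
  linear_combination g * A * k * (Complex.I * k * ((y 0 - ys 0 : ℂ) ^ 2 + (y 1 - ys 1 : ℂ) ^ 2) +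
    2 * s) * hI

end

section

variable {k : ℂ} {θ : ℝ} {f : ℝ → ℝ} {X₁ : ℝ} {X₂ : EReal} {u : ℝ → Plane → ℂ}
  {J : Set ℝ} {H Hx Hs Hss : ℝ → ℝ → ℝ}

lemma continuousOn_kernel_mul_radial (k : ℂ) {xs : ℝ} (hJ : J ⊆ Set.Iio xs) (ys : Plane) {G : ℝ → ℝ → ℝ}
    (h : ContinuousOn (fun q : ℝ × ℝ => G q.1 q.2) (J ×ˢ Set.univ)) :
    ContinuousOn (fun p : ℝ × Plane => kernel k xs ys p.1 p.2 * (G p.1 (‖p.2‖ ^ 2) : ℂ))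
      (J ×ˢ Set.univ) :=
  ((continuousOn_kernel k xs ys).mono (Set.prod_mono hJ (subset_refl _))).mul
    (continuousOn_radial h)

lemma cutoffSource_eq_zero {xs : ℝ} {ys : Plane} {x : ℝ} {y : Plane}
    (h : H x (‖y‖ ^ 2) = 0 ∧ Hx x (‖y‖ ^ 2) = 0 ∧ Hs x (‖y‖ ^ 2) = 0 ∧ Hss x (‖y‖ ^ 2) = 0) :
    cutoffSource k xs ys Hx Hs Hss x y = 0 := by
  simp [cutoffSource, h]

lemma IsTotalField.continuousOn_ext (hu : IsTotalField k θ f X₁ X₂ u) :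
    ContinuousOn (fun p : ℝ × Plane => u p.1 p.2) (exterior f X₁ X₂) :=
  hu.continuousOn.mono fun _ hp => Or.inl hp

lemma IsTotalField.continuousOn_cutoff (hf : IsProfile f X₁ X₂) (hu : IsTotalField k θ f X₁ X₂ u)
    (hH : IsCutoff J (exterior f X₁ X₂) H Hx Hs Hss) {xs : ℝ} (hJ : J ⊆ Set.Iio xs) (ys : Plane) :
    ContinuousOn (fun p : ℝ × Plane => u p.1 p.2 *
      (kernel k xs ys p.1 p.2 * (H p.1 (‖p.2‖ ^ 2) : ℂ))) (J ×ˢ Set.univ) := by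
  refine continuousOn_mul_of_vanish (isOpen_exterior hf) (hH.isOpen.prod isOpen_univ)
    hu.continuousOn_ext (continuousOn_kernel_mul_radial k hJ ys hH.cont) fun p hp hpE => ?_
  filter_upwards [hH.eventually_zero hp.1 hpE] with q hq
  simp [hq.1]

lemma IsTotalField.continuousOn_source (hf : IsProfile f X₁ X₂) (hu : IsTotalField k θ f X₁ X₂ u)
    (hH : IsCutoff J (exterior f X₁ X₂) H Hx Hs Hss) {xs : ℝ} (hJ : J ⊆ Set.Iio xs) (ys : Plane) :
    ContinuousOn (fun p : ℝ × Plane => u p.1 p.2 * cutoffSource k xs ys Hx Hs Hss p.1 p.2)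
      (J ×ˢ Set.univ) := by
  refine continuousOn_mul_of_vanish (isOpen_exterior hf) (hH.isOpen.prod isOpen_univ)
    hu.continuousOn_ext (hH.continuousOn_source k hJ ys) fun p hp hpE => ?_
  filter_upwards [hH.eventually_zero hp.1 hpE] with q hq
  exact cutoffSource_eq_zero hq

lemma IsCutoff.continuousOn_integral (hH : IsCutoff J (exterior f X₁ X₂) H Hx Hs Hss)
    {G : ℝ → Plane → ℂ} (hG : ContinuousOn (fun p : ℝ × Plane => G p.1 p.2) (J ×ˢ Set.univ))
    (h0 : ∀ x y, (H x (‖y‖ ^ 2) = 0 ∧ Hx x (‖y‖ ^ 2) = 0 ∧ Hs x (‖y‖ ^ 2) = 0 ∧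
      Hss x (‖y‖ ^ 2) = 0) → G x y = 0) :
    ContinuousOn (fun x => ∫ y, G x y) J := by
  obtain ⟨r, hr, h1⟩ := hH.bounded
  refine continuousOn_integral_of_compact_support (isCompact_closedBall (0 : Plane) r) hG
    fun x y hx hy => h0 x y (h1 x hx _ ?_)
  rw [mem_closedBall_zero_iff, not_le] at hy
  exact pow_lt_pow_left₀ hy hr two_ne_zero

/-- The `x`-derivative of the product of the field with a cutoff Green's function. -/
noncomputable def cutoffFieldDx (k : ℂ) (xs : ℝ) (ys : Plane) (u : ℝ → Plane → ℂ)
    (H Hx : ℝ → ℝ → ℝ) (x : ℝ) (y : Plane) : ℂ :=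
  deriv (fun x => u x y) x * (kernel k xs ys x y * (H x (‖y‖ ^ 2) : ℂ)) +
    u x y * (kernel k xs ys x y * (1 / ((xs - x : ℝ) : ℂ) + Complex.I * k / 2 *
      ((‖y - ys‖ ^ 2 : ℝ) : ℂ) / ((xs - x : ℝ) : ℂ) ^ 2) * (H x (‖y‖ ^ 2) : ℂ) +
      kernel k xs ys x y * (Hx x (‖y‖ ^ 2) : ℂ))

/-- At points of the body `u` has no meaning, but there the product vanishes for all nearby `x` as
well. -/
lemma IsTotalField.hasDerivAt_cutoff (hu : IsTotalField k θ f X₁ X₂ u)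
    (hH : IsCutoff J (exterior f X₁ X₂) H Hx Hs Hss) {xs x : ℝ} (ys : Plane) (hx : x ∈ J)
    (hxs : x < xs) (h1 : x ≠ X₁) (h2 : (x : EReal) ≠ X₂) (y : Plane) :
    HasDerivAt (fun x => u x y * (kernel k xs ys x y * (H x (‖y‖ ^ 2) : ℂ)))
      (cutoffFieldDx k xs ys u H Hx x y) x := by
  by_cases hy : (x, y) ∈ exterior f X₁ X₂
  · exact (hu.differentiableAt (x, y) ⟨hy, h1, h2⟩).hasDerivAt.mul
      ((hasDerivAt_kernel k hxs ys y).mul (hH.deriv_x x hx _).ofReal_comp)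
  · have he : ∀ᶠ z in 𝓝 x, H z (‖y‖ ^ 2) = 0 ∧
      Hx z (‖y‖ ^ 2) = 0 ∧ Hs z (‖y‖ ^ 2) = 0 ∧ Hss z (‖y‖ ^ 2) = 0 :=
      (Continuous.tendsto (f := fun z : ℝ => (z, y)) (by fun_prop) x).eventually
        (hH.eventually_zero hx hy)
    have h0 := he.self_of_nhds
    have : cutoffFieldDx k xs ys u H Hx x y = 0 := by simp [cutoffFieldDx, h0.1, h0.2.1]
    rw [this]
    refine (hasDerivAt_const x (0 : ℂ)).congr_of_eventuallyEq ?_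
    filter_upwards [he] with z hz
    simp [hz.1]

lemma IsTotalField.continuousOn_Dx (hf : IsProfile f X₁ X₂) (hu : IsTotalField k θ f X₁ X₂ u)
    (hH : IsCutoff J (exterior f X₁ X₂) H Hx Hs Hss) {xs : ℝ} (hJ : J ⊆ Set.Iio xs) (ys : Plane)
    (hJ0 : ∀ x ∈ J, x ≠ X₁ ∧ (x : EReal) ≠ X₂) :
    ContinuousOn (fun p : ℝ × Plane => cutoffFieldDx k xs ys u H Hx p.1 p.2)
      (J ×ˢ Set.univ) := by
  have hs : ∀ p ∈ J ×ˢ (Set.univ : Set Plane), ((xs - p.1 : ℝ) : ℂ) ≠ 0 := fun p hp => by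
    exact_mod_cast (sub_pos.2 (hJ hp.1)).ne'
  have hE : ∀ p ∈ J ×ˢ (Set.univ : Set Plane), p ∉ offTips f X₁ X₂ → p ∉ exterior f X₁ X₂ :=
    fun p hp h1 h2 => h1 ⟨h2, hJ0 p.1 hp.1⟩
  have hO := hH.isOpen.prod (isOpen_univ (X := Plane))
  have h1 := (continuousOn_kernel k xs ys).mono (Set.prod_mono hJ (subset_refl _))
  refine ContinuousOn.add ?_ ?_
  · refine continuousOn_mul_of_vanish (isOpen_offTips hf) hO hu.continuousOn_deriv
      (continuousOn_kernel_mul_radial k hJ ys hH.cont) fun p hp hpE => ?_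
    filter_upwards [hH.eventually_zero hp.1 (hE p hp hpE)] with q hq
    simp [hq.1]
  · refine continuousOn_mul_of_vanish (isOpen_offTips hf) hO hu.continuousOn_offTips
      (ContinuousOn.add (ContinuousOn.mul (h1.mul (ContinuousOn.add ?_ ?_))
        (continuousOn_radial hH.cont))
      (continuousOn_kernel_mul_radial k hJ ys hH.cont_x)) fun p hp hpE => ?_
    · exact ContinuousOn.div (by fun_prop) (by fun_prop) hs
    · exact ContinuousOn.div (by fun_prop) (by fun_prop) fun p hp => pow_ne_zero _ (hs p hp)
    filter_upwards [hH.eventually_zero hp.1 (hE p hp hpE)] with q hq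
    simp [hq.1, hq.2.1]

lemma IsCutoff.mono (hH : IsCutoff J (exterior f X₁ X₂) H Hx Hs Hss) {J' : Set ℝ} (h : J' ⊆ J)
    (ho : IsOpen J') : IsCutoff J' (exterior f X₁ X₂) H Hx Hs Hss where
  isOpen := ho
  cont := hH.cont.mono (Set.prod_mono h subset_rfl)
  cont_x := hH.cont_x.mono (Set.prod_mono h subset_rfl)
  cont_s := hH.cont_s.mono (Set.prod_mono h subset_rfl)
  cont_ss := hH.cont_ss.mono (Set.prod_mono h subset_rfl)
  deriv_x x hx := hH.deriv_x x (h hx)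
  deriv_s x hx := hH.deriv_s x (h hx)
  deriv_ss x hx := hH.deriv_ss x (h hx)
  vanish x hx := hH.vanish x (h hx)
  bounded := let ⟨r, hr, h1⟩ := hH.bounded; ⟨r, hr, fun x hx => h1 x (h hx)⟩

/-- The equation turns ∂ₓu into (i/2k)Δu, and the Laplacian moves to the cutoff kernel by parts.
Together with the `x`-derivative of that kernel it forms the source of `sum_cutoffKernelDD`. -/
lemma IsTotalField.integral_Dx (hf : IsProfile f X₁ X₂) (hu : IsTotalField k θ f X₁ X₂ u)
    (hk : k ≠ 0) (hH : IsCutoff J (exterior f X₁ X₂) H Hx Hs Hss) {xs x : ℝ}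
    (hJ : J ⊆ Set.Iio xs) (ys : Plane) (hx : x ∈ J)
    (h1 : x ≠ X₁) (h2 : (x : EReal) ≠ X₂) :
    ∫ y, cutoffFieldDx k xs ys u H Hx x y =
      ∫ y, u x y * cutoffSource k xs ys Hx Hs Hss x y := by
  have hxs : x < xs := hJ hx
  set Ω := {y : Plane | (x, y) ∈ offTips f X₁ X₂}
  have hout : ∀ y ∉ Ω, (x, y) ∉ exterior f X₁ X₂ := fun y hy hy' =>
    hy (slice_offTips h1 h2 hy')
  set A : Plane → ℂ := fun y => Complex.I / (2 * k) *
    (kernel k xs ys x y * (H x (‖y‖ ^ 2) : ℂ) * (Laplacian.laplacian (u x) : Plane → ℂ) y) with hA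
  set B : Plane → ℂ := fun y => Complex.I / (2 * k) *
    ((∑ i, cutoffKernelDD k xs ys H Hs Hss x i y) * u x y) with hB
  set S : Plane → ℂ := fun y => u x y * cutoffSource k xs ys Hx Hs Hss x y with hS
  have e1 : ∀ y, cutoffFieldDx k xs ys u H Hx x y = A y + (S y - B y) := by
    intro y
    by_cases hy : (x, y) ∈ exterior f X₁ X₂
    · have heq := hu.equation (x, y) ⟨hy, h1, h2⟩
      have : deriv (fun x => u x y) x =
          Complex.I / (2 * k) * (Laplacian.laplacian (u x) : Plane → ℂ) y := by
        rw [eq_neg_of_add_eq_zero_left heq]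
        have : Complex.I / (2 * k) = -(1 / (2 * Complex.I * k)) := by
          field_simp
          simp
        rw [this]; ring
      simp only [hA, hB, hS, ← sum_cutoffKernelDD (H := H) hk hxs ys y, cutoffFieldDx, this]
      ring
    · have h0 := (hH.eventually_zero_slice hx hy).self_of_nhds
      simp [hA, hB, hS, cutoffFieldDx, cutoffSource, cutoffKernelDD, h0]
  have cu := continuousOn_slice hu.continuousOn_offTips x
  have iS : Integrable S := by
    refine (continuous_slice hx (G := fun x y => u x y *
      cutoffSource k xs ys Hx Hs Hss x y) (hu.continuousOn_source hf hH hJ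
      ys)).integrable_of_hasCompactSupport (hH.hasCompactSupport hx fun y hy => ?_)
    simp [cutoffSource_eq_zero hy]
  have iB : Integrable B := by
    refine Integrable.const_mul ?_ _
    refine integrable_mul_of_tsupport (isOpen_slice hf x) ?_ cu ?_ ?_
    · exact continuous_finsetSum _ fun i _ => hH.continuous_DD k ys hx hxs i
    · exact hH.hasCompactSupport hx fun y hy => by simp [cutoffKernelDD, hy]
    · refine tsupport_subset_of_eventually fun y hy => ?_
      filter_upwards [hH.eventually_zero_slice hx (hout y hy)] with z hz
      simp [cutoffKernelDD, hz]
  have iP : Integrable (cutoffFieldDx k xs ys u H Hx x) := by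
    have hH' : IsCutoff (J ∩ {x | x ≠ X₁ ∧ (x : EReal) ≠ X₂}) (exterior f X₁ X₂) H Hx Hs Hss :=
      hH.mono Set.inter_subset_left (hH.isOpen.inter (isOpen_ne.inter
        (isOpen_ne.preimage continuous_coe_real_ereal)))
    have hx' : x ∈ J ∩ {x | x ≠ X₁ ∧ (x : EReal) ≠ X₂} := ⟨hx, h1, h2⟩
    refine (continuous_slice hx' (G := cutoffFieldDx k xs ys u H Hx) (hu.continuousOn_Dx hf hH'
      (Set.inter_subset_left.trans hJ) ys fun x hx => hx.2)).integrable_of_hasCompactSupport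
        (hH.hasCompactSupport hx fun y hy => ?_)
    simp [cutoffFieldDx, hy]
  -- The term with the Laplacian is integrable because the other three terms of `e1` are.
  have iA : Integrable A := by
    have : A = fun y => cutoffFieldDx k xs ys u H Hx x y - (S y - B y) := by
      ext y; rw [e1]; ring
    rw [this]
    exact iP.sub (iS.sub iB)
  have hAB : ∫ y, A y = ∫ y, B y := by
    simp only [hA, hB]
    rw [integral_const_mul, integral_const_mul, hu.integral_laplacian hf hH ys hx hxs h1 h2]
  simp_rw [e1]
  have e2 : ∫ y, A y + (S y - B y) = (∫ y, A y) + ∫ y, (S y - B y) := integral_add iA (iS.sub iB)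
  rw [e2, integral_sub iS iB, hAB]
  ring

/-- Differentiation under the integral: the supports in `y` stay in one disc, and the derivative is
bounded over a compact neighbourhood of `x` that avoids the tip planes. -/
lemma IsTotalField.hasDerivAt_integral (hf : IsProfile f X₁ X₂) (hu : IsTotalField k θ f X₁ X₂ u)
    (hk : k ≠ 0) (hH : IsCutoff J (exterior f X₁ X₂) H Hx Hs Hss) {xs x : ℝ}
    (hJ : J ⊆ Set.Iio xs) (ys : Plane) (hx : x ∈ J)
    (h1 : x ≠ X₁) (h2 : (x : EReal) ≠ X₂) :
    HasDerivAt (fun x => ∫ y, u x y * (kernel k xs ys x y * (H x (‖y‖ ^ 2) : ℂ)))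
      (∫ y, u x y * cutoffSource k xs ys Hx Hs Hss x y) x := by
  have hJ'o : IsOpen (J ∩ {x | x ≠ X₁ ∧ (x : EReal) ≠ X₂}) :=
    (hH.isOpen.inter (isOpen_ne.inter (isOpen_ne.preimage continuous_coe_real_ereal)))
  have hH' : IsCutoff (J ∩ {x | x ≠ X₁ ∧ (x : EReal) ≠ X₂}) (exterior f X₁ X₂) H Hx Hs Hss :=
    hH.mono Set.inter_subset_left hJ'o
  have hc := hu.continuousOn_Dx hf hH' (Set.inter_subset_left.trans hJ) ys fun x hx => hx.2
  have hV := hu.continuousOn_cutoff hf hH hJ ys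
  have hJx : x ∈ J ∩ {x | x ≠ X₁ ∧ (x : EReal) ≠ X₂} := ⟨hx, h1, h2⟩
  obtain ⟨r, hr, hb⟩ := hH.bounded
  obtain ⟨ε, hε, hball⟩ := Metric.nhds_basis_closedBall.mem_iff.1 (hJ'o.mem_nhds ⟨hx, h1, h2⟩)
  have hK : IsCompact (Metric.closedBall x ε ×ˢ Metric.closedBall (0 : Plane) r) :=
    (isCompact_closedBall _ _).prod (isCompact_closedBall _ _)
  obtain ⟨M, hM⟩ := hK.exists_bound_of_continuousOn
    (hc.mono (Set.prod_mono hball (Set.subset_univ _)))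
  rw [← hu.integral_Dx hf hk hH hJ ys hx h1 h2]
  refine (hasDerivAt_integral_of_dominated_loc_of_deriv_le
    (bound := (Metric.closedBall (0 : Plane) r).indicator fun _ => M)
    (Metric.closedBall_mem_nhds x hε) ?_ ?_ ?_ ?_ ?_ ?_).2
  · filter_upwards [hH.isOpen.mem_nhds hx] with z hz
    exact (continuous_slice hz (G := fun x y => u x y * (kernel k xs ys x y * (H x (‖y‖ ^ 2) : ℂ))) hV).aestronglyMeasurable
  · exact (continuous_slice hx (G := fun x y => u x y * (kernel k xs ys x y * (H x (‖y‖ ^ 2) : ℂ))) hV).integrable_of_hasCompactSupport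
      (hH.hasCompactSupport hx fun y hy => by simp [hy])
  · exact (continuous_slice hJx (G := cutoffFieldDx k xs ys u H Hx) hc).aestronglyMeasurable
  · refine Eventually.of_forall fun y z hz => ?_
    by_cases hy : y ∈ Metric.closedBall (0 : Plane) r
    · rw [Set.indicator_of_mem hy]
      exact hM (z, y) ⟨hz, hy⟩
    · rw [Set.indicator_of_notMem hy]
      rw [mem_closedBall_zero_iff, not_le] at hy
      have := hb z (hball hz).1 _ (pow_lt_pow_left₀ hy hr two_ne_zero)
      simp [cutoffFieldDx, this]
  · exact (integrable_indicator_iff measurableSet_closedBall).2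
      (integrableOn_const measure_closedBall_lt_top.ne)
  · refine Eventually.of_forall fun y z hz => ?_
    exact hu.hasDerivAt_cutoff hH ys (hball hz).1 (hJ (hball hz).1) (hball hz).2.1 (hball hz).2.2 y

/-- Green's identity in a slab, with a cutoff. -/
theorem IsTotalField.green_identity (hf : IsProfile f X₁ X₂) (hu : IsTotalField k θ f X₁ X₂ u)
    (hk : k ≠ 0) (hH : IsCutoff J (exterior f X₁ X₂) H Hx Hs Hss) {xs a b : ℝ}
    (hJ : J ⊆ Set.Iio xs) (ys : Plane) (hab : a ≤ b) (hI : Set.Icc a b ⊆ J) :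
    (∫ y, u b y * (kernel k xs ys b y * (H b (‖y‖ ^ 2) : ℂ))) -
      ∫ y, u a y * (kernel k xs ys a y * (H a (‖y‖ ^ 2) : ℂ)) =
    ∫ x in a..b, ∫ y, u x y * cutoffSource k xs ys Hx Hs Hss x y := by
  have hcI : ContinuousOn (fun x => ∫ y, u x y * cutoffSource k xs ys Hx Hs Hss x y) J :=
    hH.continuousOn_integral (hu.continuousOn_source hf hH hJ ys) fun x y h => by
      simp [cutoffSource_eq_zero h]
  have hcV : ContinuousOn
      (fun x => ∫ y, u x y * (kernel k xs ys x y * (H x (‖y‖ ^ 2) : ℂ))) J :=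
    hH.continuousOn_integral (hu.continuousOn_cutoff hf hH hJ ys) fun x y h => by simp [h]
  -- Differentiability in `x` is not known in the planes of the tips. They are at most two, and the
  -- plane integral is continuous across them, so the fundamental theorem of calculus still holds.
  have hcount : ({x : ℝ | x = X₁ ∨ (x : EReal) = X₂}).Countable := by
    refine Set.Countable.union (Set.countable_singleton X₁)
      (Set.Subsingleton.countable fun x hx y hy => ?_)
    exact EReal.coe_injective (hx.trans hy.symm)
  rw [integral_eq_of_hasDerivAt_off_countable_of_le _ _ hab hcount (hcV.mono hI)]
  · intro x hx
    have hx' := not_or.1 hx.2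
    exact hu.hasDerivAt_integral hf hk hH hJ ys (hI (Set.Ioo_subset_Icc_self hx.1)) hx'.1 hx'.2
  · exact (hcI.mono (by rwa [Set.uIcc_of_le hab])).intervalIntegrable

end

/-! ### The smooth step and the inner and outer cutoffs -/

/-- A smooth step from `0` on `s ≤ 1` to `1` on `2 ≤ s`. -/
noncomputable def step (s : ℝ) : ℝ := Real.smoothTransition (s - 1)

lemma contDiff_step {n : ℕ∞} : ContDiff ℝ n step :=
  Real.smoothTransition.contDiff.comp (contDiff_id.sub contDiff_const)

lemma monotone_step : Monotone step := fun _ _ h =>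
  Real.smoothTransition.monotone (sub_le_sub_right h 1)

lemma step_nonneg (s : ℝ) : 0 ≤ step s := Real.smoothTransition.nonneg _
lemma step_le_one (s : ℝ) : step s ≤ 1 := Real.smoothTransition.le_one _

lemma step_eq_zero {s : ℝ} (h : s ≤ 1) : step s = 0 :=
  Real.smoothTransition.zero_of_nonpos (by linarith)

lemma step_eq_one {s : ℝ} (h : 2 ≤ s) : step s = 1 :=
  Real.smoothTransition.one_of_one_le (by linarith)

lemma hasDerivAt_step (s : ℝ) : HasDerivAt step (deriv step s) s :=
  ((contDiff_step (n := 1)).differentiable (by norm_num) s).hasDerivAt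

lemma contDiff_deriv_step {n : ℕ} : ContDiff ℝ n (deriv step) :=
  (contDiff_succ_iff_deriv.1 (contDiff_step (n := ((n + 1 : ℕ) : ℕ∞)))).2.2

lemma continuous_deriv_step : Continuous (deriv step) := (contDiff_deriv_step (n := 1)).continuous

lemma hasDerivAt_deriv_step (s : ℝ) : HasDerivAt (deriv step) (deriv (deriv step) s) s :=
  ((contDiff_deriv_step (n := 1)).differentiable (by norm_num) s).hasDerivAt

lemma continuous_deriv_deriv_step : Continuous (deriv (deriv step)) :=
  (contDiff_deriv_step (n := 1)).continuous_deriv (by norm_num)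

/-- The derivative vanishes on the open half-line, and its continuity carries this over to the
endpoint. -/
lemma deriv_eq_zero_of_const_Iio {g : ℝ → ℝ} {a c : ℝ} (hg : Continuous (deriv g))
    (h : ∀ s < a, g s = c) {s : ℝ} (hs : s ≤ a) : deriv g s = 0 := by
  have h1 : Set.EqOn (deriv g) (fun _ => 0) (Set.Iio a) := fun t ht => by
    have : g =ᶠ[𝓝 t] fun _ => c := by
      filter_upwards [Iio_mem_nhds ht] with z hz using h z hz
    simpa using this.deriv_eq
  have := h1.closure hg continuous_const
  rw [closure_Iio] at this
  exact this hs

lemma deriv_eq_zero_of_const_Ioi {g : ℝ → ℝ} {a c : ℝ} (hg : Continuous (deriv g))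
    (h : ∀ s > a, g s = c) {s : ℝ} (hs : a ≤ s) : deriv g s = 0 := by
  have h1 : Set.EqOn (deriv g) (fun _ => 0) (Set.Ioi a) := fun t ht => by
    have : g =ᶠ[𝓝 t] fun _ => c := by
      filter_upwards [Ioi_mem_nhds ht] with z hz using h z hz
    simpa using this.deriv_eq
  have := h1.closure hg continuous_const
  rw [closure_Ioi] at this
  exact this hs

lemma deriv_step_of_le {s : ℝ} (h : s ≤ 1) : deriv step s = 0 :=
  deriv_eq_zero_of_const_Iio (c := 0) continuous_deriv_step (fun _ ht => step_eq_zero (le_of_lt ht)) h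

lemma deriv_step_of_ge {s : ℝ} (h : 2 ≤ s) : deriv step s = 0 :=
  deriv_eq_zero_of_const_Ioi continuous_deriv_step (fun _ ht => step_eq_one (le_of_lt ht)) h

lemma deriv_deriv_step_of_le {s : ℝ} (h : s ≤ 1) : deriv (deriv step) s = 0 :=
  deriv_eq_zero_of_const_Iio continuous_deriv_deriv_step
    (fun _ ht => deriv_step_of_le (le_of_lt ht)) h

lemma deriv_deriv_step_of_ge {s : ℝ} (h : 2 ≤ s) : deriv (deriv step) s = 0 :=
  deriv_eq_zero_of_const_Ioi continuous_deriv_deriv_step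
    (fun _ ht => deriv_step_of_ge (le_of_lt ht)) h

lemma deriv_step_nonneg (s : ℝ) : 0 ≤ deriv step s := monotone_step.deriv_nonneg

lemma exists_bound_of_step {g : ℝ → ℝ} (hg : Continuous g) (h1 : ∀ s ≤ 1, g s = 0)
    (h2 : ∀ s, 2 ≤ s → g s = 0) : ∃ C, 0 ≤ C ∧ ∀ s, |g s| ≤ C := by
  obtain ⟨C, hC⟩ := (isCompact_Icc (a := (1 : ℝ)) (b := 2)).exists_bound_of_continuousOn
    hg.continuousOn
  have hC0 : 0 ≤ C := (norm_nonneg _).trans (hC 1 (by norm_num))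
  refine ⟨C, hC0, fun s => ?_⟩
  by_cases hs : s ≤ 1
  · simpa [h1 s hs] using hC0
  by_cases hs' : 2 ≤ s
  · simpa [h2 s hs'] using hC0
  · exact hC s ⟨by linarith, by linarith⟩

lemma exists_step_bound : ∃ C, 0 ≤ C ∧ ∀ s, |deriv step s| ≤ C ∧ |deriv (deriv step) s| ≤ C := by
  obtain ⟨C1, h1, h1'⟩ := exists_bound_of_step continuous_deriv_step (fun _ => deriv_step_of_le)
    (fun _ => deriv_step_of_ge)
  obtain ⟨C2, h2, h2'⟩ := exists_bound_of_step continuous_deriv_deriv_step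
    (fun _ => deriv_deriv_step_of_le) (fun _ => deriv_deriv_step_of_ge)
  exact ⟨C1 + C2, by positivity, fun s =>
    ⟨(h1' s).trans (by linarith), (h2' s).trans (by linarith)⟩⟩

/-- The inner cutoff, which removes `‖y‖ ^ 2 ≤ F x + δ`. -/
noncomputable def inner₀ (F : ℝ → ℝ) (δ x s : ℝ) : ℝ := step ((s - F x) / δ)
/-- The `x`-derivative of the inner cutoff. -/
noncomputable def innerX (F F' : ℝ → ℝ) (δ x s : ℝ) : ℝ := deriv step ((s - F x) / δ) * (-F' x / δ)
/-- The `s`-derivative of the inner cutoff. -/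
noncomputable def innerS (F : ℝ → ℝ) (δ x s : ℝ) : ℝ := deriv step ((s - F x) / δ) / δ
/-- The second `s`-derivative of the inner cutoff. -/
noncomputable def innerSS (F : ℝ → ℝ) (δ x s : ℝ) : ℝ :=
  deriv (deriv step) ((s - F x) / δ) / δ ^ 2
/-- The outer cutoff and its derivatives. -/
noncomputable def outer₀ (R s : ℝ) : ℝ := 1 - step (s / R ^ 2)
/-- The derivative of the outer cutoff. -/
noncomputable def outerS (R s : ℝ) : ℝ := -(deriv step (s / R ^ 2) / R ^ 2)
/-- The second derivative of the outer cutoff. -/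
noncomputable def outerSS (R s : ℝ) : ℝ := -(deriv (deriv step) (s / R ^ 2) / R ^ 2 / R ^ 2)

lemma hasDerivAt_outer (R s : ℝ) : HasDerivAt (outer₀ R) (outerS R s) s := by
  have := ((hasDerivAt_step (s / R ^ 2)).comp s ((hasDerivAt_id s).div_const (R ^ 2))).const_sub 1
  refine this.congr_deriv ?_
  simp [outerS, div_eq_mul_inv]

lemma hasDerivAt_outerS (R s : ℝ) : HasDerivAt (outerS R) (outerSS R s) s := by
  have := (((hasDerivAt_deriv_step (s / R ^ 2)).comp s
    ((hasDerivAt_id s).div_const (R ^ 2))).div_const (R ^ 2)).neg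
  refine this.congr_deriv ?_
  simp [outerSS, div_eq_mul_inv]

lemma hasDerivAt_inner₀ (F : ℝ → ℝ) (δ x s : ℝ) :
    HasDerivAt (inner₀ F δ x) (innerS F δ x s) s := by
  have := ((hasDerivAt_step ((s - F x) / δ)).comp s
    (((hasDerivAt_id s).sub_const (F x)).div_const δ))
  refine this.congr_deriv ?_
  simp [innerS, div_eq_mul_inv]

lemma hasDerivAt_innerS (F : ℝ → ℝ) (δ x s : ℝ) :
    HasDerivAt (innerS F δ x) (innerSS F δ x s) s := by
  have := ((hasDerivAt_deriv_step ((s - F x) / δ)).comp s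
    (((hasDerivAt_id s).sub_const (F x)).div_const δ)).div_const δ
  refine this.congr_deriv ?_
  simp only [innerSS, div_eq_mul_inv]
  ring

lemma hasDerivAt_innerX {F F' : ℝ → ℝ} {x : ℝ} (hF : HasDerivAt F (F' x) x) (δ s : ℝ) :
    HasDerivAt (fun x => inner₀ F δ x s) (innerX F F' δ x s) x := by
  have := ((hasDerivAt_step ((s - F x) / δ)).comp x ((hF.const_sub s).div_const δ))
  exact this

lemma continuousOn_arg {F : ℝ → ℝ} {J : Set ℝ} (hF : ContinuousOn F J) (δ : ℝ) :
    ContinuousOn (fun q : ℝ × ℝ => (q.2 - F q.1) / δ) (J ×ˢ Set.univ) :=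
  (continuousOn_snd.sub (ContinuousOn.comp (g := F) (f := Prod.fst) hF continuousOn_fst fun _ hq => hq.1)).div_const δ

/-- The step vanishes up to `s = F x + δ`, which leaves room around the body because its squared
radius is at most `F x`. The outer factor vanishes from `s = 2 * R ^ 2` on. -/
lemma isCutoff_step {f F F' : ℝ → ℝ} {X₁ : ℝ} {X₂ : EReal} {J : Set ℝ} {δ R : ℝ} (hJ : IsOpen J)
    (hF : ∀ x ∈ J, HasDerivAt F (F' x) x) (hF' : ContinuousOn F' J) (hδ : 0 < δ) (hR : 0 < R)
    (hfF : ∀ x ∈ J, ∀ y : Plane, (x, y) ∉ exterior f X₁ X₂ → ‖y‖ ^ 2 ≤ F x) :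
    IsCutoff J (exterior f X₁ X₂) (fun x s => inner₀ F δ x s * outer₀ R s)
      (fun x s => innerX F F' δ x s * outer₀ R s)
      (fun x s => innerS F δ x s * outer₀ R s + inner₀ F δ x s * outerS R s)
      (fun x s => innerSS F δ x s * outer₀ R s + 2 * (innerS F δ x s * outerS R s) +
        inner₀ F δ x s * outerSS R s) := by
  have hFc : ContinuousOn F J := fun x hx => (hF x hx).continuousAt.continuousWithinAt
  have c0 := continuousOn_arg hFc δ
  have s0 : Continuous step := (contDiff_step (n := 0)).continuous
  have cF' : ContinuousOn (fun q : ℝ × ℝ => -F' q.1 / δ) (J ×ˢ Set.univ) :=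
    (ContinuousOn.comp (g := F') (f := Prod.fst) hF' continuousOn_fst fun _ hq => hq.1).neg.div_const δ
  have i0 := s0.comp_continuousOn c0
  have iS := (continuous_deriv_step.comp_continuousOn c0).div_const δ
  have iX := (continuous_deriv_step.comp_continuousOn c0).mul cF'
  have iSS := (continuous_deriv_deriv_step.comp_continuousOn c0).div_const (δ ^ 2)
  have d0 : Continuous (fun q : ℝ × ℝ => q.2 / R ^ 2) := by fun_prop
  have o0 : ContinuousOn (fun q : ℝ × ℝ => outer₀ R q.2) (J ×ˢ Set.univ) :=
    (continuous_const.sub (s0.comp d0)).continuousOn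
  have oS : ContinuousOn (fun q : ℝ × ℝ => outerS R q.2) (J ×ˢ Set.univ) :=
    ((continuous_deriv_step.comp d0).div_const (R ^ 2)).neg.continuousOn
  have oSS : ContinuousOn (fun q : ℝ × ℝ => outerSS R q.2) (J ×ˢ Set.univ) :=
    (((continuous_deriv_deriv_step.comp d0).div_const (R ^ 2)).div_const (R ^ 2)).neg.continuousOn
  refine ⟨hJ, i0.mul o0, iX.mul o0, (iS.mul o0).add (i0.mul oS),
    ((iSS.mul o0).add (continuousOn_const.mul (iS.mul oS))).add (i0.mul oSS), ?_, ?_, ?_, ?_, ?_⟩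
  · exact fun x hx s => (hasDerivAt_innerX (hF x hx) δ s).mul_const _
  · exact fun x hx s => (hasDerivAt_inner₀ F δ x s).mul (hasDerivAt_outer R s)
  · intro x hx s
    refine (((hasDerivAt_innerS F δ x s).mul (hasDerivAt_outer R s)).add
      ((hasDerivAt_inner₀ F δ x s).mul (hasDerivAt_outerS R s))).congr_deriv ?_
    ring
  · intro x hx y hy
    have hc : ContinuousAt (fun q : ℝ × ℝ => (q.2 - F q.1) / δ) (x, ‖y‖ ^ 2) :=
      c0.continuousAt ((hJ.prod isOpen_univ).mem_nhds ⟨hx, trivial⟩)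
    have hlt : (‖y‖ ^ 2 - F x) / δ < 1 := by
      have := hfF x hx y hy
      exact (div_nonpos_of_nonpos_of_nonneg (by linarith) hδ.le).trans_lt one_pos
    filter_upwards [hc.eventually (Iio_mem_nhds hlt)] with q hq
    have hq' : (q.2 - F q.1) / δ ≤ 1 := le_of_lt hq
    simp [inner₀, innerX, innerS, innerSS, step_eq_zero hq', deriv_step_of_le hq',
      deriv_deriv_step_of_le hq']
  · refine ⟨2 * R, by positivity, fun x _ s hs => ?_⟩
    have hq : 2 ≤ s / R ^ 2 := by
      rw [le_div_iff₀ (by positivity)]; nlinarith [sq_nonneg R]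
    simp [outer₀, outerS, outerSS, step_eq_one hq, deriv_step_of_ge hq, deriv_deriv_step_of_ge hq]

/-! ### Gaussian decay for Im k > 0, and removal of the outer cutoff -/

lemma norm_kernel (k : ℂ) {xs x : ℝ} (hx : x < xs) (ys y : Plane) :
    ‖kernel k xs ys x y‖ = ‖k‖ / (2 * Real.pi * (xs - x)) *
      Real.exp (-(k.im / (2 * (xs - x)) * ‖y - ys‖ ^ 2)) := by
  have hs : 0 < xs - x := sub_pos.2 hx
  unfold kernel
  rw [norm_mul, Complex.norm_exp, norm_div]
  congr 2
  · simp only [norm_mul, Complex.norm_real, Complex.norm_I, Real.norm_eq_abs,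
      abs_of_pos hs, abs_of_pos Real.pi_pos, mul_one, Complex.norm_two]
  · have : Complex.I * k / (2 * ((xs - x : ℝ) : ℂ)) * ((‖y - ys‖ ^ 2 : ℝ) : ℂ) =
        ((‖y - ys‖ ^ 2 / (2 * (xs - x)) : ℝ) : ℂ) * (Complex.I * k) := by
      push_cast; ring
    rw [this, Complex.re_ofReal_mul]
    simp
    ring

lemma norm_uIn (k : ℂ) (θ x : ℝ) (y : Plane) :
    ‖uIn k θ x y‖ = Real.exp (-(k.im * (θ * y 0 - x * θ ^ 2 / 2))) := by
  unfold uIn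
  rw [Complex.norm_exp, mul_comm, Complex.re_ofReal_mul]
  simp
  ring

lemma norm_uIn_le (k : ℂ) (θ x c : ℝ) (hx : |x| ≤ c) (y : Plane) :
    ‖uIn k θ x y‖ ≤ Real.exp (|k.im| * c * θ ^ 2) * Real.exp (|k.im| * |θ| * ‖y‖) := by
  rw [norm_uIn, ← Real.exp_add]
  apply Real.exp_le_exp.2
  have h0 : |y 0| ≤ ‖y‖ := by simpa using PiLp.norm_apply_le y 0
  have h1 : -(k.im * (θ * y 0)) ≤ |k.im| * |θ| * ‖y‖ := by
    refine (neg_le_abs _).trans ?_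
    rw [abs_mul, abs_mul, mul_assoc]
    gcongr
  have h2 : k.im * (x * θ ^ 2) ≤ |k.im| * c * θ ^ 2 := by
    refine (le_abs_self _).trans ?_
    rw [abs_mul, abs_mul, abs_of_nonneg (sq_nonneg θ), mul_assoc]
    gcongr
  have h3 : 0 ≤ |k.im| * c * θ ^ 2 := by
    have := (abs_nonneg x).trans hx
    positivity
  nlinarith

/-- The scattered part is below 1 for large `‖y‖`, and the incident wave grows at most
exponentially. -/
lemma ScatteredDecays.exists_bound {k : ℂ} {θ : ℝ} {f : ℝ → ℝ} {X₁ : ℝ} {X₂ : EReal}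
    {u : ℝ → Plane → ℂ} (h : ScatteredDecays k θ f X₁ X₂ u) (a b : ℝ) :
    ∃ A K R : ℝ, 0 ≤ A ∧ 0 ≤ K ∧ 0 ≤ R ∧ ∀ x ∈ Set.Icc a b, ∀ y : Plane, R ≤ ‖y‖ →
      (x, y) ∈ exterior f X₁ X₂ → ‖u x y‖ ≤ A * Real.exp (K * ‖y‖) := by
  obtain ⟨R, hR⟩ := h a b 1 one_pos
  set c := max |a| |b|
  refine ⟨1 + Real.exp (|k.im| * c * θ ^ 2), |k.im| * |θ|, max R 0, by positivity, by positivity,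
    le_max_right _ _, fun x hx y hy hE => ?_⟩
  have h1 := hR x hx y ((le_max_left _ _).trans hy) hE
  have h2 := norm_uIn_le k θ x c (abs_le_max_abs_abs hx.1 hx.2) y
  have h3 : ‖u x y‖ ≤ ‖u x y - uIn k θ x y‖ + ‖uIn k θ x y‖ := by
    simpa using norm_add_le (u x y - uIn k θ x y) (uIn k θ x y)
  have h4 : 1 ≤ Real.exp (|k.im| * |θ| * ‖y‖) := Real.one_le_exp (by positivity)
  rw [add_mul]
  linarith

/-- A Gaussian with another centre absorbs an exponential and keeps a quarter of its rate: `t² ≤ 2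
d² + 2 e²` costs one half, and completing a square for `K t` another quarter. -/
lemma gauss_exponent {m K t d e : ℝ} (hm : 0 < m) (h : t ≤ d + e) (ht : 0 ≤ t)
    : -(m * d ^ 2) + K * t ≤ -(m / 4 * t ^ 2) + (m * e ^ 2 + K ^ 2 / m) := by
  have h1 : t ^ 2 ≤ 2 * d ^ 2 + 2 * e ^ 2 := by nlinarith [sq_nonneg (d - e)]
  have h2 : K * t ≤ m / 4 * t ^ 2 + K ^ 2 / m := by
    have h3 : m / 4 * t ^ 2 + K ^ 2 / m - K * t = (m * t / 2 - K) ^ 2 / m := by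
      field_simp; ring
    have h4 : 0 ≤ (m * t / 2 - K) ^ 2 / m := by positivity
    linarith
  nlinarith

/-- The Gaussian decay of the kernel, with the rate of the farthest plane `a` and the amplitude of
the nearest plane `b`, beats the exponential growth of the field uniformly in `x`. -/
lemma ScatteredDecays.exists_kernel_bound {k : ℂ} (hk : 0 < k.im) {θ : ℝ} {f : ℝ → ℝ} {X₁ : ℝ}
    {X₂ : EReal} {u : ℝ → Plane → ℂ} (h : ScatteredDecays k θ f X₁ X₂ u) {a b xs : ℝ}
    (hb : b < xs) (ys : Plane) :
    ∃ A κ R : ℝ, 0 ≤ A ∧ 0 < κ ∧ 0 ≤ R ∧ ∀ x ∈ Set.Icc a b, ∀ y : Plane, R ≤ ‖y‖ →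
      (x, y) ∈ exterior f X₁ X₂ →
        ‖u x y‖ * ‖kernel k xs ys x y‖ ≤ A * Real.exp (-(κ * ‖y‖ ^ 2)) := by
  obtain ⟨A, K, R, hA, hK, hR0, hR⟩ := h.exists_bound a b
  by_cases hab : a ≤ b
  swap
  · exact ⟨0, 1, 0, le_rfl, one_pos, le_rfl, fun x hx => absurd (hx.1.trans hx.2) hab⟩
  set m := k.im / (2 * (xs - a)) with hm
  have hsb : 0 < xs - b := by linarith
  have hm0 : 0 < m := div_pos hk (by linarith)
  set B := ‖k‖ / (2 * Real.pi * (xs - b))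
  have hpi := Real.pi_pos
  have hB : 0 ≤ B := by positivity
  refine ⟨A * B * Real.exp (m * ‖ys‖ ^ 2 + K ^ 2 / m), m / 4, R, by positivity, by positivity, hR0,
    fun x hx y hy hE => ?_⟩
  have hxs : x < xs := hx.2.trans_lt hb
  have hs : 0 < xs - x := by linarith
  have h1 : ‖kernel k xs ys x y‖ ≤ B * Real.exp (-(m * ‖y - ys‖ ^ 2)) := by
    rw [norm_kernel k hxs]
    have h2 : ‖k‖ / (2 * Real.pi * (xs - x)) ≤ B := by
      apply div_le_div_of_nonneg_left (norm_nonneg _) (by positivity)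
      have := hx.2
      gcongr
    have h3 : m ≤ k.im / (2 * (xs - x)) := by
      apply div_le_div_of_nonneg_left hk.le (by positivity)
      have := hx.1
      gcongr
    gcongr
  have h4 : ‖y‖ ≤ ‖y - ys‖ + ‖ys‖ := by simpa using norm_add_le (y - ys) ys
  have h5 := gauss_exponent (K := K) hm0 h4 (norm_nonneg _)
  calc ‖u x y‖ * ‖kernel k xs ys x y‖
      ≤ (A * Real.exp (K * ‖y‖)) * (B * Real.exp (-(m * ‖y - ys‖ ^ 2))) := by
        have := hR x hx y hy hE
        gcongr
    _ = A * B * Real.exp (-(m * ‖y - ys‖ ^ 2) + K * ‖y‖) := by rw [Real.exp_add]; ring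
    _ ≤ A * B * Real.exp (-(m / 4 * ‖y‖ ^ 2) + (m * ‖ys‖ ^ 2 + K ^ 2 / m)) := by gcongr
    _ = _ := by rw [Real.exp_add]; ring

lemma integrable_gauss {κ : ℝ} (hκ : 0 < κ) :
    Integrable (fun y : Plane => Real.exp (-(κ * ‖y‖ ^ 2))) := by
  have := (GaussianFourier.integrable_cexp_neg_mul_sq_norm_add (V := Plane) (b := (κ : ℂ))
    (by simpa using hκ) 0 0).norm
  refine this.congr (Eventually.of_forall fun y => ?_)
  simp only [Complex.norm_exp]
  congr 1
  simp [← Complex.ofReal_pow]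

/-- Continuity and Gaussian decay make a function integrable. -/
lemma integrable_of_continuous_of_gauss {G : Plane → ℂ} (hG : Continuous G) {A κ R : ℝ}
    (hκ : 0 < κ) (h : ∀ y, R ≤ ‖y‖ → ‖G y‖ ≤ A * Real.exp (-(κ * ‖y‖ ^ 2))) : Integrable G := by
  have h1 : IntegrableOn G (Metric.closedBall 0 R) :=
    hG.continuousOn.integrableOn_compact (isCompact_closedBall _ _)
  have h2 : IntegrableOn G (Metric.closedBall 0 R)ᶜ := by
    refine Integrable.mono' (((integrable_gauss hκ).const_mul A).integrableOn)
      hG.aestronglyMeasurable ?_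
    rw [ae_restrict_iff' measurableSet_closedBall.compl]
    refine Eventually.of_forall fun y hy => h y ?_
    simp at hy
    exact hy.le
  have := h1.union h2
  rwa [Set.union_compl_self, integrableOn_univ] at this

section

variable {k : ℂ} {θ : ℝ} {f : ℝ → ℝ} {X₁ : ℝ} {X₂ : EReal} {u : ℝ → Plane → ℂ}

lemma inner₀_mem (F : ℝ → ℝ) (δ x s : ℝ) : 0 ≤ inner₀ F δ x s ∧ inner₀ F δ x s ≤ 1 :=
  ⟨step_nonneg _, step_le_one _⟩

lemma outer₀_mem (R s : ℝ) : 0 ≤ outer₀ R s ∧ outer₀ R s ≤ 1 :=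
  ⟨sub_nonneg.2 (step_le_one _), sub_le_self _ (step_nonneg _)⟩

lemma outer_of_le {R s : ℝ} (hR : 0 < R) (h : s ≤ R ^ 2) :
    outer₀ R s = 1 ∧ outerS R s = 0 ∧ outerSS R s = 0 := by
  have h1 : s / R ^ 2 ≤ 1 := (div_le_one (by positivity)).2 h
  simp [outer₀, outerS, outerSS, step_eq_zero h1, deriv_step_of_le h1, deriv_deriv_step_of_le h1]

lemma inner_of_ge {F F' : ℝ → ℝ} {δ x s : ℝ} (hδ : 0 < δ) (h : F x + 2 * δ ≤ s) :
    inner₀ F δ x s = 1 ∧ innerX F F' δ x s = 0 ∧ innerS F δ x s = 0 ∧ innerSS F δ x s = 0 := by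
  have h1 : 2 ≤ (s - F x) / δ := (le_div_iff₀ hδ).2 (by linarith)
  simp [inner₀, innerX, innerS, innerSS, step_eq_one h1, deriv_step_of_ge h1,
    deriv_deriv_step_of_ge h1]

lemma isOpen_extSlice (hf : IsProfile f X₁ X₂) (x : ℝ) :
    IsOpen {y : Plane | (x, y) ∈ exterior f X₁ X₂} :=
  (isOpen_exterior hf).preimage (f := fun y : Plane => (x, y)) (by fun_prop)

lemma IsTotalField.continuousOn_extSlice (hu : IsTotalField k θ f X₁ X₂ u) (x : ℝ) :
    ContinuousOn (u x) {y : Plane | (x, y) ∈ exterior f X₁ X₂} :=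
  hu.continuousOn_ext.comp (f := fun y : Plane => (x, y)) (by fun_prop) fun _ hy => hy

lemma IsTotalField.continuous_inner (hf : IsProfile f X₁ X₂) (hu : IsTotalField k θ f X₁ X₂ u)
    {F : ℝ → ℝ} {δ x xs : ℝ} (hδ : 0 < δ) (hxs : x < xs) (ys : Plane)
    (hfF : ∀ y : Plane, (x, y) ∉ exterior f X₁ X₂ → ‖y‖ ^ 2 ≤ F x) :
    Continuous fun y => u x y * (kernel k xs ys x y * (inner₀ F δ x (‖y‖ ^ 2) : ℂ)) := by
  rw [← continuousOn_univ]
  have hc : Continuous fun y : Plane => (‖y‖ ^ 2 - F x) / δ := by fun_prop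
  have s0 : Continuous step := (contDiff_step (n := 0)).continuous
  refine continuousOn_mul_of_vanish (isOpen_extSlice hf x) isOpen_univ
    (hu.continuousOn_extSlice x) ?_ fun y _ hy => ?_
  · exact ((continuous_kernel k hxs ys).mul
      (Complex.continuous_ofReal.comp (s0.comp hc))).continuousOn
  · have hlt : (‖y‖ ^ 2 - F x) / δ < 1 :=
      (div_nonpos_of_nonpos_of_nonneg (by linarith [hfF y hy]) hδ.le).trans_lt one_pos
    filter_upwards [hc.continuousAt.eventually (Iio_mem_nhds hlt)] with z hz
    simp [inner₀, step_eq_zero (le_of_lt hz)]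

lemma norm_dotSub_le (ys y : Plane) : |dotSub ys y| ≤ ‖y‖ * (‖y‖ + ‖ys‖) := by
  have h : dotSub ys y = inner ℝ y (y - ys) := by
    simp [dotSub, PiLp.inner_apply, Fin.sum_univ_two]; ring
  rw [h]
  exact (abs_real_inner_le_norm _ _).trans
    (mul_le_mul_of_nonneg_left (norm_sub_le _ _) (norm_nonneg _))

/-- The second derivative of the outer cutoff vanishes for `s ≥ 2 * R ^ 2`, so the factor `s` in
front of it costs only one power `R ^ 2`; hence `12 = 4 + 4 * 2`. -/
lemma norm_outer_factor_le {C B s t T R : ℝ} {k β : ℂ} (hC : 0 ≤ C)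
    (hCb : ∀ s, |deriv step s| ≤ C ∧ |deriv (deriv step) s| ≤ C) (hR : 0 < R)
    (hβ : ‖β‖ ≤ B) (ht : |t| ≤ T) (hs : 0 ≤ s) :
    ‖Complex.I / (2 * k) * (4 * (outerS R s : ℂ) + 4 * (s : ℂ) * (outerSS R s : ℂ) +
      4 * (outerS R s : ℂ) * β * (t : ℂ))‖ ≤
      1 / R ^ 2 * (‖Complex.I / (2 * k)‖ * C * (12 + 4 * B * T)) := by
  have hR2 : 0 < R ^ 2 := by positivity
  have hT : 0 ≤ T := (abs_nonneg _).trans ht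
  have hB : 0 ≤ B := (norm_nonneg _).trans hβ
  have h1 : |outerS R s| ≤ C / R ^ 2 := by
    rw [outerS, abs_neg, abs_div, abs_of_pos hR2]
    gcongr
    exact (hCb _).1
  have h2 : |s * outerSS R s| ≤ 2 * C / R ^ 2 := by
    by_cases h : 2 ≤ s / R ^ 2
    · simp only [outerSS, deriv_deriv_step_of_ge h]
      simp; positivity
    · have h3 : s / R ^ 2 ≤ 2 := by linarith
      have : s * outerSS R s = -(s / R ^ 2 * deriv (deriv step) (s / R ^ 2) / R ^ 2) := by
        rw [outerSS]; ring
      rw [this, abs_neg, abs_div, abs_of_pos hR2, abs_mul, abs_of_nonneg (by positivity : 0 ≤ s / R ^ 2)]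
      gcongr
      exact (hCb _).2
  rw [norm_mul]
  have h4 : ‖4 * (outerS R s : ℂ) + 4 * (s : ℂ) * (outerSS R s : ℂ) +
      4 * (outerS R s : ℂ) * β * (t : ℂ)‖ ≤ 4 * (C / R ^ 2) + 4 * (2 * C / R ^ 2) +
      4 * (C / R ^ 2) * B * T := by
    refine (norm_add_le _ _).trans (add_le_add ((norm_add_le _ _).trans (add_le_add ?_ ?_)) ?_)
    · rw [norm_mul, Complex.norm_real, Real.norm_eq_abs]
      simpa using h1
    · rw [mul_assoc, norm_mul, ← Complex.ofReal_mul, Complex.norm_real, Real.norm_eq_abs]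
      simpa using h2
    · rw [norm_mul, norm_mul, norm_mul, Complex.norm_real, Complex.norm_real, Real.norm_eq_abs,
        Real.norm_eq_abs, RCLike.norm_ofNat]
      gcongr
  calc _ ≤ ‖Complex.I / (2 * k)‖ * (4 * (C / R ^ 2) + 4 * (2 * C / R ^ 2) +
      4 * (C / R ^ 2) * B * T) := by gcongr
    _ = _ := by ring

/-- Half of the Gaussian pays for the quadratic factor, by `1 + t ≤ exp t`. -/
lemma poly_mul_gauss_le {κ e t : ℝ} (hκ : 0 < κ) :
    t * (t + e) * Real.exp (-(κ * t ^ 2)) ≤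
      (4 / κ + e ^ 2) * Real.exp (-(κ / 2 * t ^ 2)) := by
  have h1 : κ / 2 * t ^ 2 + 1 ≤ Real.exp (κ / 2 * t ^ 2) := Real.add_one_le_exp _
  have h2 : t * (t + e) ≤ (4 / κ + e ^ 2) * (κ / 2 * t ^ 2 + 1) := by
    have : (4 / κ + e ^ 2) * (κ / 2 * t ^ 2 + 1) =
      2 * t ^ 2 + 4 / κ + e ^ 2 * (κ / 2 * t ^ 2) + e ^ 2 := by field_simp; ring
    rw [this]
    have : 0 ≤ 4 / κ + e ^ 2 * (κ / 2 * t ^ 2) := by positivity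
    nlinarith [sq_nonneg (t - e)]
  have h3 : Real.exp (-(κ * t ^ 2)) =
      Real.exp (-(κ / 2 * t ^ 2)) * Real.exp (-(κ / 2 * t ^ 2)) := by
    rw [← Real.exp_add]; ring_nf
  have h4 : Real.exp (κ / 2 * t ^ 2) * Real.exp (-(κ / 2 * t ^ 2)) = 1 := by
    rw [← Real.exp_add]; simp
  have hp : 0 ≤ 4 / κ + e ^ 2 := by positivity
  calc t * (t + e) * Real.exp (-(κ * t ^ 2))
      ≤ ((4 / κ + e ^ 2) * Real.exp (κ / 2 * t ^ 2)) * Real.exp (-(κ * t ^ 2)) := by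
        refine mul_le_mul_of_nonneg_right (h2.trans ?_) (Real.exp_pos _).le
        gcongr
    _ = (4 / κ + e ^ 2) * (Real.exp (κ / 2 * t ^ 2) * Real.exp (-(κ / 2 * t ^ 2))) *
        Real.exp (-(κ / 2 * t ^ 2)) := by rw [h3]; ring
    _ = _ := by rw [h4]; ring

/-- Dominated convergence: at each point the outer cutoff is eventually 1, and the integrand without
it is continuous with Gaussian decay. -/
lemma IsTotalField.tendsto_integral_outer (hf : IsProfile f X₁ X₂) (hu : IsTotalField k θ f X₁ X₂ u)
    (hk : 0 < k.im) (hdec : ScatteredDecays k θ f X₁ X₂ u)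
    {F : ℝ → ℝ} {δ x xs : ℝ} (hδ : 0 < δ) (hxs : x < xs) (ys : Plane)
    (hfF : ∀ y : Plane, (x, y) ∉ exterior f X₁ X₂ → ‖y‖ ^ 2 ≤ F x) :
    Tendsto (fun R : ℝ => ∫ y, u x y * (kernel k xs ys x y *
        ((inner₀ F δ x (‖y‖ ^ 2) * outer₀ R (‖y‖ ^ 2) : ℝ) : ℂ))) atTop
      (𝓝 (∫ y, u x y * (kernel k xs ys x y * (inner₀ F δ x (‖y‖ ^ 2) : ℂ)))) := by
  have hc := hu.continuous_inner hf hδ hxs ys hfF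
  obtain ⟨A, κ, R, hA, hκ, hR0, hR⟩ := hdec.exists_kernel_bound hk (a := x) (b := x) hxs ys
  have hint : Integrable fun y => u x y * (kernel k xs ys x y * (inner₀ F δ x (‖y‖ ^ 2) : ℂ)) := by
    refine integrable_of_continuous_of_gauss hc (A := A) (R := R) hκ fun y hy => ?_
    by_cases hE : (x, y) ∈ exterior f X₁ X₂
    · refine le_trans ?_ (hR x (Set.left_mem_Icc.2 le_rfl) y hy hE)
      rw [norm_mul, norm_mul, Complex.norm_real, Real.norm_eq_abs,
        abs_of_nonneg (inner₀_mem F δ x _).1]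
      have := (inner₀_mem F δ x (‖y‖ ^ 2)).2
      gcongr
      exact mul_le_of_le_one_right (norm_nonneg _) this
    · have : inner₀ F δ x (‖y‖ ^ 2) = 0 := step_eq_zero
        ((div_nonpos_of_nonpos_of_nonneg (by linarith [hfF y hE]) hδ.le).trans zero_le_one)
      simp [this]; positivity
  have hrw : ∀ R : ℝ, (fun y => u x y * (kernel k xs ys x y *
        ((inner₀ F δ x (‖y‖ ^ 2) * outer₀ R (‖y‖ ^ 2) : ℝ) : ℂ))) = fun y =>
        u x y * (kernel k xs ys x y * (inner₀ F δ x (‖y‖ ^ 2) : ℂ)) * (outer₀ R (‖y‖ ^ 2) : ℂ) := by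
    intro R; ext y; push_cast; ring
  simp_rw [hrw]
  refine tendsto_integral_filter_of_dominated_convergence _ ?_ ?_ hint.norm ?_
  · refine Eventually.of_forall fun R => (hc.mul (Complex.continuous_ofReal.comp ?_)).aestronglyMeasurable
    have s0 : Continuous step := (contDiff_step (n := 0)).continuous
    unfold outer₀
    fun_prop
  · refine Eventually.of_forall fun R => Eventually.of_forall fun y => ?_
    rw [norm_mul, Complex.norm_real, Real.norm_eq_abs, abs_of_nonneg (outer₀_mem _ _).1]
    exact mul_le_of_le_one_right (norm_nonneg _) (outer₀_mem _ _).2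
  · refine Eventually.of_forall fun y => ?_
    refine tendsto_const_nhds.congr' ?_
    filter_upwards [eventually_ge_atTop ‖y‖, eventually_gt_atTop 0] with R hR hR0
    rw [(outer_of_le hR0 (pow_le_pow_left₀ (norm_nonneg _) hR 2)).1]
    simp

/-- Green's identity with an inner cutoff only, and the continuity of its right-hand side. -/
theorem IsTotalField.green_identity_inner (hf : IsProfile f X₁ X₂) (hu : IsTotalField k θ f X₁ X₂ u)
    (hk : 0 < k.im) (hdec : ScatteredDecays k θ f X₁ X₂ u) {F F' : ℝ → ℝ} {J : Set ℝ}
    {δ xs a b : ℝ} (hJo : IsOpen J) (hJ : J ⊆ Set.Iio xs)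
    (hF : ∀ x ∈ J, HasDerivAt F (F' x) x) (hF' : ContinuousOn F' J) (hδ : 0 < δ)
    (hfF : ∀ x ∈ J, ∀ y : Plane, (x, y) ∉ exterior f X₁ X₂ → ‖y‖ ^ 2 ≤ F x) (ys : Plane)
    (hab : a ≤ b) (hI : Set.Icc a b ⊆ J) :
    ContinuousOn (fun x => ∫ y, u x y *
      cutoffSource k xs ys (innerX F F' δ) (innerS F δ) (innerSS F δ) x y) (Set.Icc a b) ∧
    (∫ y, u b y * (kernel k xs ys b y * (inner₀ F δ b (‖y‖ ^ 2) : ℂ))) -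
      ∫ y, u a y * (kernel k xs ys a y * (inner₀ F δ a (‖y‖ ^ 2) : ℂ)) =
    ∫ x in a..b, ∫ y, u x y *
      cutoffSource k xs ys (innerX F F' δ) (innerS F δ) (innerSS F δ) x y := by
  have haJ : a ∈ J := hI (Set.left_mem_Icc.2 hab)
  have hbJ : b ∈ J := hI (Set.right_mem_Icc.2 hab)
  have hk0 : k ≠ 0 := by rintro rfl; simp at hk
  have hbxs : b < xs := hJ hbJ
  have hLHS := (hu.tendsto_integral_outer hf hk hdec hδ (hJ hbJ) ys (hfF b hbJ)).sub
    (hu.tendsto_integral_outer hf hk hdec hδ (hJ haJ) ys (hfF a haJ))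
  obtain ⟨A, κ, R₀, hA, hκ, hR00, hR₀⟩ := hdec.exists_kernel_bound hk (a := a) (b := b) hbxs ys
  obtain ⟨C, hC, hCb⟩ := exists_step_bound
  have hFc : ContinuousOn F (Set.Icc a b) := fun x hx =>
    (hF x (hI hx)).continuousAt.continuousWithinAt
  obtain ⟨M, hM⟩ := isCompact_Icc.exists_bound_of_continuousOn hFc
  set B : ℝ := ‖k‖ / (xs - b) with hB
  have hB0 : 0 ≤ B := div_nonneg (norm_nonneg _) (by linarith)
  set D : ℝ := ‖Complex.I / (2 * k)‖
  -- An integrable majorant, up to the factor `1 / R ^ 2`, of the terms in which the outer cutoff is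
  -- differentiated.
  set G : Plane → ℝ := fun y => A * Real.exp (-(κ * ‖y‖ ^ 2)) *
    (D * C * (12 + 4 * B * (‖y‖ * (‖y‖ + ‖ys‖)))) with hG
  have hGi : Integrable G := by
    have h1 := integrable_gauss hκ
    have h2 : Integrable fun y : Plane => ‖y‖ * (‖y‖ + ‖ys‖) * Real.exp (-(κ * ‖y‖ ^ 2)) := by
      refine Integrable.mono' ((integrable_gauss (half_pos hκ)).const_mul (4 / κ + ‖ys‖ ^ 2))
        (by fun_prop) (Eventually.of_forall fun y => ?_)
      rw [Real.norm_of_nonneg (by positivity)]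
      exact poly_mul_gauss_le hκ
    refine ((h1.const_mul (A * D * C * 12)).add (h2.const_mul (A * D * C * 4 * B))).congr
      (Eventually.of_forall fun y => ?_)
    simp only [hG, Pi.add_apply]
    ring
  have hcut := fun {R : ℝ} (hR : 0 < R) => isCutoff_step (R := R) hJo hF hF' hδ hR hfF
  -- the outer cutoff changes the source term by a small amount only
  have hdiff : ∀ R : ℝ, 0 < R → R₀ ≤ R → M + 2 * δ ≤ R ^ 2 → ∀ x ∈ Set.Icc a b,
      ‖(∫ y, u x y * cutoffSource k xs ys (fun x s => innerX F F' δ x s * outer₀ R s)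
        (fun x s => innerS F δ x s * outer₀ R s + inner₀ F δ x s * outerS R s)
        (fun x s => innerSS F δ x s * outer₀ R s + 2 * (innerS F δ x s * outerS R s) +
          inner₀ F δ x s * outerSS R s) x y) -
        ∫ y, u x y * cutoffSource k xs ys (innerX F F' δ) (innerS F δ) (innerSS F δ) x y‖ ≤
      1 / R ^ 2 * ∫ y, G y := by
    intro R hR hRR hMR x hx
    set S : Plane → ℂ := fun y =>
      u x y * cutoffSource k xs ys (fun x s => innerX F F' δ x s * outer₀ R s)
        (fun x s => innerS F δ x s * outer₀ R s + inner₀ F δ x s * outerS R s)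
        (fun x s => innerSS F δ x s * outer₀ R s + 2 * (innerS F δ x s * outerS R s) +
          inner₀ F δ x s * outerSS R s) x y with hS
    set S₀ : Plane → ℂ := fun y =>
      u x y * cutoffSource k xs ys (innerX F F' δ) (innerS F δ) (innerSS F δ) x y with hS₀
    have hFM : F x ≤ M := (le_abs_self _).trans (hM x hx)
    have hSi : Integrable S := by
      refine (continuous_slice (hI hx) (G := fun x y => u x y *
        cutoffSource k xs ys _ _ _ x y)
        (hu.continuousOn_source hf (hcut hR) hJ ys)).integrable_of_hasCompactSupport
        ((hcut hR).hasCompactSupport (hI hx) fun y hy => ?_)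
      simp only [cutoffSource]
      rw [hy.2.1, hy.2.2.1, hy.2.2.2]
      simp
    -- Derivatives of the inner cutoff live in `‖y‖ ^ 2 ≤ M + 2 * δ ≤ R ^ 2`, where the outer cutoff
    -- is 1. Hence the two sources agree in the disc of radius `R`, and the one without the outer
    -- cutoff is zero outside it.
    have hS0eq : S₀ = (Metric.closedBall (0 : Plane) R).indicator S := by
      ext y
      by_cases hy : y ∈ Metric.closedBall (0 : Plane) R
      · rw [Set.indicator_of_mem hy]
        rw [mem_closedBall_zero_iff] at hy
        have ho := outer_of_le hR (pow_le_pow_left₀ (norm_nonneg _) hy 2)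
        simp [hS, hS₀, cutoffSource, ho]
      · rw [Set.indicator_of_notMem hy]
        rw [mem_closedBall_zero_iff, not_le] at hy
        have : R ^ 2 ≤ ‖y‖ ^ 2 := pow_le_pow_left₀ hR.le hy.le 2
        have hi := inner_of_ge (F := F) (F' := F') (x := x) hδ (s := ‖y‖ ^ 2) (by linarith)
        simp [hS₀, cutoffSource, hi]
    rw [hS0eq, ← integral_sub hSi (hSi.indicator measurableSet_closedBall), ← integral_const_mul]
    refine norm_integral_le_of_norm_le (hGi.const_mul _) (Eventually.of_forall fun y => ?_)
    have hGy : 0 ≤ 1 / R ^ 2 * G y := by positivity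
    by_cases hy : y ∈ Metric.closedBall (0 : Plane) R
    · rw [Set.indicator_of_mem hy]
      simpa using hGy
    rw [Set.indicator_of_notMem hy, sub_zero]
    rw [mem_closedBall_zero_iff, not_le] at hy
    have hRy : R ^ 2 ≤ ‖y‖ ^ 2 := pow_le_pow_left₀ hR.le hy.le 2
    have hi := inner_of_ge (F := F) (F' := F') (x := x) hδ (s := ‖y‖ ^ 2) (by linarith)
    have hE : (x, y) ∈ exterior f X₁ X₂ := by
      by_contra hE
      have := hfF x (hI hx) y hE
      linarith
    have hβ : ‖Complex.I * k / ((xs - x : ℝ) : ℂ)‖ ≤ B := by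
      have hx2 := hx.2
      have : 0 < xs - b := by linarith
      rw [norm_div, norm_mul, Complex.norm_I, one_mul, Complex.norm_real, Real.norm_eq_abs,
        abs_of_pos (by linarith)]
      exact div_le_div_of_nonneg_left (norm_nonneg _) this (by linarith)
    have hfac := norm_outer_factor_le (k := k) hC hCb hR hβ (norm_dotSub_le ys y) (sq_nonneg ‖y‖)
    have hker := hR₀ x hx y (hRR.trans hy.le) hE
    have : S y = u x y * kernel k xs ys x y * (Complex.I / (2 * k) *
        (4 * (outerS R (‖y‖ ^ 2) : ℂ) + 4 * ((‖y‖ ^ 2 : ℝ) : ℂ) * (outerSS R (‖y‖ ^ 2) : ℂ) +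
      4 * (outerS R (‖y‖ ^ 2) : ℂ) * (Complex.I * k / ((xs - x : ℝ) : ℂ)) * (dotSub ys y : ℂ))) := by
      simp [hS, cutoffSource, hi]
      ring
    rw [this, norm_mul, norm_mul]
    calc _ ≤ (A * Real.exp (-(κ * ‖y‖ ^ 2))) * (1 / R ^ 2 *
        (D * C * (12 + 4 * B * (‖y‖ * (‖y‖ + ‖ys‖))))) := by gcongr
      _ = _ := by simp only [hG]; ring
  have hint : ∀ R : ℝ, 0 < R → ContinuousOn (fun x =>
      ∫ y, u x y * cutoffSource k xs ys (fun x s => innerX F F' δ x s * outer₀ R s)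
        (fun x s => innerS F δ x s * outer₀ R s + inner₀ F δ x s * outerS R s)
        (fun x s => innerSS F δ x s * outer₀ R s + 2 * (innerS F δ x s * outerS R s) +
          inner₀ F δ x s * outerSS R s) x y) J := fun R hR =>
    (hcut hR).continuousOn_integral (hu.continuousOn_source hf (hcut hR) hJ ys) fun x y h => by
      simp only [cutoffSource]
      rw [h.2.1, h.2.2.1, h.2.2.2]
      simp
  have huI : Set.uIcc a b = Set.Icc a b := Set.uIcc_of_le hab
  have hev : ∀ᶠ R : ℝ in atTop, 0 < R ∧ R₀ ≤ R ∧ M + 2 * δ ≤ R ^ 2 := by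
    filter_upwards [eventually_gt_atTop 0, eventually_ge_atTop R₀,
      (tendsto_pow_atTop two_ne_zero).eventually_ge_atTop (M + 2 * δ)] with R h1 h2 h3
    exact ⟨h1, h2, h3⟩
  have hlim : Tendsto (fun R : ℝ => 1 / R ^ 2 * ∫ y, G y) atTop (𝓝 0) := by
    have : Tendsto (fun R : ℝ => 1 / R ^ 2) atTop (𝓝 0) := by
      simp only [one_div]
      exact (tendsto_pow_atTop (α := ℝ) two_ne_zero).inv_tendsto_atTop
    simpa using this.mul_const (∫ y, G y)
  have hcont0 : ContinuousOn (fun x => ∫ y, u x y *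
      cutoffSource k xs ys (innerX F F' δ) (innerS F δ) (innerSS F δ) x y) (Set.Icc a b) := by
    -- `hdiff` is uniform in `x`, so continuity survives the limit in `R`.
    refine TendstoUniformlyOn.continuousOn (p := atTop) (F := fun (R : ℝ) x =>
      ∫ y, u x y * cutoffSource k xs ys (fun x s => innerX F F' δ x s * outer₀ R s)
        (fun x s => innerS F δ x s * outer₀ R s + inner₀ F δ x s * outerS R s)
        (fun x s => innerSS F δ x s * outer₀ R s + 2 * (innerS F δ x s * outerS R s) +
          inner₀ F δ x s * outerSS R s) x y) ?_
      (Eventually.frequently ?_)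
    · rw [Metric.tendstoUniformlyOn_iff]
      intro η hη
      filter_upwards [hev, hlim.eventually (Iio_mem_nhds hη)] with R hR hlt x hx
      rw [dist_comm, dist_eq_norm]
      exact (hdiff R hR.1 hR.2.1 hR.2.2 x hx).trans_lt hlt
    · filter_upwards [hev] with R hR using (hint R hR.1).mono hI
  refine ⟨hcont0, tendsto_nhds_unique hLHS ?_⟩
  rw [tendsto_iff_norm_sub_tendsto_zero]
  refine squeeze_zero' (Eventually.of_forall fun _ => norm_nonneg _)
    (g := fun R => 1 / R ^ 2 * (∫ y, G y) * |b - a|) ?_ (by simpa using hlim.mul_const |b - a|)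
  filter_upwards [hev] with R hR
  rw [hu.green_identity hf hk0 (hcut hR.1) hJ ys hab hI,
    ← intervalIntegral.integral_sub (((hint R hR.1).mono hI |>.mono huI.subset).intervalIntegrable)
    ((hcont0.mono huI.subset).intervalIntegrable)]
  refine intervalIntegral.norm_integral_le_of_norm_le_const fun x hx => ?_
  rw [Set.uIoc_of_le hab] at hx
  exact hdiff R hR.1 hR.2.1 hR.2.2 x (Set.Ioc_subset_Icc_self hx)

end

/-! ### Plane integrals, the energy of slices, and the size of the body near a tip -/

section

variable {k : ℂ} {θ : ℝ} {f : ℝ → ℝ} {X₁ : ℝ} {X₂ : EReal} {u : ℝ → Plane → ℂ}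

/-- The part of the exterior in a transversal plane. -/
def extSlice (f : ℝ → ℝ) (X₁ : ℝ) (X₂ : EReal) (x : ℝ) : Set Plane :=
  {y | (x, y) ∈ exterior f X₁ X₂}

/-- The integral of the field against Green's function over a transversal plane. -/
noncomputable def planeIntegral (k : ℂ) (f : ℝ → ℝ) (X₁ : ℝ) (X₂ : EReal) (u : ℝ → Plane → ℂ)
    (xs : ℝ) (ys : Plane) (x : ℝ) : ℂ :=
  ∫ y in extSlice f X₁ X₂ x, u x y * kernel k xs ys x y

lemma measurableSet_extSlice (hf : IsProfile f X₁ X₂) (x : ℝ) :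
    MeasurableSet (extSlice f X₁ X₂ x) := (isOpen_extSlice hf x).measurableSet

/-- Off the tip planes the field is continuous up to the circle in which the surface cuts the plane,
hence bounded on bounded parts of the slice. In a tip plane the tip itself is missing from the
domain of continuity. -/
lemma IsTotalField.exists_closed_slice (hu : IsTotalField k θ f X₁ X₂ u) {x : ℝ}
    (h1 : x ≠ X₁) (h2 : (x : EReal) ≠ X₂) :
    ∃ Z : Set Plane, IsClosed Z ∧ extSlice f X₁ X₂ x ⊆ Z ∧ ContinuousOn (u x) Z := by
  have hc : ∀ Z : Set Plane, (∀ y ∈ Z, (x, y) ∈ exterior f X₁ X₂ ∪ surface f X₁ X₂) →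
      ContinuousOn (u x) Z := fun Z hZ =>
    hu.continuousOn.comp (f := fun y : Plane => (x, y)) (by fun_prop) hZ
  by_cases hx : X₁ < x ∧ (x : EReal) < X₂
  · refine ⟨{y | f x ≤ ‖y‖}, isClosed_le continuous_const continuous_norm, ?_, hc _ ?_⟩
    · intro y hy
      exact (hy hx.1.le hx.2.le).le
    · intro y hy
      have hy' : f x ≤ ‖y‖ := hy
      rcases hy'.lt_or_eq with h | h
      · exact Or.inl fun _ _ => h
      · exact Or.inr ⟨hx.1, hx.2, h.symm⟩
  · refine ⟨Set.univ, isClosed_univ, Set.subset_univ _, hc _ fun y _ => Or.inl fun h3 h4 => ?_⟩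
    exact absurd ⟨lt_of_le_of_ne h3 h1.symm, lt_of_le_of_ne h4 h2⟩ hx

/-- Continuity up to a closed set handles the bounded part, Gaussian decay the rest. -/
lemma IsTotalField.integrableOn_slice (hf : IsProfile f X₁ X₂) (hu : IsTotalField k θ f X₁ X₂ u)
    (hk : 0 < k.im) (hdec : ScatteredDecays k θ f X₁ X₂ u) {xs x : ℝ} (hxs : x < xs) (ys : Plane)
    (h1 : x ≠ X₁) (h2 : (x : EReal) ≠ X₂) :
    IntegrableOn (fun y => u x y * kernel k xs ys x y) (extSlice f X₁ X₂ x) := by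
  obtain ⟨Z, hZ, hsub, hc⟩ := hu.exists_closed_slice h1 h2
  obtain ⟨A, κ, R, hA, hκ, hR0, hR⟩ := hdec.exists_kernel_bound hk (a := x) (b := x) hxs ys
  have hm := measurableSet_extSlice hf x
  have hcg := hc.mul (continuous_kernel k hxs ys).continuousOn (s := Z)
  have e1 : IntegrableOn (fun y => u x y * kernel k xs ys x y)
      (extSlice f X₁ X₂ x ∩ Metric.closedBall 0 R) := by
    have : IsCompact (Z ∩ Metric.closedBall 0 R) := (isCompact_closedBall _ _).inter_left hZ
    exact ((hcg.mono Set.inter_subset_left).integrableOn_compact this).mono_set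
      (Set.inter_subset_inter_left _ hsub)
  have e2 : IntegrableOn (fun y => u x y * kernel k xs ys x y)
      (extSlice f X₁ X₂ x ∩ (Metric.closedBall 0 R)ᶜ) := by
    refine Integrable.mono' (((integrable_gauss hκ).const_mul A).integrableOn) ?_ ?_
    · exact ((hcg.mono hsub).mono Set.inter_subset_left).aestronglyMeasurable
        (hm.inter measurableSet_closedBall.compl)
    · rw [ae_restrict_iff' (hm.inter measurableSet_closedBall.compl)]
      refine Eventually.of_forall fun y hy => ?_
      have hy2 := hy.2
      simp only [Set.mem_compl_iff, mem_closedBall_zero_iff, not_le] at hy2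
      rw [norm_mul]
      exact hR x (Set.left_mem_Icc.2 le_rfl) y hy2.le hy.1
  have := e1.union e2
  rwa [← Set.inter_union_distrib_left, Set.union_compl_self, Set.inter_univ] at this

/-- The energy in a bounded part of a transversal plane. -/
noncomputable def energy (f : ℝ → ℝ) (X₁ : ℝ) (X₂ : EReal) (u : ℝ → Plane → ℂ) (R x : ℝ) :
    ENNReal :=
  ∫⁻ y in extSlice f X₁ X₂ x ∩ Metric.closedBall 0 R, ENNReal.ofReal (‖u x y‖ ^ 2)

/-- Tonelli's theorem on a bounded part of the exterior, where Meixner's condition applies. -/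
lemma IsTotalField.lintegral_energy_lt_top (hf : IsProfile f X₁ X₂)
    (hu : IsTotalField k θ f X₁ X₂ u) (R a b : ℝ) :
    ∫⁻ x in Set.Icc a b, energy f X₁ X₂ u R x < ⊤ := by
  set S : Set (ℝ × Plane) := exterior f X₁ X₂ ∩ (Set.Icc a b ×ˢ Metric.closedBall 0 R) with hS
  have hSm : MeasurableSet S := (isOpen_exterior hf).measurableSet.inter
    (measurableSet_Icc.prod measurableSet_closedBall)
  set G : ℝ × Plane → ENNReal := S.indicator fun p => ENNReal.ofReal (‖u p.1 p.2‖ ^ 2) with hG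
  have hGm : AEMeasurable G (volume : Measure (ℝ × Plane)) := by
    rw [hG, aemeasurable_indicator_iff hSm]
    have : AEStronglyMeasurable (fun p : ℝ × Plane => u p.1 p.2) (volume.restrict S) :=
      (hu.continuousOn_ext.mono Set.inter_subset_left).aestronglyMeasurable hSm
    exact (this.norm.aemeasurable.pow_const 2).ennreal_ofReal
  have e1 : ∫⁻ x in Set.Icc a b, energy f X₁ X₂ u R x = ∫⁻ p, G p := by
    rw [Measure.volume_eq_prod] at hGm ⊢
    rw [lintegral_prod _ hGm, ← lintegral_indicator measurableSet_Icc]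
    refine lintegral_congr fun x => ?_
    by_cases hx : x ∈ Set.Icc a b
    · rw [Set.indicator_of_mem hx, energy, ← lintegral_indicator
        ((measurableSet_extSlice hf x).inter measurableSet_closedBall)]
      refine lintegral_congr fun y => ?_
      have : (x, y) ∈ S ↔ y ∈ extSlice f X₁ X₂ x ∩ Metric.closedBall 0 R :=
        ⟨fun h => ⟨h.1, h.2.2⟩, fun h => ⟨h.1, hx, h.2⟩⟩
      rw [hG]
      by_cases hy : (x, y) ∈ S
      · rw [Set.indicator_of_mem hy, Set.indicator_of_mem (this.1 hy)]
      · rw [Set.indicator_of_notMem hy, Set.indicator_of_notMem (this.not.1 hy)]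
    · rw [Set.indicator_of_notMem hx]
      have : ∀ y, G (x, y) = 0 := fun y => by
        simp [hG, hS, hx]
      simp [this]
  rw [e1, hG, lintegral_indicator hSm]
  set R' := max R (max |a| |b|)
  have hsub : S ⊆ exterior f X₁ X₂ ∩ Metric.closedBall 0 R' := by
    rintro ⟨x, y⟩ ⟨h1, h2, h3⟩
    refine ⟨h1, ?_⟩
    rw [mem_closedBall_zero_iff] at h3 ⊢
    rw [Prod.norm_def]
    exact max_le ((abs_le_max_abs_abs h2.1 h2.2).trans (le_max_right _ _)) (h3.trans (le_max_left _ _))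
  have hint := (hu.meixner R').mono_set hsub
  have h3 := hint.hasFiniteIntegral
  refine lt_of_le_of_lt (lintegral_mono fun p => ?_) h3
  rw [← ofReal_norm]
  refine ENNReal.ofReal_le_ofReal ?_
  rw [Real.norm_of_nonneg (by positivity)]
  exact le_add_of_nonneg_left (by positivity)

/-- Near any plane there are planes, on both sides, with a small energy. -/
lemma IsTotalField.exists_small_energy (hf : IsProfile f X₁ X₂) (hu : IsTotalField k θ f X₁ X₂ u)
    (R X : ℝ) {η : ℝ} (hη : 0 < η) : ∀ᶠ τ in 𝓝[>] (0 : ℝ),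
      (∃ x ∈ Set.Ioo (X + τ / 2) (X + τ), energy f X₁ X₂ u R x ≤ ENNReal.ofReal (η / τ)) ∧
      (∃ x ∈ Set.Ioo (X - τ) (X - τ / 2), energy f X₁ X₂ u R x ≤ ENNReal.ofReal (η / τ)) ∧
      ∫⁻ x in Set.Ioo (X - τ) (X + τ), energy f X₁ X₂ u R x ≤ ENNReal.ofReal η := by
  have h1 := hu.lintegral_energy_lt_top hf R (X - 1) (X + 1)
  have h2 : Tendsto (fun τ : ℝ => ∫⁻ x in Set.Ioo (X - τ) (X + τ), energy f X₁ X₂ u R x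
      ∂(volume.restrict (Set.Icc (X - 1) (X + 1)))) (𝓝[>] 0) (𝓝 0) := by
    -- Absolute continuity of the integral: thin slabs carry little energy.
    refine tendsto_setLIntegral_zero h1.ne ?_
    have h3 : Tendsto (fun τ : ℝ => ENNReal.ofReal (2 * τ)) (𝓝[>] 0) (𝓝 0) := by
      have : Tendsto (fun τ : ℝ => ENNReal.ofReal (2 * τ)) (𝓝 0) (𝓝 (ENNReal.ofReal (2 * 0))) :=
        (ENNReal.continuous_ofReal.comp (by fun_prop)).tendsto 0
      simpa using this.mono_left nhdsWithin_le_nhds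
    refine tendsto_of_tendsto_of_tendsto_of_le_of_le tendsto_const_nhds h3 (fun _ => zero_le)
      fun τ => ?_
    refine (Measure.restrict_apply_le _ _).trans ?_
    rw [Real.volume_Ioo]
    exact ENNReal.ofReal_le_ofReal (by linarith)
  have h4 : ∀ᶠ τ in 𝓝[>] (0 : ℝ), ∫⁻ x in Set.Ioo (X - τ) (X + τ), energy f X₁ X₂ u R x
      ∂(volume.restrict (Set.Icc (X - 1) (X + 1))) < ENNReal.ofReal (η / 2) :=
    h2.eventually (Iio_mem_nhds (by simpa using hη))
  filter_upwards [h4, self_mem_nhdsWithin, mem_nhdsWithin_of_mem_nhds (Iio_mem_nhds one_pos)]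
    with τ h5 h6 h7
  have h6' : (0 : ℝ) < τ := h6
  have h7' : τ < 1 := h7
  have h8 : Set.Ioo (X - τ) (X + τ) ⊆ Set.Icc (X - 1) (X + 1) := fun x hx =>
    ⟨by linarith [hx.1], by linarith [hx.2]⟩
  rw [Measure.restrict_restrict measurableSet_Ioo, Set.inter_eq_left.2 h8] at h5
  -- Chebyshev's argument on a half-slab of width `τ / 2`: if every plane in it had energy above `η
  -- / τ`, the slab would carry at least `η / 2`.
  have key : ∀ a b : ℝ, b - a = τ / 2 → X - τ ≤ a → b ≤ X + τ →
      ∃ x ∈ Set.Ioo a b, energy f X₁ X₂ u R x ≤ ENNReal.ofReal (η / τ) := by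
    intro a b hab ha hb
    by_contra! hcon
    have h8 : ∫⁻ x in Set.Ioo a b, ENNReal.ofReal (η / τ) ≤
        ∫⁻ x in Set.Ioo (X - τ) (X + τ), energy f X₁ X₂ u R x :=
      (setLIntegral_mono' measurableSet_Ioo fun x hx => (hcon x hx).le).trans
        (lintegral_mono_set (Set.Ioo_subset_Ioo ha hb))
    rw [setLIntegral_const, Real.volume_Ioo, hab, ← ENNReal.ofReal_mul (by positivity)] at h8
    have h9 := h8.trans_lt h5
    have : η / τ * (τ / 2) = η / 2 := by field_simp
    rw [this] at h9
    exact lt_irrefl _ h9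
  exact ⟨key _ _ (by ring) (by linarith) (by linarith),
    key _ _ (by ring) (by linarith) (by linarith),
    h5.le.trans (ENNReal.ofReal_le_ofReal (by linarith))⟩

/-- Young's inequality `t ≤ l * t ^ 2 + 1 / l`, integrated over a disc. The parameter `l` stays
free, to be balanced later against the thickness of a slab. -/
lemma lintegral_norm_le_energy (R : ℝ) {x r l : ℝ} (hl : 0 < l) (hr : r ≤ R) (hr0 : 0 ≤ r) :
    ∫⁻ y in extSlice f X₁ X₂ x ∩ Metric.closedBall 0 r, ENNReal.ofReal ‖u x y‖ ≤
      ENNReal.ofReal l * energy f X₁ X₂ u R x + ENNReal.ofReal (Real.pi * r ^ 2 / l) := by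
  have h1 : ∀ y, ENNReal.ofReal ‖u x y‖ ≤
      ENNReal.ofReal l * ENNReal.ofReal (‖u x y‖ ^ 2) + ENNReal.ofReal (1 / l) := fun y => by
    rw [← ENNReal.ofReal_mul hl.le, ← ENNReal.ofReal_add (by positivity) (by positivity)]
    refine ENNReal.ofReal_le_ofReal ?_
    have : l * ‖u x y‖ ^ 2 + 1 / l - ‖u x y‖ =
        ((l * ‖u x y‖ - 1 / 2) ^ 2 + 3 / 4) / l := by field_simp; ring
    have h2 : 0 ≤ ((l * ‖u x y‖ - 1 / 2) ^ 2 + 3 / 4) / l := by positivity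
    linarith
  refine (lintegral_mono h1).trans ?_
  rw [lintegral_add_right _ measurable_const, lintegral_const_mul' _ _ ENNReal.ofReal_ne_top,
    setLIntegral_const]
  refine add_le_add ?_ ?_
  · refine mul_le_mul_right ?_ _
    exact lintegral_mono_set (Set.inter_subset_inter_right _ (Metric.closedBall_subset_closedBall hr))
  · have h3 : volume (extSlice f X₁ X₂ x ∩ Metric.closedBall (0 : Plane) r) ≤
        ENNReal.ofReal (Real.pi * r ^ 2) := by
      refine (measure_mono Set.inter_subset_right).trans ?_
      rw [EuclideanSpace.volume_closedBall_fin_two, ← ENNReal.ofReal_pow hr0,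
        ← ENNReal.ofReal_mul' Real.pi_pos.le, mul_comm]
    refine (mul_le_mul_right h3 _).trans ?_
    rw [← ENNReal.ofReal_mul (by positivity)]
    exact ENNReal.ofReal_le_ofReal (by rw [div_mul_eq_mul_div, one_mul])

/-- The slope is bounded and `f` vanishes at the tip, so by the mean value theorem the body lies in
a cone there. -/
lemma exists_tip_bound (hf : IsProfile f X₁ X₂) {X : ℝ} (hX : X = X₁ ∨ (X : EReal) = X₂) :
    ∃ C : ℝ, 0 ≤ C ∧ ∀ x : ℝ, X₁ ≤ x → (x : EReal) ≤ X₂ → 0 ≤ f x ∧ f x ≤ C * |x - X| := by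
  obtain ⟨C, hC⟩ := hf.slope
  have hnn : ∀ x : ℝ, X₁ ≤ x → (x : EReal) ≤ X₂ → 0 ≤ f x := by
    intro x h1 h2
    rcases h1.lt_or_eq with h1 | h1
    · rcases h2.lt_or_eq with h2 | h2
      · exact (hf.pos x h1 h2).le
      · exact (hf.rear x h2.symm).ge
    · rw [← h1]; exact hf.front.ge
  have hfX : f X = 0 := by
    rcases hX with h | h
    · rw [h]; exact hf.front
    · exact hf.rear X h.symm
  have hXr : X₁ ≤ X ∧ (X : EReal) ≤ X₂ := by
    rcases hX with h | h
    · exact ⟨h.ge, by rw [h]; exact hf.lt.le⟩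
    · exact ⟨by have := hf.lt; rw [← h] at this; exact (EReal.coe_lt_coe_iff.1 this).le, h.le⟩
  refine ⟨max C 0, le_max_right _ _, fun x h1 h2 => ⟨hnn x h1 h2, ?_⟩⟩
  have hconv : Convex ℝ {x : ℝ | X₁ ≤ x ∧ (x : EReal) ≤ X₂} :=
    (show Set.OrdConnected {x : ℝ | X₁ ≤ x ∧ (x : EReal) ≤ X₂} from
      ⟨fun a ha b hb c hc => ⟨ha.1.trans hc.1,
        (EReal.coe_le_coe_iff.2 hc.2).trans hb.2⟩⟩).convex
  have hlip : ∀ a b : ℝ, a < b → X₁ ≤ a → (b : EReal) ≤ X₂ → |f b - f a| ≤ max C 0 * (b - a) := by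
    intro a b hab ha hb
    obtain ⟨c, hc, hc'⟩ := exists_deriv_eq_slope f hab
      (hf.continuousOn.mono fun z hz => ⟨ha.trans hz.1, (EReal.coe_le_coe_iff.2 hz.2).trans hb⟩)
      (fun z hz => by
        have hz1 : X₁ < z := ha.trans_lt hz.1
        have hz2 : (z : EReal) < X₂ := (EReal.coe_lt_coe_iff.2 hz.2).trans_le hb
        have ho : IsOpen {x : ℝ | X₁ < x ∧ (x : EReal) < X₂} :=
          isOpen_Ioi.inter (isOpen_Iio.preimage continuous_coe_real_ereal)
        exact ((hf.smooth.differentiableOn (by norm_num)).differentiableAt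
          (ho.mem_nhds ⟨hz1, hz2⟩)).differentiableWithinAt)
    have h3 := hC c (ha.trans_lt hc.1) ((EReal.coe_lt_coe_iff.2 hc.2).trans_le hb)
    have hba : 0 < b - a := sub_pos.2 hab
    rw [hc', abs_div, abs_of_pos hba, div_le_iff₀ hba] at h3
    exact h3.trans (by gcongr; exact le_max_left _ _)
  rcases lt_trichotomy x X with h | h | h
  · have := hlip x X h h1 hXr.2
    rw [hfX, zero_sub, abs_neg] at this
    rw [abs_of_neg (sub_neg.2 h), neg_sub]
    exact (le_abs_self _).trans this
  · simp [h, hfX]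
  · have := hlip X x h hXr.1 h2
    rw [hfX, sub_zero] at this
    rw [abs_of_pos (sub_pos.2 h)]
    exact (le_abs_self _).trans this

end

/-! ### Free propagation, and the passage through a tip -/

section

variable {k : ℂ} {θ : ℝ} {f : ℝ → ℝ} {X₁ : ℝ} {X₂ : EReal} {u : ℝ → Plane → ℂ}

lemma exists_no_other_tip (X₁ : ℝ) (X₂ : EReal) (X : ℝ) :
    ∃ τ₀ > 0, ∀ x : ℝ, x ≠ X → |x - X| < τ₀ → x ≠ X₁ ∧ (x : EReal) ≠ X₂ := by
  have hfin : ({x : ℝ | x = X₁ ∨ (x : EReal) = X₂} \ {X}).Finite := by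
    refine Set.Finite.sdiff (Set.Finite.union (Set.finite_singleton X₁)
      (Set.Subsingleton.finite fun x hx y hy => EReal.coe_injective (hx.trans hy.symm)))
  have hmem : ({x : ℝ | x = X₁ ∨ (x : EReal) = X₂} \ {X})ᶜ ∈ 𝓝 X :=
    hfin.isClosed.isOpen_compl.mem_nhds fun h => h.2 rfl
  obtain ⟨τ, hτ, hsub⟩ := Metric.mem_nhds_iff.1 hmem
  refine ⟨τ, hτ, fun x hx hxτ => ?_⟩
  have h1 : x ∈ Metric.ball X τ := by rwa [Metric.mem_ball, Real.dist_eq]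
  have h2 := hsub h1
  constructor
  · exact fun h => h2 ⟨Or.inl h, hx⟩
  · exact fun h => h2 ⟨Or.inr h, hx⟩

/-- The field propagates freely through a slab which does not meet the body. -/
lemma IsTotalField.planeIntegral_const (hf : IsProfile f X₁ X₂) (hu : IsTotalField k θ f X₁ X₂ u)
    (hk : 0 < k.im) (hdec : ScatteredDecays k θ f X₁ X₂ u) {J : Set ℝ} (hJo : IsOpen J) {xs a b : ℝ}
    (hJ : J ⊆ Set.Iio xs) (hE : ∀ x ∈ J, ∀ y, (x, y) ∈ exterior f X₁ X₂) (ys : Plane)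
    (hab : a ≤ b) (hI : Set.Icc a b ⊆ J) :
    planeIntegral k f X₁ X₂ u xs ys b = planeIntegral k f X₁ X₂ u xs ys a := by
  -- With `F = -3` and `δ = 1` the step is already 1 from `s = -1` on: a cutoff that removes nothing
  -- and has no source.
  have h := (hu.green_identity_inner hf hk hdec (F := fun _ => -3) (F' := fun _ => 0) (δ := 1) hJo hJ
    (fun x _ => hasDerivAt_const x _) continuousOn_const one_pos
    (fun x hx y hy => absurd (hE x hx y) hy) ys hab hI).2
  have h1 : ∀ x s, 0 ≤ s → inner₀ (fun _ => -3) 1 x s = 1 ∧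
      innerX (fun _ => -3) (fun _ => 0) 1 x s = 0 ∧ innerS (fun _ => -3) 1 x s = 0 ∧
      innerSS (fun _ => -3) 1 x s = 0 := fun x s hs => inner_of_ge one_pos (by linarith)
  have h2 : ∀ x ∈ J, planeIntegral k f X₁ X₂ u xs ys x =
      ∫ y, u x y * (kernel k xs ys x y * (inner₀ (fun _ => -3) 1 x (‖y‖ ^ 2) : ℂ)) := by
    intro x hx
    have : extSlice f X₁ X₂ x = Set.univ := Set.eq_univ_of_forall fun y => hE x hx y
    rw [planeIntegral, this, setIntegral_univ]
    refine integral_congr_ae (Eventually.of_forall fun y => ?_)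
    simp [(h1 x (‖y‖ ^ 2) (sq_nonneg _)).1]
  have h3 : ∀ x y, cutoffSource k xs ys (innerX (fun _ => -3) (fun _ => 0) 1)
      (innerS (fun _ => -3) 1) (innerSS (fun _ => -3) 1) x y = 0 := fun x y =>
    cutoffSource_eq_zero (h1 x (‖y‖ ^ 2) (sq_nonneg _) |>.imp_left fun _ => rfl)
      (H := fun _ _ => 0)
  simp only [h3, mul_zero, integral_zero, intervalIntegral.integral_zero] at h
  rw [h2 b (hI (Set.right_mem_Icc.2 hab)), h2 a (hI (Set.left_mem_Icc.2 hab)), sub_eq_zero.1 h]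

lemma norm_kernel_le {xs x d : ℝ} (hk : 0 ≤ k.im) (hd : 0 < d) (hx : d ≤ xs - x) (ys y : Plane) :
    ‖kernel k xs ys x y‖ ≤ ‖k‖ / (2 * Real.pi * d) := by
  have hs : 0 < xs - x := hd.trans_le hx
  have hpi := Real.pi_pos
  rw [norm_kernel k (sub_pos.1 hs)]
  have h1 : Real.exp (-(k.im / (2 * (xs - x)) * ‖y - ys‖ ^ 2)) ≤ 1 := by
    rw [Real.exp_le_one_iff, neg_nonpos]; positivity
  refine (mul_le_of_le_one_right (by positivity) h1).trans ?_
  gcongr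

/-- Removing a small disc around the axis does not change the plane integral much. -/
lemma IsTotalField.enorm_planeIntegral_sub (hf : IsProfile f X₁ X₂)
    (hu : IsTotalField k θ f X₁ X₂ u)
    (hk : 0 < k.im) (hdec : ScatteredDecays k θ f X₁ X₂ u) {xs x d τ l : ℝ} (hd : 0 < d)
    (hx : d ≤ xs - x) (ys : Plane) (h1 : x ≠ X₁) (h2 : (x : EReal) ≠ X₂) (hτ : 0 < τ)
    (hτ1 : τ ≤ 1) (hl : 0 < l)
    (hfF : ∀ y : Plane, (x, y) ∉ exterior f X₁ X₂ → ‖y‖ ^ 2 ≤ τ) :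
    ‖planeIntegral k f X₁ X₂ u xs ys x -
      ∫ y, u x y * (kernel k xs ys x y * (inner₀ (fun _ => τ) τ x (‖y‖ ^ 2) : ℂ))‖ₑ ≤
    ENNReal.ofReal (‖k‖ / (2 * Real.pi * d)) * (ENNReal.ofReal l * energy f X₁ X₂ u 2 x +
      ENNReal.ofReal (Real.pi * (3 * τ) / l)) := by
  have hxs : x < xs := by linarith
  have hm := measurableSet_extSlice hf x
  set V : Plane → ℂ := fun y =>
    u x y * (kernel k xs ys x y * (inner₀ (fun _ => τ) τ x (‖y‖ ^ 2) : ℂ)) with hV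
  have hWi := hu.integrableOn_slice hf hk hdec hxs ys h1 h2
  have hVc : Continuous V := hu.continuous_inner hf hτ hxs ys hfF
  have e1 : ∫ y, V y = ∫ y in extSlice f X₁ X₂ x, V y := by
    rw [setIntegral_eq_integral_of_forall_compl_eq_zero]
    intro y hy
    have : inner₀ (fun _ => τ) τ x (‖y‖ ^ 2) = 0 := step_eq_zero
      ((div_nonpos_of_nonpos_of_nonneg (by linarith [hfF y hy]) hτ.le).trans zero_le_one)
    simp [hV, this]
  have hVi : IntegrableOn V (extSlice f X₁ X₂ x) := by
    refine Integrable.mono hWi hVc.aestronglyMeasurable (Eventually.of_forall fun y => ?_)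
    simp only [hV, norm_mul, Complex.norm_real, Real.norm_eq_abs]
    rw [abs_of_nonneg (inner₀_mem _ _ _ _).1, ← mul_assoc]
    exact mul_le_of_le_one_right (by positivity) (inner₀_mem _ _ _ _).2
  -- With `F = δ = τ` the cutoff is 1 from `s = 3 * τ` on. For `τ ≤ 1` this disc lies in the disc of
  -- radius 2 used for the energy.
  have hr : (0 : ℝ) ≤ Real.sqrt (3 * τ) := Real.sqrt_nonneg _
  have hr2 : Real.sqrt (3 * τ) ≤ 2 := by
    rw [Real.sqrt_le_left (by norm_num)]; linarith
  have hr3 : Real.sqrt (3 * τ) ^ 2 = 3 * τ := Real.sq_sqrt (by positivity)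
  rw [planeIntegral, e1, ← integral_sub hWi hVi]
  refine (enorm_integral_le_lintegral_enorm _).trans ?_
  have h3 := lintegral_norm_le_energy (f := f) (X₁ := X₁) (X₂ := X₂) (u := u) 2 (x := x) hl hr2 hr
  rw [hr3] at h3
  refine le_trans ?_ (mul_le_mul_right h3 _)
  rw [← lintegral_const_mul' _ _ ENNReal.ofReal_ne_top,
    ← lintegral_indicator hm, ← lintegral_indicator (hm.inter measurableSet_closedBall)]
  refine lintegral_mono fun y => ?_
  by_cases hy : y ∈ extSlice f X₁ X₂ x
  swap
  · rw [Set.indicator_of_notMem hy]; exact zero_le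
  rw [Set.indicator_of_mem hy]
  by_cases hyr : y ∈ Metric.closedBall (0 : Plane) (Real.sqrt (3 * τ))
  · rw [Set.indicator_of_mem (Set.mem_inter hy hyr), ← ENNReal.ofReal_mul (by have := Real.pi_pos; positivity),
      ← ofReal_norm]
    refine ENNReal.ofReal_le_ofReal ?_
    have : u x y * kernel k xs ys x y - V y = kernel k xs ys x y * u x y *
        ((1 - inner₀ (fun _ => τ) τ x (‖y‖ ^ 2) : ℝ) : ℂ) := by
      simp only [hV]; push_cast; ring
    rw [this, norm_mul, norm_mul, Complex.norm_real, Real.norm_eq_abs]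
    have hi := inner₀_mem (fun _ => τ) τ x (‖y‖ ^ 2)
    have : |1 - inner₀ (fun _ => τ) τ x (‖y‖ ^ 2)| ≤ 1 := by
      rw [abs_of_nonneg (by linarith)]; linarith
    refine (mul_le_of_le_one_right (by positivity) this).trans ?_
    gcongr
    exact norm_kernel_le hk.le hd hx ys y
  · rw [mem_closedBall_zero_iff, not_le] at hyr
    have : 3 * τ ≤ ‖y‖ ^ 2 := by
      rw [← hr3]; exact pow_le_pow_left₀ hr hyr.le 2
    have := (inner_of_ge (F := fun _ => τ) (F' := fun _ => 0) (x := x) hτ (s := ‖y‖ ^ 2)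
      (by linarith)).1
    simp [hV, this]

/-- The source lives in the disc `s ≤ 3 * τ`. The first derivative of the cutoff is at most `C / τ`,
and the second, multiplied by `s`, at most `3 * C / τ`; so only one power of `1 / τ` is lost. -/
lemma IsTotalField.enorm_source_le {xs x d τ l C : ℝ} (hf : IsProfile f X₁ X₂)
    (hk : 0 < k.im) (hd : 0 < d)
    (hx : d ≤ xs - x) (ys : Plane) (hτ : 0 < τ) (hτ1 : τ ≤ 1) (hl : 0 < l) (hC : 0 ≤ C)
    (hCb : ∀ s, |deriv step s| ≤ C ∧ |deriv (deriv step) s| ≤ C)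
    (hfF : ∀ y : Plane, (x, y) ∉ exterior f X₁ X₂ → ‖y‖ ^ 2 ≤ τ) :
    ‖∫ y, u x y * cutoffSource k xs ys (innerX (fun _ => τ) (fun _ => 0) τ) (innerS (fun _ => τ) τ)
      (innerSS (fun _ => τ) τ) x y‖ₑ ≤
    ENNReal.ofReal (‖k‖ / (2 * Real.pi * d) * (‖Complex.I / (2 * k)‖ *
      (16 * C + 4 * C * (‖k‖ / d) * (2 * (2 + ‖ys‖)))) / τ) *
      (ENNReal.ofReal l * energy f X₁ X₂ u 2 x + ENNReal.ofReal (Real.pi * (3 * τ) / l)) := by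
  have hxs : x < xs := by linarith
  have hpi := Real.pi_pos
  have hm := measurableSet_extSlice hf x
  have hr : (0 : ℝ) ≤ Real.sqrt (3 * τ) := Real.sqrt_nonneg _
  have hr2 : Real.sqrt (3 * τ) ≤ 2 := by
    rw [Real.sqrt_le_left (by norm_num)]; linarith
  have hr3 : Real.sqrt (3 * τ) ^ 2 = 3 * τ := Real.sq_sqrt (by positivity)
  refine (enorm_integral_le_lintegral_enorm _).trans ?_
  have h3 := lintegral_norm_le_energy (f := f) (X₁ := X₁) (X₂ := X₂) (u := u) 2 (x := x) hl hr2 hr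
  rw [hr3] at h3
  refine le_trans ?_ (mul_le_mul_right h3 _)
  rw [← lintegral_const_mul' _ _ ENNReal.ofReal_ne_top,
    ← lintegral_indicator (hm.inter measurableSet_closedBall)]
  refine lintegral_mono fun y => ?_
  by_cases hy : y ∈ extSlice f X₁ X₂ x
  swap
  · have h0 : (‖y‖ ^ 2 - τ) / τ ≤ 1 :=
      (div_nonpos_of_nonpos_of_nonneg (by linarith [hfF y hy]) hτ.le).trans zero_le_one
    simp [cutoffSource, innerX, innerS, innerSS, deriv_step_of_le h0, deriv_deriv_step_of_le h0]
  by_cases hyr : y ∈ Metric.closedBall (0 : Plane) (Real.sqrt (3 * τ))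
  · rw [Set.indicator_of_mem (Set.mem_inter hy hyr), ← ENNReal.ofReal_mul (by positivity), ← ofReal_norm]
    refine ENNReal.ofReal_le_ofReal ?_
    rw [mem_closedBall_zero_iff] at hyr
    have hy2 : ‖y‖ ≤ 2 := hyr.trans hr2
    have hys : ‖y‖ ^ 2 ≤ 3 * τ := by
      rw [← hr3]; exact pow_le_pow_left₀ (norm_nonneg _) hyr 2
    have hX : innerX (fun _ => τ) (fun _ => 0) τ x (‖y‖ ^ 2) = 0 := by simp [innerX]
    have b1 : |innerS (fun _ => τ) τ x (‖y‖ ^ 2)| ≤ C / τ := by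
      rw [innerS, abs_div, abs_of_pos hτ]
      gcongr
      exact (hCb _).1
    have b2 : |‖y‖ ^ 2 * innerSS (fun _ => τ) τ x (‖y‖ ^ 2)| ≤ 3 * C / τ := by
      rw [innerSS, abs_mul, abs_div, abs_of_pos (by positivity : 0 < τ ^ 2), abs_of_nonneg (sq_nonneg _)]
      calc _ ≤ 3 * τ * (C / τ ^ 2) := by
            gcongr
            exact (hCb _).2
        _ = _ := by field_simp
    have b3 : ‖Complex.I * k / ((xs - x : ℝ) : ℂ)‖ ≤ ‖k‖ / d := by
      rw [norm_div, norm_mul, Complex.norm_I, one_mul, Complex.norm_real, Real.norm_eq_abs,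
        abs_of_pos (by linarith)]
      gcongr
    have b4 : |dotSub ys y| ≤ 2 * (2 + ‖ys‖) := (norm_dotSub_le ys y).trans (by gcongr)
    have b5 : ‖4 * (innerS (fun _ => τ) τ x (‖y‖ ^ 2) : ℂ) + 4 * ((‖y‖ ^ 2 : ℝ) : ℂ) *
        (innerSS (fun _ => τ) τ x (‖y‖ ^ 2) : ℂ) + 4 * (innerS (fun _ => τ) τ x (‖y‖ ^ 2) : ℂ) *
        (Complex.I * k / ((xs - x : ℝ) : ℂ)) * (dotSub ys y : ℂ)‖ ≤
        4 * (C / τ) + 4 * (3 * C / τ) + 4 * (C / τ) * (‖k‖ / d) * (2 * (2 + ‖ys‖)) := by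
      refine (norm_add_le _ _).trans (add_le_add ((norm_add_le _ _).trans (add_le_add ?_ ?_)) ?_)
      · rw [norm_mul, Complex.norm_real, Real.norm_eq_abs]
        simpa using b1
      · rw [mul_assoc, norm_mul, ← Complex.ofReal_mul, Complex.norm_real, Real.norm_eq_abs]
        simpa using b2
      · rw [norm_mul, norm_mul, norm_mul, Complex.norm_real, Complex.norm_real, Real.norm_eq_abs,
          Real.norm_eq_abs, RCLike.norm_ofNat]
        gcongr
    simp only [cutoffSource]
    rw [hX, Complex.ofReal_zero, zero_add, norm_mul, norm_mul, norm_mul, mul_comm]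
    have b6 := norm_kernel_le hk.le hd hx ys y
    calc _ ≤ ‖k‖ / (2 * Real.pi * d) * (‖Complex.I / (2 * k)‖ * (4 * (C / τ) + 4 * (3 * C / τ) +
          4 * (C / τ) * (‖k‖ / d) * (2 * (2 + ‖ys‖)))) * ‖u x y‖ := by gcongr
      _ = _ := by ring
  · rw [mem_closedBall_zero_iff, not_le] at hyr
    have : 3 * τ ≤ ‖y‖ ^ 2 := by
      rw [← hr3]; exact pow_le_pow_left₀ hr hyr.le 2
    have := (inner_of_ge (F := fun _ => τ) (F' := fun _ => 0) (x := x) hτ (s := ‖y‖ ^ 2)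
      (by linarith)).2
    simp [cutoffSource, this]

/-- The plane integral does not jump at a tip. -/
theorem IsTotalField.tip_crossing (hf : IsProfile f X₁ X₂) (hu : IsTotalField k θ f X₁ X₂ u)
    (hk : 0 < k.im) (hdec : ScatteredDecays k θ f X₁ X₂ u) {X xs : ℝ}
    (hX : X = X₁ ∨ (X : EReal) = X₂) (hxs : X < xs) (ys : Plane) {ε : ℝ} (hε : 0 < ε) :
    ∃ x ∈ Set.Ioo (X - ε) X, ∃ x' ∈ Set.Ioo X (X + ε),
      ‖planeIntegral k f X₁ X₂ u xs ys x' - planeIntegral k f X₁ X₂ u xs ys x‖ < ε := by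
  obtain ⟨C, hC, hCb⟩ := exists_step_bound
  obtain ⟨S, hS, hSb⟩ := exists_tip_bound hf hX
  obtain ⟨τ₀, hτ₀, htips⟩ := exists_no_other_tip X₁ X₂ X
  have hpi := Real.pi_pos
  set d := (xs - X) / 2 with hd'
  have hd : 0 < d := by simp only [hd']; linarith
  set K₁ := ‖k‖ / (2 * Real.pi * d) with hK₁
  set K₂ := K₁ * (‖Complex.I / (2 * k)‖ * (16 * C + 4 * C * (‖k‖ / d) * (2 * (2 + ‖ys‖)))) with hK₂
  have hK₁0 : 0 ≤ K₁ := by positivity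
  have hK₂0 : 0 ≤ K₂ := by positivity
  set K := 2 * (K₁ * (1 + 3 * Real.pi)) + K₂ * (1 + 6 * Real.pi) with hK
  have hK0 : 0 ≤ K := by positivity
  -- The jump will turn out to be at most `K * η`: two end planes contribute through `K₁`, the slab
  -- between them through `K₂`.
  obtain ⟨η, hη, hηε⟩ : ∃ η > 0, K * η < ε :=
    ⟨ε / (K + 1), by positivity, by
      rw [← mul_div_assoc, div_lt_iff₀ (by positivity)]; nlinarith⟩
  have hS2 : Tendsto (fun τ : ℝ => 4 * S ^ 2 * τ) (𝓝[>] 0) (𝓝 0) := by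
    have : Tendsto (fun τ : ℝ => 4 * S ^ 2 * τ) (𝓝 0) (𝓝 (4 * S ^ 2 * 0)) :=
      Continuous.tendsto (by fun_prop) 0
    simpa using this.mono_left nhdsWithin_le_nhds
  have hsm : ∀ c : ℝ, 0 < c → ∀ᶠ τ in 𝓝[>] (0 : ℝ), τ < c := fun c hc =>
    mem_nhdsWithin_of_mem_nhds (Iio_mem_nhds hc)
  -- The slab of half-width `τ` has energy at most `η ^ 2`, and one plane on each side of the tip
  -- has energy at most `η ^ 2 / τ`.
  obtain ⟨τ, ⟨⟨x', hx', hEx'⟩, ⟨x, hx, hEx⟩, hM⟩, hτ, hτε, hτt, hτd, hτ1, hτS⟩ :=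
    ((hu.exists_small_energy hf 2 X (η := η ^ 2) (by positivity)).and
      ((eventually_mem_nhdsWithin (a := (0 : ℝ)) (s := Set.Ioi 0)).and ((hsm ε hε).and ((hsm τ₀ hτ₀).and ((hsm (d / 2) (by positivity)).and ((hsm 1 one_pos).and
        (hS2.eventually (Iio_mem_nhds one_pos)))))))).exists
  have hτ : 0 < τ := hτ
  have hτS : 4 * S ^ 2 * τ < 1 := hτS
  have hx1 : X - τ < x := hx.1
  have hx2 : x < X := by linarith [hx.2]
  have hx1' : X < x' := by linarith [hx'.1]
  have hx2' : x' < X + τ := hx'.2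
  refine ⟨x, ⟨by linarith, hx2⟩, x', ⟨hx1', by linarith⟩, ?_⟩
  have htx := htips x hx2.ne (by rw [abs_of_neg (by linarith)]; linarith)
  have htx' := htips x' hx1'.ne' (by rw [abs_of_pos (by linarith)]; linarith)
  -- In the slab the squared radius of the body is `O(τ ^ 2)`, hence below `τ`, and a cutoff
  -- independent of `x` covers it.
  have hfF : ∀ z ∈ Set.Ioo (X - 2 * τ) (X + 2 * τ), ∀ y : Plane, (z, y) ∉ exterior f X₁ X₂ →
      ‖y‖ ^ 2 ≤ τ := by
    intro z hz y hy
    simp only [exterior, Set.mem_ofPred_eq, not_forall, not_lt] at hy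
    obtain ⟨h1, h2, h3⟩ := hy
    obtain ⟨h4, h5⟩ := hSb z h1 h2
    have h6 : |z - X| ≤ 2 * τ := by rw [abs_le]; constructor <;> linarith [hz.1, hz.2]
    have h7 : ‖y‖ ≤ S * (2 * τ) := h3.trans (h5.trans (by gcongr))
    calc ‖y‖ ^ 2 ≤ (S * (2 * τ)) ^ 2 := by gcongr
      _ = 4 * S ^ 2 * τ * τ := by ring
      _ ≤ 1 * τ := by gcongr
      _ = τ := one_mul τ
  have hdx : ∀ z ∈ Set.Ioo (X - τ) (X + τ), d ≤ xs - z := fun z hz => by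
    have := hz.2; simp only [hd'] at hτd ⊢; linarith
  have hG := (hu.green_identity_inner hf hk hdec (J := Set.Ioo (X - 2 * τ) (X + 2 * τ))
    (F := fun _ => τ) (F' := fun _ => 0) (δ := τ) (xs := xs) isOpen_Ioo
    (fun z hz => by have := hz.2; simp only [hd', Set.mem_Iio] at hτd ⊢; linarith)
    (fun x _ => hasDerivAt_const x _) continuousOn_const hτ hfF ys (a := x) (b := x')
    (by linarith) (fun z hz => ⟨by linarith [hz.1], by linarith [hz.2]⟩)).2
  -- This is the balancing value of `l`. In an end plane Young's inequality gives `l * η ^ 2 / τ =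
  -- η` and `3 * π * τ / l = 3 * π * η`. In the slab it gives `l * η ^ 2` and `6 * π * τ ^ 2 / l`,
  -- each of order `τ * η`, against the factor `1 / τ` of the source.
  have hl : 0 < τ / η := by positivity
  have hend : ∀ z ∈ Set.Ioo (X - τ) (X + τ), z ≠ X₁ → (z : EReal) ≠ X₂ →
      energy f X₁ X₂ u 2 z ≤ ENNReal.ofReal (η ^ 2 / τ) →
      ‖planeIntegral k f X₁ X₂ u xs ys z -
      ∫ y, u z y * (kernel k xs ys z y * (inner₀ (fun _ => τ) τ z (‖y‖ ^ 2) : ℂ))‖ₑ ≤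
        ENNReal.ofReal (K₁ * (1 + 3 * Real.pi) * η) := by
    intro z hz h1 h2 hEz
    refine (hu.enorm_planeIntegral_sub hf hk hdec hd (hdx z hz) ys h1 h2 hτ hτ1.le hl
      (hfF z ⟨by linarith [hz.1], by linarith [hz.2]⟩)).trans ?_
    refine (mul_le_mul_right (add_le_add_left (mul_le_mul_right hEz _) _) _).trans ?_
    rw [← ENNReal.ofReal_mul hl.le, ← ENNReal.ofReal_add (by positivity) (by positivity),
      ← ENNReal.ofReal_mul hK₁0]
    refine ENNReal.ofReal_le_ofReal (le_of_eq ?_)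
    field_simp
  have hint : ‖∫ x in x..x', ∫ y, u x y *
      cutoffSource k xs ys (innerX (fun _ => τ) (fun _ => 0) τ) (innerS (fun _ => τ) τ)
        (innerSS (fun _ => τ) τ) x y‖ₑ ≤ ENNReal.ofReal (K₂ * (1 + 6 * Real.pi) * η) := by
    rw [intervalIntegral.integral_of_le (by linarith)]
    refine (enorm_integral_le_lintegral_enorm _).trans ?_
    have hsub : Set.Ioc x x' ⊆ Set.Ioo (X - τ) (X + τ) := fun z hz =>
      ⟨by linarith [hz.1], by linarith [hz.2]⟩
    refine (lintegral_mono_set hsub).trans ?_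
    refine (setLIntegral_mono' measurableSet_Ioo fun z hz => IsTotalField.enorm_source_le hf hk hd
      (hdx z hz) ys hτ hτ1.le hl hC hCb (hfF z ⟨by linarith [hz.1], by linarith [hz.2]⟩)).trans ?_
    rw [lintegral_const_mul' _ _ ENNReal.ofReal_ne_top, lintegral_add_right _ measurable_const,
      lintegral_const_mul' _ _ ENNReal.ofReal_ne_top, setLIntegral_const, Real.volume_Ioo]
    refine (mul_le_mul_right (add_le_add_left (mul_le_mul_right hM _) _) _).trans ?_
    rw [← ENNReal.ofReal_mul hl.le, ← ENNReal.ofReal_mul (by positivity),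
      ← ENNReal.ofReal_add (by positivity) (mul_nonneg (by positivity) (by linarith)),
      ← ENNReal.ofReal_mul (by positivity)]
    refine ENNReal.ofReal_le_ofReal (le_of_eq ?_)
    rw [← hK₁, ← hK₂]
    field_simp
    ring
  rw [← hG] at hint
  have e1 := hend x ⟨hx1, by linarith⟩ htx.1 htx.2 hEx
  have e2 := hend x' ⟨by linarith, hx2'⟩ htx'.1 htx'.2 hEx'
  rw [← ofReal_norm, ENNReal.ofReal_le_ofReal_iff (by positivity)] at e1 e2 hint
  set a := planeIntegral k f X₁ X₂ u xs ys x
  set a' := planeIntegral k f X₁ X₂ u xs ys x'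
  set b := ∫ y, u x y * (kernel k xs ys x y * (inner₀ (fun _ => τ) τ x (‖y‖ ^ 2) : ℂ))
  set b' := ∫ y, u x' y * (kernel k xs ys x' y * (inner₀ (fun _ => τ) τ x' (‖y‖ ^ 2) : ℂ))
  have : a' - a = (a' - b') + (b' - b) - (a - b) := by ring
  rw [this]
  refine (norm_sub_le _ _).trans_lt ((add_le_add_left (norm_add_le _ _) _).trans_lt ?_)
  refine lt_of_le_of_lt ?_ hηε
  rw [hK]
  linarith

end

/-! ### Gaussian integrals of Green's function -/

lemma integral_kernel_mul_uIn {k : ℂ} (hk : 0 < k.im) (θ : ℝ) {xs x : ℝ} (hx : x < xs)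
    (ys : Plane) : ∫ y, uIn k θ x y * kernel k xs ys x y = uIn k θ xs ys := by
  have hs : 0 < xs - x := sub_pos.2 hx
  have hk0 : k ≠ 0 := by rintro rfl; simp at hk
  have hsC : ((xs - x : ℝ) : ℂ) ≠ 0 := by exact_mod_cast hs.ne'
  set s : ℂ := ((xs - x : ℝ) : ℂ) with hsdef
  set b : ℂ := -(Complex.I * k / (2 * s)) with hb
  have hbr : 0 < b.re := by
    have : b = (((1 / (2 * (xs - x))) : ℝ) : ℂ) * (-(Complex.I * k)) := by
      rw [hb, hsdef]; push_cast; ring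
    rw [this, Complex.re_ofReal_mul]
    simp only [Complex.neg_re, Complex.mul_re, Complex.I_re, Complex.I_im]
    have : 0 < 1 / (2 * (xs - x)) := by positivity
    nlinarith
  have hb0 : b ≠ 0 := by intro h; simp [h] at hbr
  -- In two dimensions the constant of the Gaussian integral is `π / b`, which cancels the prefactor
  -- of the kernel. The completed square advances the phase of the plane wave from `x` to `xs`.
  have key := GaussianFourier.integral_cexp_neg_mul_sq_norm_add (V := Plane) hbr
    (Complex.I * k * θ) (basisVec 0)
  rw [← integral_add_right_eq_self _ ys]
  have e1 : ∀ z : Plane, uIn k θ x (z + ys) * kernel k xs ys x (z + ys) =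
      (k / (2 * Real.pi * Complex.I * s) * Complex.exp (Complex.I * k *
        ((θ * ys 0 - x * θ ^ 2 / 2 : ℝ) : ℂ))) *
      Complex.exp (-b * (‖z‖ : ℂ) ^ 2 + Complex.I * k * θ * (inner ℝ (basisVec 0) z : ℝ)) := by
    intro z
    have hin : (inner ℝ (basisVec 0) z : ℝ) = z 0 := by simp [EuclideanSpace.inner_single_left]
    rw [hin, uIn, kernel, add_sub_cancel_right, ← hsdef]
    calc _ = k / (2 * Real.pi * Complex.I * s) * (Complex.exp (Complex.I * k *
          ((θ * (z + ys) 0 - x * θ ^ 2 / 2 : ℝ) : ℂ)) *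
          Complex.exp (Complex.I * k / (2 * s) * ((‖z‖ ^ 2 : ℝ) : ℂ))) := by ring
      _ = _ := by
        rw [mul_assoc (k / _), ← Complex.exp_add, ← Complex.exp_add]
        congr 2
        rw [hb, PiLp.add_apply]
        push_cast
        ring
  simp_rw [e1]
  rw [integral_const_mul, key]
  have hpi : (Real.pi : ℂ) ≠ 0 := by exact_mod_cast Real.pi_ne_zero
  have e2 : ((Real.pi : ℂ) / b) ^ ((Module.finrank ℝ Plane : ℂ) / 2) = Real.pi / b := by
    simp
  rw [e2]
  have e3 : k / (2 * Real.pi * Complex.I * s) * (Real.pi / b) = 1 := by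
    rw [hb]
    have hI := Complex.I_ne_zero
    field_simp
    simp
  calc _ = (k / (2 * Real.pi * Complex.I * s) * (Real.pi / b)) *
        (Complex.exp (Complex.I * k * ((θ * ys 0 - x * θ ^ 2 / 2 : ℝ) : ℂ)) *
        Complex.exp ((Complex.I * k * θ) ^ 2 * (‖basisVec 0‖ : ℂ) ^ 2 / (4 * b))) := by ring
    _ = _ := by
      rw [e3, one_mul, ← Complex.exp_add, uIn]
      congr 1
      have hn : ‖basisVec 0‖ = 1 := by simp
      rw [hn, hb]
      have hI : Complex.I ^ 2 = -1 := Complex.I_sq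
      have hsx : (xs : ℂ) = s + x := by rw [hsdef]; push_cast; ring
      push_cast
      rw [hsx]
      have : (Complex.I * k * θ) ^ 2 * 1 ^ 2 / (4 * -(Complex.I * k / (2 * s))) =
          -(Complex.I * k * θ ^ 2 * s / 2) := by
        field_simp
        ring
      rw [this]
      ring

lemma integrable_kernel {k : ℂ} (hk : 0 < k.im) {xs x : ℝ} (hx : x < xs) (ys : Plane) :
    Integrable (kernel k xs ys x) := by
  have hs : 0 < xs - x := sub_pos.2 hx
  have h1 := ((integrable_gauss (κ := k.im / (2 * (xs - x))) (by positivity)).comp_sub_right ys).const_mul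
    (‖k‖ / (2 * Real.pi * (xs - x)))
  refine h1.mono' (continuous_kernel k hx ys).aestronglyMeasurable (Eventually.of_forall fun y => ?_)
  rw [norm_kernel k hx]

lemma integral_kernel {k : ℂ} (hk : 0 < k.im) {xs x : ℝ} (hx : x < xs) (ys : Plane) :
    ∫ y, kernel k xs ys x y = 1 := by
  simpa [uIn] using integral_kernel_mul_uIn hk 0 hx ys

/-- The kernel is complex, so its `L¹` norm exceeds its mass in general; an approximate identity
needs only that this norm does not depend on `xs - x`. -/
lemma integral_norm_kernel {k : ℂ} (hk : 0 < k.im) {xs x : ℝ} (hx : x < xs) (ys : Plane) :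
    ∫ y, ‖kernel k xs ys x y‖ = ‖k‖ / k.im := by
  have hs : 0 < xs - x := sub_pos.2 hx
  have hpi := Real.pi_pos
  simp_rw [norm_kernel k hx]
  rw [integral_const_mul, integral_sub_right_eq_self
    (fun y : Plane => Real.exp (-(k.im / (2 * (xs - x)) * ‖y‖ ^ 2))) ys]
  have := GaussianFourier.integral_rexp_neg_mul_sq_norm (V := Plane)
    (b := k.im / (2 * (xs - x))) (by positivity)
  simp only [neg_mul] at this
  rw [this]
  simp
  field_simp

/-! ### Concentration of Green's function at the observation point -/

section

variable {k : ℂ} {θ : ℝ} {f : ℝ → ℝ} {X₁ : ℝ} {X₂ : EReal} {u : ℝ → Plane → ℂ}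

/-- In front of the body the field is the incident wave, which Green's function propagates into
itself. -/
lemma IsTotalField.planeIntegral_front (hu : IsTotalField k θ f X₁ X₂ u) (hk : 0 < k.im)
    {xs x : ℝ} (hx : x < xs) (hx1 : x < X₁) (ys : Plane) :
    planeIntegral k f X₁ X₂ u xs ys x = uIn k θ xs ys := by
  have : extSlice f X₁ X₂ x = Set.univ :=
    Set.eq_univ_of_forall fun y h => absurd h (not_le.2 hx1)
  rw [planeIntegral, this, setIntegral_univ, ← integral_kernel_mul_uIn hk θ hx ys]
  refine integral_congr_ae (Eventually.of_forall fun y => ?_)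
  simp only [sub_eq_zero.1 (hu.initial x hx1 y)]

/-- From `t ^ 3 / 3! ≤ exp t`. A third power is enough: one factor `s` is lost to the amplitude of
the kernel, one to the energy of the chosen plane, and one remains. -/
lemma exp_neg_div_le {μ s : ℝ} (hμ : 0 < μ) (hs : 0 < s) :
    Real.exp (-(μ / s)) ≤ 6 * s ^ 3 / μ ^ 3 := by
  have h := Real.pow_div_factorial_le_exp (μ / s) (by positivity) 3
  have h6 : ((Nat.factorial 3 : ℕ) : ℝ) = 6 := by norm_num [Nat.factorial]
  rw [h6] at h
  rw [Real.exp_neg, inv_le_comm₀ (Real.exp_pos _) (by positivity)]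
  refine le_trans (le_of_eq ?_) h
  field_simp

/-- The exponent is split into halves. One gives a factor that is tiny when `xs - x` is small; the
other, weakened by `xs - x ≤ 1`, gives a fixed Gaussian integrable in `y`. -/
lemma norm_kernel_le_off {k : ℂ} (hk : 0 < k.im) {xs x c : ℝ} (hc : 0 ≤ c) (hx : x < xs)
    (hx1 : xs - x ≤ 1)
    {ys y : Plane} (hy : c ≤ ‖y - ys‖) :
    ‖kernel k xs ys x y‖ ≤ ‖k‖ / (2 * Real.pi * (xs - x)) *
      Real.exp (-(k.im * c ^ 2 / 4 / (xs - x))) * Real.exp (-(k.im / 4 * ‖y - ys‖ ^ 2)) := by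
  have hs : 0 < xs - x := sub_pos.2 hx
  have hpi := Real.pi_pos
  rw [norm_kernel k hx, mul_assoc (‖k‖ / _), ← Real.exp_add]
  gcongr
  have h1 : k.im * c ^ 2 / 4 / (xs - x) ≤ k.im / (4 * (xs - x)) * ‖y - ys‖ ^ 2 := by
    rw [div_div, div_mul_eq_mul_div]
    gcongr
  have h2 : k.im / 4 * ‖y - ys‖ ^ 2 ≤ k.im / (4 * (xs - x)) * ‖y - ys‖ ^ 2 := by
    gcongr
    linarith
  have h3 : k.im / (2 * (xs - x)) = k.im / (4 * (xs - x)) + k.im / (4 * (xs - x)) := by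
    field_simp; norm_num
  rw [h3, add_mul]
  linarith

set_option maxHeartbeats 1000000 in
/-- Green's function concentrates at the observation point. -/
theorem IsTotalField.approx_identity (hf : IsProfile f X₁ X₂) (hu : IsTotalField k θ f X₁ X₂ u)
    (hk : 0 < k.im) (hdec : ScatteredDecays k θ f X₁ X₂ u) {xs : ℝ} {ys : Plane}
    (hE : (xs, ys) ∈ exterior f X₁ X₂) {ε : ℝ} (hε : 0 < ε) :
    ∃ x ∈ Set.Ioo (xs - ε) xs, ‖planeIntegral k f X₁ X₂ u xs ys x - u xs ys‖ < ε := by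
  obtain ⟨τ₀, hτ₀, htips⟩ := exists_no_other_tip X₁ X₂ xs
  obtain ⟨A, K, R, hA, hK, hR0, hR⟩ := hdec.exists_bound (xs - 1) xs
  have hpi := Real.pi_pos
  -- `‖k‖ / k.im` is the `L¹` norm of the kernel, so an oscillation below `η` near `ys` contributes
  -- less than `ε / 2`.
  set η := ε / (2 * (‖k‖ / k.im + 1)) with hη
  have hη0 : 0 < η := by positivity
  have hηε : η * (‖k‖ / k.im) < ε / 2 := by
    rw [hη, div_mul_eq_mul_div, div_lt_iff₀ (by positivity)]
    nlinarith [show 0 ≤ ‖k‖ / k.im by positivity]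
  have hnear : ∀ᶠ p : ℝ × Plane in 𝓝 (xs, ys), p ∈ exterior f X₁ X₂ ∧ ‖u p.1 p.2 - u xs ys‖ < η := by
    refine ((isOpen_exterior hf).eventually_mem hE).and ?_
    have := (hu.continuousOn_ext.continuousAt ((isOpen_exterior hf).mem_nhds hE))
    have h2 := Metric.tendsto_nhds.1 this η hη0
    simpa only [dist_eq_norm] using h2
  obtain ⟨c, hc, hball⟩ := Metric.eventually_nhds_iff_ball.1 hnear
  set m := k.im / 4 with hm
  have hm0 : 0 < m := by positivity
  set μ := k.im * c ^ 2 / 4 with hμ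
  have hμ0 : 0 < μ := by positivity
  set G : Plane → ℝ := fun y => (A * Real.exp (K * ‖y‖) + ‖u xs ys‖) *
    Real.exp (-(m * ‖y - ys‖ ^ 2)) with hG
  have hG0 : ∀ y, 0 ≤ G y := fun y => by positivity
  have hGi : Integrable G := by
    refine Integrable.mono' ((integrable_gauss (κ := m / 4) (by positivity)).const_mul
      ((A + ‖u xs ys‖) * Real.exp (m * ‖ys‖ ^ 2 + K ^ 2 / m))) (by fun_prop)
      (Eventually.of_forall fun y => ?_)
    rw [Real.norm_of_nonneg (hG0 y)]
    have h4 : ‖y‖ ≤ ‖y - ys‖ + ‖ys‖ := by simpa using norm_add_le (y - ys) ys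
    have h5 := gauss_exponent (K := K) hm0 h4 (norm_nonneg _)
    have h6 : (1 : ℝ) ≤ Real.exp (K * ‖y‖) := Real.one_le_exp (by positivity)
    calc G y ≤ ((A + ‖u xs ys‖) * Real.exp (K * ‖y‖)) * Real.exp (-(m * ‖y - ys‖ ^ 2)) := by
          simp only [hG]
          gcongr
          nlinarith [norm_nonneg (u xs ys)]
      _ = (A + ‖u xs ys‖) * Real.exp (-(m * ‖y - ys‖ ^ 2) + K * ‖y‖) := by
          rw [Real.exp_add]; ring
      _ ≤ (A + ‖u xs ys‖) * Real.exp (-(m / 4 * ‖y‖ ^ 2) + (m * ‖ys‖ ^ 2 + K ^ 2 / m)) := by gcongr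
      _ = _ := by rw [Real.exp_add]; ring
  set IG := ∫ y, G y with hIG
  have hIG0 : 0 ≤ IG := integral_nonneg hG0
  -- The summands stand for the field in the disc of radius `R`, through its energy and through the
  -- area of the disc, and for the Gaussian tails.
  set Q := ‖k‖ / (2 * Real.pi) * (6 / μ ^ 3) * (1 + Real.pi * R ^ 2 + IG) with hQ
  have hQ0 : 0 ≤ Q := by positivity
  have hsm : ∀ c : ℝ, 0 < c → ∀ᶠ τ in 𝓝[>] (0 : ℝ), τ < c := fun c hc =>
    mem_nhdsWithin_of_mem_nhds (Iio_mem_nhds hc)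
  -- Planes of small energy have to be chosen: `xs` may be the plane of a tip, near which there is
  -- no pointwise bound for `u`.
  obtain ⟨τ, ⟨-, ⟨x, hx, hEx⟩, -⟩, hτ, hτε, hτt, hτc, hτ1, hτQ⟩ :=
    ((hu.exists_small_energy hf R xs one_pos).and
      ((eventually_mem_nhdsWithin (a := (0 : ℝ)) (s := Set.Ioi 0)).and ((hsm ε hε).and
        ((hsm τ₀ hτ₀).and ((hsm c hc).and ((hsm 1 one_pos).and
        (hsm (ε / (2 * (Q + 1))) (by positivity)))))))).exists
  have hτ : 0 < τ := hτ
  have hx1 : xs - τ < x := hx.1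
  have hxs : x < xs := by linarith [hx.2]
  refine ⟨x, ⟨by linarith, hxs⟩, ?_⟩
  have htx := htips x hxs.ne (by rw [abs_of_neg (by linarith)]; linarith)
  have hs : 0 < xs - x := sub_pos.2 hxs
  set s := xs - x with hsdef
  have hsτ : s < τ := by simp only [hsdef]; linarith
  set ω := ‖k‖ / (2 * Real.pi * s) * Real.exp (-(μ / s)) with hω
  have hω0 : 0 ≤ ω := by positivity
  have hmeas := measurableSet_extSlice hf x
  have hWi := hu.integrableOn_slice hf hk hdec hxs ys htx.1 htx.2
  have hki := integrable_kernel hk hxs ys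
  -- As the kernel has mass 1, the constant `u xs ys` can be put under the integral.
  have e1 : planeIntegral k f X₁ X₂ u xs ys x - u xs ys =
      ∫ y, ((extSlice f X₁ X₂ x).indicator (fun y => u x y * kernel k xs ys x y) y -
        u xs ys * kernel k xs ys x y) := by
    rw [integral_sub ((integrable_indicator_iff hmeas).2 hWi) (hki.const_mul _),
      integral_indicator hmeas, integral_const_mul, integral_kernel hk hxs, mul_one, planeIntegral]
  have e2 : ‖planeIntegral k f X₁ X₂ u xs ys x - u xs ys‖ₑ ≤
      ∫⁻ y, (((extSlice f X₁ X₂ x ∩ Metric.closedBall 0 R).indicator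
        (fun y => ENNReal.ofReal ω * ENNReal.ofReal ‖u x y‖) y + ENNReal.ofReal (ω * G y)) +
        ENNReal.ofReal (η * ‖kernel k xs ys x y‖)) := by
    rw [e1]
    refine (enorm_integral_le_lintegral_enorm _).trans (lintegral_mono fun y => ?_)
    -- Near `ys` the continuity of `u` helps, elsewhere the smallness of the kernel.
    by_cases hyc : ‖y - ys‖ < c
    · have hp := hball (x, y) (by
        rw [Metric.mem_ball, Prod.dist_eq, max_lt_iff]
        refine ⟨?_, by rwa [dist_eq_norm]⟩
        rw [Real.dist_eq, abs_of_neg (by linarith)]; linarith)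
      have hy : y ∈ extSlice f X₁ X₂ x := hp.1
      rw [Set.indicator_of_mem hy, ← sub_mul, ← ofReal_norm, norm_mul]
      refine le_trans ?_ le_add_self
      refine ENNReal.ofReal_le_ofReal ?_
      gcongr
      exact hp.2.le
    · rw [not_lt] at hyc
      have hko : ‖kernel k xs ys x y‖ ≤ ω * Real.exp (-(m * ‖y - ys‖ ^ 2)) :=
        norm_kernel_le_off hk hc.le hxs (by linarith) hyc
      have hko' : ‖kernel k xs ys x y‖ ≤ ω := hko.trans (mul_le_of_le_one_right hω0 (by
        rw [Real.exp_le_one_iff, neg_nonpos]; positivity))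
      refine le_trans ?_ le_self_add
      refine enorm_sub_le.trans ?_
      have hus : ‖u xs ys * kernel k xs ys x y‖ ≤ ω * (‖u xs ys‖ * Real.exp (-(m * ‖y - ys‖ ^ 2))) := by
        rw [norm_mul]
        calc _ ≤ ‖u xs ys‖ * (ω * Real.exp (-(m * ‖y - ys‖ ^ 2))) := by gcongr
          _ = _ := by ring
      have hus' : ‖u xs ys * kernel k xs ys x y‖ ≤ ω * G y := by
        refine hus.trans ?_
        simp only [hG]
        gcongr
        exact le_add_of_nonneg_left (by positivity)
      by_cases hy : y ∈ extSlice f X₁ X₂ x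
      swap
      · rw [Set.indicator_of_notMem hy, Set.indicator_of_notMem (fun h => hy h.1), enorm_zero,
          ← ofReal_norm]
        exact add_le_add_right (ENNReal.ofReal_le_ofReal hus') 0
      rw [Set.indicator_of_mem hy]
      by_cases hyR : y ∈ Metric.closedBall (0 : Plane) R
      · rw [Set.indicator_of_mem (Set.mem_inter hy hyR), ← ofReal_norm, ← ofReal_norm,
          ← ENNReal.ofReal_mul hω0]
        refine add_le_add (ENNReal.ofReal_le_ofReal ?_) (ENNReal.ofReal_le_ofReal hus')
        rw [norm_mul, mul_comm]
        gcongr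
      · rw [Set.indicator_of_notMem (fun h => hyR h.2), ← ofReal_norm, ← ofReal_norm, zero_add,
          ← ENNReal.ofReal_add (norm_nonneg _) (norm_nonneg _)]
        refine ENNReal.ofReal_le_ofReal ?_
        rw [mem_closedBall_zero_iff, not_le] at hyR
        have h7 := hR x ⟨by linarith, hxs.le⟩ y hyR.le hy
        have h8 : ‖u x y * kernel k xs ys x y‖ ≤
            (A * Real.exp (K * ‖y‖)) * (ω * Real.exp (-(m * ‖y - ys‖ ^ 2))) := by
          rw [norm_mul]; gcongr
        simp only [hG]
        nlinarith
  have hmk : Measurable fun y => ENNReal.ofReal (η * ‖kernel k xs ys x y‖) :=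
    (measurable_const.mul (continuous_kernel k hxs ys).norm.measurable).ennreal_ofReal
  have hmG : Measurable fun y => ENNReal.ofReal (ω * G y) := by
    refine Measurable.ennreal_ofReal ?_
    have : Continuous G := by simp only [hG]; fun_prop
    exact measurable_const.mul this.measurable
  rw [lintegral_add_right _ hmk, lintegral_add_right _ hmG,
    ← ofReal_integral_eq_lintegral_ofReal (hki.norm.const_mul η)
      (Eventually.of_forall fun y => by positivity),
    ← ofReal_integral_eq_lintegral_ofReal (hGi.const_mul ω)
      (Eventually.of_forall fun y => mul_nonneg hω0 (hG0 y)),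
    lintegral_indicator (hmeas.inter measurableSet_closedBall),
    lintegral_const_mul' _ _ ENNReal.ofReal_ne_top, integral_const_mul, integral_const_mul,
    integral_norm_kernel hk hxs] at e2
  have h9 := lintegral_norm_le_energy (f := f) (X₁ := X₁) (X₂ := X₂) (u := u) R (x := x) one_pos
    le_rfl hR0
  rw [ENNReal.ofReal_one, one_mul, div_one] at h9
  have h10 : ∫⁻ y in extSlice f X₁ X₂ x ∩ Metric.closedBall 0 R, ENNReal.ofReal ‖u x y‖ ≤
      ENNReal.ofReal (1 / s + Real.pi * R ^ 2) := by
    rw [ENNReal.ofReal_add (by positivity) (by positivity)]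
    refine h9.trans (add_le_add_left (hEx.trans (ENNReal.ofReal_le_ofReal ?_)) _)
    gcongr
  have h11 := e2.trans (add_le_add_left (add_le_add_left (mul_le_mul_right h10 _) _) _)
  rw [← ENNReal.ofReal_mul hω0, ← ENNReal.ofReal_add (by positivity) (by positivity),
    ← ENNReal.ofReal_add (by positivity) (by positivity), ← ofReal_norm,
    ENNReal.ofReal_le_ofReal_iff (by positivity)] at h11
  have h12 : ω * (1 / s + Real.pi * R ^ 2) + ω * IG ≤ Q * τ := by
    have hs1 : s ≤ 1 := by linarith
    have h13 : ω ≤ ‖k‖ / (2 * Real.pi) * (6 / μ ^ 3) * s ^ 2 := by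
      calc ω ≤ ‖k‖ / (2 * Real.pi * s) * (6 * s ^ 3 / μ ^ 3) := by
            simp only [hω]; gcongr; exact exp_neg_div_le hμ0 hs
        _ = _ := by field_simp
    calc _ = ω * (1 / s + Real.pi * R ^ 2 + IG) := by ring
      _ ≤ (‖k‖ / (2 * Real.pi) * (6 / μ ^ 3) * s ^ 2) * (1 / s + Real.pi * R ^ 2 + IG) := by gcongr
      _ = ‖k‖ / (2 * Real.pi) * (6 / μ ^ 3) * (s * (1 + (Real.pi * R ^ 2 + IG) * s)) := by
        field_simp
        ring
      _ ≤ ‖k‖ / (2 * Real.pi) * (6 / μ ^ 3) * (τ * (1 + (Real.pi * R ^ 2 + IG) * 1)) := by gcongr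
      _ = _ := by simp only [hQ]; ring
  have h14 : Q * τ < ε / 2 := by
    rw [lt_div_iff₀ (by positivity)] at hτQ
    nlinarith
  linarith

end

/-! ### Polar coordinates and the trace of the field on the surface -/

/-- The transversal plane as a product. -/
noncomputable def planeEquiv : ℝ × ℝ ≃ᵐ Plane :=
  MeasurableEquiv.finTwoArrow.symm.trans (MeasurableEquiv.toLp 2 (Fin 2 → ℝ))

lemma planeEquiv_apply (a b : ℝ) : planeEquiv (a, b) = !₂[a, b] := rfl

lemma measurePreserving_planeEquiv : MeasurePreserving planeEquiv :=
  (volume_preserving_finTwoArrow ℝ).symm.trans (PiLp.volume_preserving_toLp (Fin 2))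

/-- `polarCoord` has its angles in `(-π, π)`. Rotating the plane by `π`, which is `y ↦ -y`, moves
them to `(0, 2π)`. -/
lemma pol_add_pi (r φ : ℝ) : pol r (φ + Real.pi) = -planeEquiv (polarCoord.symm (r, φ)) := by
  rw [polarCoord_symm_apply, planeEquiv_apply, pol]
  ext i
  fin_cases i <;> simp

lemma preimage_shift_polar : (fun p : ℝ × ℝ => p + (0, Real.pi)) ⁻¹'
    (Set.Ioi 0 ×ˢ Set.Ioo 0 (2 * Real.pi)) = polarCoord.target := by
  ext ⟨r, φ⟩
  simp only [Set.mem_preimage, Set.mem_prod, polarCoord_target, Prod.mk_add_mk, add_zero,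
    Set.mem_Ioo, Set.mem_Ioi]
  constructor <;> rintro ⟨h1, h2, h3⟩ <;> exact ⟨h1, by linarith, by linarith⟩

lemma lintegral_plane_polar (F : Plane → ENNReal) :
    ∫⁻ y, F y = ∫⁻ p in Set.Ioi (0 : ℝ) ×ˢ Set.Ioo 0 (2 * Real.pi),
      ENNReal.ofReal p.1 * F (pol p.1 p.2) := by
  rw [← lintegral_neg_eq_self, ← measurePreserving_planeEquiv.lintegral_comp_emb
    planeEquiv.measurableEmbedding, ← lintegral_comp_polarCoord_symm]
  have h := (measurePreserving_add_right (volume : Measure (ℝ × ℝ)) (0, Real.pi)).setLIntegral_comp_preimage_emb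
    (measurableEmbedding_addRight _) (fun p : ℝ × ℝ => ENNReal.ofReal p.1 * F (pol p.1 p.2))
    (Set.Ioi 0 ×ˢ Set.Ioo 0 (2 * Real.pi))
  rw [preimage_shift_polar] at h
  rw [← h]
  refine setLIntegral_congr_fun (polarCoord.open_target.measurableSet) fun p _ => ?_
  simp only [Prod.fst_add, Prod.snd_add, add_zero, smul_eq_mul]
  rw [pol_add_pi]

lemma integral_plane_polar (F : Plane → ℂ) :
    ∫ y, F y = ∫ p in Set.Ioi (0 : ℝ) ×ˢ Set.Ioo 0 (2 * Real.pi), (p.1 : ℂ) * F (pol p.1 p.2) := by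
  rw [← integral_neg_eq_self, ← measurePreserving_planeEquiv.integral_comp
    planeEquiv.measurableEmbedding, ← integral_comp_polarCoord_symm]
  have h := (measurePreserving_add_right (volume : Measure (ℝ × ℝ)) (0, Real.pi)).setIntegral_preimage_emb
    (measurableEmbedding_addRight _) (fun p : ℝ × ℝ => (p.1 : ℂ) * F (pol p.1 p.2))
    (Set.Ioi 0 ×ˢ Set.Ioo 0 (2 * Real.pi))
  rw [preimage_shift_polar] at h
  rw [← h]
  refine setIntegral_congr_fun (polarCoord.open_target.measurableSet) fun p _ => ?_
  simp only [Prod.fst_add, Prod.snd_add, add_zero]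
  rw [pol_add_pi, Complex.real_smul]

/-- The radial unit vector. -/
noncomputable abbrev radial (φ : ℝ) : Plane := pol 1 φ

lemma hasDerivAt_pol (r φ : ℝ) : HasDerivAt (fun r => pol r φ) (radial φ) r := by
  have : (fun r => pol r φ) = fun r => r • radial φ := by
    ext r i; fin_cases i <;> simp [pol, radial]
  rw [this]
  simpa using (hasDerivAt_id r).smul_const (radial φ)

/-- No integrability of `g'` is assumed: if its integral is infinite nothing is claimed, otherwise
the fundamental theorem of calculus applies. The endpoint `a` may lie on the surface, where no
derivative is available. -/
lemma enorm_le_add_lintegral_deriv {g g' : ℝ → ℂ} {a b : ℝ} (hab : a ≤ b)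
    (hc : ContinuousOn g (Set.Icc a b)) (hd : ∀ r ∈ Set.Ioo a b, HasDerivAt g (g' r) r)
    (hg' : ContinuousOn g' (Set.Ioo a b)) :
    ‖g a‖ₑ ≤ ‖g b‖ₑ + ∫⁻ r in Set.Ioo a b, ‖g' r‖ₑ := by
  by_cases hfin : ∫⁻ r in Set.Ioo a b, ‖g' r‖ₑ = ⊤
  · rw [hfin]; simp
  have hi : IntegrableOn g' (Set.Ioo a b) :=
    ⟨hg'.aestronglyMeasurable measurableSet_Ioo, lt_top_iff_ne_top.2 hfin⟩
  have hi' : IntervalIntegrable g' volume a b := by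
    rw [intervalIntegrable_iff_integrableOn_Ioo_of_le hab]; exact hi
  have h1 := intervalIntegral.integral_eq_sub_of_hasDerivAt_of_le hab hc hd hi'
  have h2 : g a = g b - ∫ r in Set.Ioo a b, g' r := by
    rw [← integral_Ioc_eq_integral_Ioo, ← intervalIntegral.integral_of_le hab, h1]; ring
  rw [h2]
  exact enorm_sub_le.trans (add_le_add_right (enorm_integral_le_lintegral_enorm _) _)

section

variable {k : ℂ} {θ : ℝ} {f : ℝ → ℝ} {X₁ : ℝ} {X₂ : EReal} {u : ℝ → Plane → ℂ}

lemma isOpen_axis (X₁ : ℝ) (X₂ : EReal) : IsOpen {x : ℝ | X₁ < x ∧ (x : EReal) < X₂} :=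
  isOpen_Ioi.inter (isOpen_Iio.preimage continuous_coe_real_ereal)

lemma isOpen_axisUpTo (X₁ : ℝ) (X₂ : EReal) (c : ℝ) : IsOpen (axisUpTo X₁ X₂ c) := by
  have : axisUpTo X₁ X₂ c = {x : ℝ | X₁ < x ∧ (x : EReal) < X₂} ∩ Set.Iio c := by
    ext x; simp [axisUpTo, and_assoc]
  rw [this]
  exact (isOpen_axis X₁ X₂).inter isOpen_Iio

lemma mem_offTips_pol {x r : ℝ} (φ : ℝ) (h1 : X₁ < x) (h2 : (x : EReal) < X₂) (h0 : 0 ≤ f x)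
    (hr : f x < r) : (x, pol r φ) ∈ offTips f X₁ X₂ := by
  refine ⟨fun _ _ => ?_, h1.ne', h2.ne⟩
  simp only
  rw [norm_pol, abs_of_pos (h0.trans_lt hr)]
  exact hr

lemma mem_surface_pol {x : ℝ} (φ : ℝ) (h1 : X₁ < x) (h2 : (x : EReal) < X₂) (h0 : 0 ≤ f x) :
    (x, pol (f x) φ) ∈ surface f X₁ X₂ := by
  refine ⟨h1, h2, ?_⟩
  simp only
  rw [norm_pol, abs_of_nonneg h0]

lemma IsTotalField.hasDerivAt_radial (hu : IsTotalField k θ f X₁ X₂ u) {x r φ : ℝ}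
    (h : (x, pol r φ) ∈ offTips f X₁ X₂) :
    HasDerivAt (fun r => u x (pol r φ)) (fderiv ℝ (u x) (pol r φ) (radial φ)) r :=
  ((hu.contDiffAt _ h).differentiableAt (by norm_num)).hasFDerivAt.comp_hasDerivAt r
    (hasDerivAt_pol r φ)

lemma IsTotalField.continuousOn_surfaceField (hf : IsProfile f X₁ X₂)
    (hu : IsTotalField k θ f X₁ X₂ u) :
    ContinuousOn (fun q : ℝ × ℝ => surfaceField f u q.1 q.2)
      ({x : ℝ | X₁ < x ∧ (x : EReal) < X₂} ×ˢ Set.univ) := by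
  have hfc : ContinuousOn f {x : ℝ | X₁ < x ∧ (x : EReal) < X₂} :=
    hf.continuousOn.mono fun x hx => ⟨hx.1.le, hx.2.le⟩
  have hfc' : ContinuousOn (fun q : ℝ × ℝ => f q.1)
      ({x : ℝ | X₁ < x ∧ (x : EReal) < X₂} ×ˢ Set.univ) :=
    ContinuousOn.comp (g := f) (f := Prod.fst) hfc continuousOn_fst fun _ hq => hq.1
  refine hu.continuousOn.comp (f := fun q : ℝ × ℝ => (q.1, pol (f q.1) q.2)) ?_ ?_
  · exact continuousOn_fst.prodMk (continuous_pol.comp_continuousOn (hfc'.prodMk continuousOn_snd))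
  · exact fun q hq => Or.inr (mem_surface_pol q.2 hq.1.1 hq.1.2 (hf.pos _ hq.1.1 hq.1.2).le)

/-- A trace inequality: the surface value is compared along a radius with the value at `ρ`, and
averaged over `R < ρ < R + 1`. Since `f x ≤ r` on this radius, the weight `f x` is dominated by the
Jacobian `r`, so the bound does not degenerate at the tips. -/
lemma IsTotalField.trace_le (hf : IsProfile f X₁ X₂) (hu : IsTotalField k θ f X₁ X₂ u) {x R : ℝ}
    (φ : ℝ) (h1 : X₁ < x) (h2 : (x : EReal) < X₂) (hR : f x ≤ R) :
    ENNReal.ofReal (f x) * ‖surfaceField f u x φ‖ₑ ≤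
      ∫⁻ r in Set.Ioo (f x) (R + 1), ENNReal.ofReal r *
        ENNReal.ofReal (2 + (‖fderiv ℝ (u x) (pol r φ)‖ ^ 2 + ‖u x (pol r φ)‖ ^ 2)) := by
  have h0 := hf.pos x h1 h2
  set g : ℝ → ℂ := fun r => u x (pol r φ) with hg
  set g' : ℝ → ℂ := fun r => fderiv ℝ (u x) (pol r φ) (radial φ) with hg'
  have hcol : ∀ r, f x < r → (x, pol r φ) ∈ offTips f X₁ X₂ := fun r hr =>
    mem_offTips_pol φ h1 h2 h0.le hr
  have hpc : Continuous fun r => pol r φ := continuous_pol.comp (by fun_prop : Continuous fun r : ℝ => (r, φ))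
  have hgc : ContinuousOn g (Set.Ici (f x)) := by
    refine hu.continuousOn.comp (f := fun r : ℝ => (x, pol r φ)) (by fun_prop) fun r hr => ?_
    rcases (Set.mem_Ici.1 hr).lt_or_eq with h | h
    · exact Or.inl (hcol r h).1
    · rw [← h]; exact Or.inr (mem_surface_pol φ h1 h2 h0.le)
  have hg'c : ContinuousOn g' (Set.Ioi (f x)) := by
    have : ContinuousOn (fun r => fderiv ℝ (u x) (pol r φ)) (Set.Ioi (f x)) :=
      hu.continuousOn_grad.comp (f := fun r : ℝ => (x, pol r φ)) (by fun_prop) fun r hr => hcol r hr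
    exact this.clm_apply continuousOn_const
  have hg'n : ∀ r, ‖g' r‖ ≤ ‖fderiv ℝ (u x) (pol r φ)‖ := fun r => by
    have := (fderiv ℝ (u x) (pol r φ)).le_opNorm (radial φ)
    rwa [radial, norm_pol, abs_one, mul_one] at this
  have key : ∀ ρ ∈ Set.Ioo R (R + 1), ENNReal.ofReal (f x) * ‖surfaceField f u x φ‖ₑ ≤
      ENNReal.ofReal ρ * ‖g ρ‖ₑ + ∫⁻ r in Set.Ioo (f x) (R + 1), ENNReal.ofReal r * ‖g' r‖ₑ := by
    intro ρ hρ
    have hfρ : f x ≤ ρ := hR.trans hρ.1.le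
    have h3 := enorm_le_add_lintegral_deriv hfρ (hgc.mono Set.Icc_subset_Ici_self)
      (fun r hr => hu.hasDerivAt_radial (hcol r hr.1)) (hg'c.mono Set.Ioo_subset_Ioi_self)
    refine (mul_le_mul_right h3 _).trans ?_
    rw [mul_add, ← lintegral_const_mul' _ _ ENNReal.ofReal_ne_top]
    refine add_le_add (mul_le_mul_left (ENNReal.ofReal_le_ofReal hfρ) _) ?_
    refine (setLIntegral_mono' measurableSet_Ioo fun r hr =>
      mul_le_mul_left (ENNReal.ofReal_le_ofReal hr.1.le) _).trans ?_
    exact lintegral_mono_set (Set.Ioo_subset_Ioo_right hρ.2.le)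
  have h4 : ENNReal.ofReal (f x) * ‖surfaceField f u x φ‖ₑ ≤
      (∫⁻ ρ in Set.Ioo R (R + 1), ENNReal.ofReal ρ * ‖g ρ‖ₑ) +
        ∫⁻ r in Set.Ioo (f x) (R + 1), ENNReal.ofReal r * ‖g' r‖ₑ := by
    have h5 := setLIntegral_mono' (μ := volume) measurableSet_Ioo key
    rw [lintegral_add_right _ measurable_const] at h5
    simpa [setLIntegral_const] using h5
  refine h4.trans ((add_le_add_left (lintegral_mono_set (Set.Ioo_subset_Ioo_left hR)) _).trans ?_)
  refine (le_lintegral_add _ _).trans (lintegral_mono fun r => ?_)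
  rw [← mul_add]
  refine mul_le_mul_right ?_ _
  rw [← ofReal_norm, ← ofReal_norm, ← ENNReal.ofReal_add (norm_nonneg _) (norm_nonneg _)]
  refine ENNReal.ofReal_le_ofReal ?_
  have := hg'n r
  nlinarith [sq_nonneg (‖g r‖ - 1), sq_nonneg (‖fderiv ℝ (u x) (pol r φ)‖ - 1)]

lemma exists_profile_bound (hf : IsProfile f X₁ X₂) (c : ℝ) :
    ∃ R : ℝ, 0 ≤ R ∧ ∀ x ∈ axisUpTo X₁ X₂ c, f x ≤ R := by
  have hcl : IsClosed {x : ℝ | X₁ ≤ x ∧ (x : EReal) ≤ X₂} :=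
    (isClosed_Ici).inter (isClosed_Iic.preimage continuous_coe_real_ereal)
  have hK : IsCompact (Set.Icc X₁ c ∩ {x : ℝ | X₁ ≤ x ∧ (x : EReal) ≤ X₂}) :=
    isCompact_Icc.inter_right hcl
  obtain ⟨R, hR⟩ := hK.exists_bound_of_continuousOn (hf.continuousOn.mono Set.inter_subset_right)
  refine ⟨max R 0, le_max_right _ _, fun x hx => ?_⟩
  exact (le_abs_self _).trans ((hR x ⟨⟨hx.1.le, hx.2.2.le⟩, hx.1.le, hx.2.1.le⟩).trans
    (le_max_left _ _))

/-- The field is integrable over the surface, up to the tips. -/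
theorem IsTotalField.integrableOn_surface (hf : IsProfile f X₁ X₂) (hu : IsTotalField k θ f X₁ X₂ u)
    (c : ℝ) : IntegrableOn (fun q : ℝ × ℝ => surfaceField f u q.1 q.2 * (f q.1 : ℂ))
      (axisUpTo X₁ X₂ c ×ˢ Set.Ioc 0 (2 * Real.pi)) := by
  obtain ⟨R, hR0, hR⟩ := exists_profile_bound hf c
  have hT := (isOpen_axisUpTo X₁ X₂ c).measurableSet
  have hTsub : axisUpTo X₁ X₂ c ⊆ {x : ℝ | X₁ < x ∧ (x : EReal) < X₂} := fun x hx => ⟨hx.1, hx.2.1⟩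
  have hTm := hT.prod (measurableSet_Ioc (a := (0 : ℝ)) (b := 2 * Real.pi))
  have hcont : ContinuousOn (fun q : ℝ × ℝ => surfaceField f u q.1 q.2 * (f q.1 : ℂ))
      (axisUpTo X₁ X₂ c ×ˢ Set.Ioc 0 (2 * Real.pi)) := by
    refine ((hu.continuousOn_surfaceField hf).mono
      (Set.prod_mono hTsub (Set.subset_univ _))).mul ?_
    refine Complex.continuous_ofReal.comp_continuousOn ?_
    exact ContinuousOn.comp (g := f) (f := Prod.fst)
      (hf.continuousOn.mono fun x hx => ⟨hx.1.le, hx.2.le⟩) continuousOn_fst fun q hq => hTsub hq.1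
  refine ⟨hcont.aestronglyMeasurable hTm, ?_⟩
  set Q : ℝ × Plane → ENNReal := fun p =>
    ENNReal.ofReal (2 + (‖fderiv ℝ (u p.1) p.2‖ ^ 2 + ‖u p.1 p.2‖ ^ 2)) with hQ
  set S : Set (ℝ × Plane) := offTips f X₁ X₂ ∩ (axisUpTo X₁ X₂ c ×ˢ Metric.ball 0 (R + 1)) with hS
  have hSo : IsOpen S := (isOpen_offTips hf).inter ((isOpen_axisUpTo X₁ X₂ c).prod Metric.isOpen_ball)
  have hQc : ContinuousOn Q S := by
    refine ENNReal.continuous_ofReal.comp_continuousOn (continuousOn_const.add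
      ((ContinuousOn.pow ?_ 2).add (ContinuousOn.pow ?_ 2)))
    · exact (hu.continuousOn_grad.mono Set.inter_subset_left).norm
    · exact (hu.continuousOn_offTips.mono Set.inter_subset_left).norm
  have hQm : Measurable (S.indicator Q) := by
    classical
    have := hQc.measurable_piecewise (g := 0) continuousOn_const hSo.measurableSet
    rwa [Set.piecewise_eq_indicator] at this
  have hpt : ∀ x ∈ axisUpTo X₁ X₂ c, ∀ φ,
      ‖surfaceField f u x φ * (f x : ℂ)‖ₑ ≤
        ∫⁻ r in Set.Ioi (0 : ℝ), ENNReal.ofReal r * S.indicator Q (x, pol r φ) := by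
    intro x hx φ
    have h0 := hf.pos x hx.1 hx.2.1
    have hn : ‖surfaceField f u x φ * (f x : ℂ)‖ₑ =
        ENNReal.ofReal (f x) * ‖surfaceField f u x φ‖ₑ := by
      rw [enorm_mul, mul_comm, ← ofReal_norm (f x : ℂ), Complex.norm_real,
        Real.norm_of_nonneg h0.le]
    rw [hn]
    refine (hu.trace_le hf φ hx.1 hx.2.1 (hR x hx)).trans ?_
    refine le_trans (setLIntegral_mono' measurableSet_Ioo fun r hr => ?_)
      (lintegral_mono_set (fun r hr => h0.trans hr.1))
    have hmem : (x, pol r φ) ∈ S := by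
      refine ⟨mem_offTips_pol φ hx.1 hx.2.1 h0.le hr.1, hx, ?_⟩
      rw [mem_ball_zero_iff, norm_pol, abs_of_pos (h0.trans hr.1)]
      exact hr.2
    rw [Set.indicator_of_mem hmem]
  have hpolc : Continuous fun p : ℝ × ℝ => pol p.1 p.2 := continuous_pol
  -- Over the angles the trace inequality sums to an integral over the slice in polar coordinates;
  -- over `x` it becomes a volume integral that Meixner's condition bounds.
  have hslice : ∀ x ∈ axisUpTo X₁ X₂ c, ∫⁻ φ in Set.Ioc 0 (2 * Real.pi),
      ‖surfaceField f u x φ * (f x : ℂ)‖ₑ ≤ ∫⁻ y, S.indicator Q (x, y) := by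
    intro x hx
    rw [lintegral_plane_polar, setLIntegral_congr Ioo_ae_eq_Ioc.symm]
    refine (lintegral_mono fun φ => hpt x hx φ).trans ?_
    have hm : Measurable fun p : ℝ × ℝ => ENNReal.ofReal p.1 * S.indicator Q (x, pol p.1 p.2) :=
      (measurable_fst.ennreal_ofReal).mul
        (hQm.comp (measurable_const.prodMk hpolc.measurable))
    rw [Measure.volume_eq_prod, ← Measure.prod_restrict,
      lintegral_prod_symm _ hm.aemeasurable]
  have hfin : ∫⁻ p, S.indicator Q p < ⊤ := by
    rw [lintegral_indicator hSo.measurableSet]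
    set R' := max (R + 1) (max |X₁| |c|)
    have hsub : S ⊆ exterior f X₁ X₂ ∩ Metric.closedBall 0 R' := by
      rintro ⟨x, y⟩ ⟨h1, h2, h3⟩
      refine ⟨h1.1, ?_⟩
      rw [mem_ball_zero_iff] at h3
      rw [mem_closedBall_zero_iff, Prod.norm_def]
      exact max_le ((abs_le_max_abs_abs h2.1.le h2.2.2.le).trans (le_max_right _ _))
        (h3.le.trans (le_max_left _ _))
    have hfinm : volume (exterior f X₁ X₂ ∩ Metric.closedBall (0 : ℝ × Plane) R') ≠ ⊤ :=
      ((measure_mono Set.inter_subset_right).trans_lt measure_closedBall_lt_top).ne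
    have hint := (((integrableOn_const (C := (2 : ℝ)) hfinm)).add (hu.meixner R')).mono_set hsub
    refine lt_of_le_of_lt (lintegral_mono fun p => ?_) hint.hasFiniteIntegral
    rw [← ofReal_norm]
    exact ENNReal.ofReal_le_ofReal (le_abs_self _)
  have hae : AEMeasurable (fun q : ℝ × ℝ => ‖surfaceField f u q.1 q.2 * (f q.1 : ℂ)‖ₑ)
      ((volume.restrict (axisUpTo X₁ X₂ c)).prod (volume.restrict (Set.Ioc 0 (2 * Real.pi)))) := by
    rw [Measure.prod_restrict, ← Measure.volume_eq_prod]
    exact (hcont.aestronglyMeasurable hTm).enorm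
  rw [HasFiniteIntegral, Measure.volume_eq_prod, ← Measure.prod_restrict, lintegral_prod _ hae]
  refine lt_of_le_of_lt (setLIntegral_mono' hT hslice) (lt_of_le_of_lt ?_ hfin)
  rw [Measure.volume_eq_prod, lintegral_prod _ hQm.aemeasurable]
  exact setLIntegral_le_lintegral _ _

end

/-! ### The flux through the inner cutoff and its limit at the surface -/

section

variable {k : ℂ} {θ : ℝ} {f : ℝ → ℝ} {X₁ : ℝ} {X₂ : EReal} {u : ℝ → Plane → ℂ}

/-- The density of the flux of Green's identity through the level sets of an inner cutoff. -/
noncomputable def flux (k : ℂ) (F' : ℝ → ℝ) (u : ℝ → Plane → ℂ) (xs : ℝ) (ys : Plane) (x : ℝ)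
    (y : Plane) : ℂ :=
  -(F' x : ℂ) * (u x y * kernel k xs ys x y) + Complex.I / k *
    (u x y * kernel k xs ys x y * (Complex.I * k / ((xs - x : ℝ) : ℂ)) * (dotSub ys y : ℂ) -
      kernel k xs ys x y * fderiv ℝ (u x) y y)

lemma fderiv_apply_self (w : Plane → ℂ) (y : Plane) :
    fderiv ℝ w y y = (y 0 : ℂ) * fderiv ℝ w y (basisVec 0) +
      (y 1 : ℂ) * fderiv ℝ w y (basisVec 1) := by
  have h : y = y 0 • basisVec 0 + y 1 • basisVec 1 := by
    ext i; fin_cases i <;> simp [basisVec]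
  conv_lhs => rw [h]
  rw [map_add, map_smul, map_smul, Complex.real_smul, Complex.real_smul, ← h]

lemma continuous_innerS (F : ℝ → ℝ) (δ x : ℝ) :
    Continuous fun y : Plane => (innerS F δ x (‖y‖ ^ 2) : ℂ) := by
  have := continuous_deriv_step
  unfold innerS
  fun_prop

lemma innerS_eq_zero_of_le {F : ℝ → ℝ} {δ x s : ℝ} (hδ : 0 < δ) (h : s ≤ F x + δ) :
    innerS F δ x s = 0 := by
  rw [innerS, deriv_step_of_le (by rw [div_le_one hδ]; linarith), zero_div]

lemma hasCompactSupport_innerS {F : ℝ → ℝ} {δ x : ℝ} (hδ : 0 < δ) :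
    HasCompactSupport fun y : Plane => (innerS F δ x (‖y‖ ^ 2) : ℂ) := by
  refine HasCompactSupport.of_support_subset_isCompact
    (isCompact_closedBall 0 (|F x| + 2 * δ + 1)) fun y hy => ?_
  rw [mem_closedBall_zero_iff]
  by_contra h
  rw [not_le] at h
  refine hy ?_
  have h0 := abs_nonneg (F x)
  have := (inner_of_ge (F := F) (F' := F) (x := x) hδ (s := ‖y‖ ^ 2)
    (by nlinarith [le_abs_self (F x)])).2.2.1
  simp [this]

lemma tsupport_innerS_subset {F : ℝ → ℝ} {δ x : ℝ} (hδ : 0 < δ)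
    (h1 : x ≠ X₁) (h2 : (x : EReal) ≠ X₂)
    (hfF : ∀ y : Plane, (x, y) ∉ exterior f X₁ X₂ → ‖y‖ ^ 2 ≤ F x) :
    tsupport (fun y : Plane => (innerS F δ x (‖y‖ ^ 2) : ℂ)) ⊆
      {y : Plane | (x, y) ∈ offTips f X₁ X₂} := by
  refine tsupport_subset_of_eventually fun y hy => ?_
  have hy' : (x, y) ∉ exterior f X₁ X₂ := fun h => hy (slice_offTips h1 h2 h)
  have h3 : ‖y‖ ^ 2 < F x + δ := by linarith [hfF y hy']
  have h4 : ContinuousAt (fun z : Plane => ‖z‖ ^ 2) y := by fun_prop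
  filter_upwards [h4.eventually (Iio_mem_nhds h3)] with z hz
  rw [innerS_eq_zero_of_le hδ (le_of_lt hz), Complex.ofReal_zero]

lemma IsTotalField.continuousOn_flux (hu : IsTotalField k θ f X₁ X₂ u)
    (F' : ℝ → ℝ) {xs x : ℝ} (hx : x < xs) (ys : Plane) :
    ContinuousOn (flux k F' u xs ys x) {y : Plane | (x, y) ∈ offTips f X₁ X₂} := by
  have cu := continuousOn_slice hu.continuousOn_offTips x
  have cu1 : ContinuousOn (fun y => fderiv ℝ (u x) y y) {y : Plane | (x, y) ∈ offTips f X₁ X₂} :=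
    continuousOn_slice (G := fun p => fderiv ℝ (u p.1) p.2 p.2)
      (hu.continuousOn_grad.clm_apply continuousOn_snd) x
  have ck := (continuous_kernel k hx ys).continuousOn (s := {y : Plane | (x, y) ∈ offTips f X₁ X₂})
  have cd : ContinuousOn (fun y => (dotSub ys y : ℂ)) {y : Plane | (x, y) ∈ offTips f X₁ X₂} :=
    (Complex.continuous_ofReal.comp (continuous_dotSub ys)).continuousOn
  exact (continuousOn_const.mul (cu.mul ck)).add (continuousOn_const.mul
    ((((cu.mul ck).mul continuousOn_const).mul cd).sub (ck.mul cu1)))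

/-- The source term of Green's identity is a flux. -/
lemma IsTotalField.integral_source_eq_flux (hf : IsProfile f X₁ X₂)
    (hu : IsTotalField k θ f X₁ X₂ u) {F F' : ℝ → ℝ} {δ xs x : ℝ} (hδ : 0 < δ) (hx : x < xs)
    (h1 : x ≠ X₁) (h2 : (x : EReal) ≠ X₂) (ys : Plane)
    (hfF : ∀ y : Plane, (x, y) ∉ exterior f X₁ X₂ → ‖y‖ ^ 2 ≤ F x) :
    ∫ y, u x y * cutoffSource k xs ys (innerX F F' δ) (innerS F δ) (innerSS F δ) x y =
      ∫ y, (innerS F δ x (‖y‖ ^ 2) : ℂ) * flux k F' u xs ys x y := by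
  set Ω : Set Plane := {y : Plane | (x, y) ∈ offTips f X₁ X₂} with hΩ
  have hΩo : IsOpen Ω := isOpen_slice hf x
  set β : ℂ := Complex.I * k / ((xs - x : ℝ) : ℂ) with hβ
  set w : Plane → ℂ := fun y => u x y * kernel k xs ys x y with hw
  set w1 : Fin 2 → Plane → ℂ := fun i y => fderiv ℝ (u x) y (basisVec i) * kernel k xs ys x y +
    u x y * (kernel k xs ys x y * (β * ((y i - ys i : ℝ) : ℂ))) with hw1
  set ψ : Fin 2 → Plane → ℂ := fun i y =>
    ((y i - 0 : ℝ) : ℂ) * (innerS F δ x (‖y‖ ^ 2) : ℂ) with hψ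
  set ψ1 : Fin 2 → Plane → ℂ := fun i y => 1 * (innerS F δ x (‖y‖ ^ 2) : ℂ) +
    ((y i - 0 : ℝ) : ℂ) * (2 * (y i : ℂ) * (innerSS F δ x (‖y‖ ^ 2) : ℂ)) with hψ1
  have cu := continuousOn_slice hu.continuousOn_offTips x
  have cu1 : ∀ e, ContinuousOn (fun y => fderiv ℝ (u x) y e) Ω := fun e =>
    continuousOn_slice (G := fun p => fderiv ℝ (u p.1) p.2 e)
      (hu.continuousOn_grad.clm_apply continuousOn_const) x
  have ck := (continuous_kernel k hx ys).continuousOn (s := Ω)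
  have cw : ContinuousOn w Ω := cu.mul ck
  have cw1 : ∀ i, ContinuousOn (w1 i) Ω := fun i =>
    ((cu1 _).mul ck).add (cu.mul (ck.mul (continuousOn_const.mul (by fun_prop))))
  have hdw : ∀ i, ∀ y ∈ Ω, HasLineDerivAt ℝ w (w1 i y) y (basisVec i) := fun i y hy =>
    HasLineDerivAt.mulC (((hu.contDiffAt _ hy).differentiableAt
      (by norm_num)).hasFDerivAt.hasLineDerivAt _) (hasLineDerivAt_kernel k hx ys y i)
  have cS := continuous_innerS F δ x
  have cSS : Continuous fun y : Plane => (innerSS F δ x (‖y‖ ^ 2) : ℂ) := by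
    have := continuous_deriv_deriv_step
    unfold innerSS
    fun_prop
  have cψ : ∀ i, Continuous (ψ i) := fun i =>
    (by fun_prop : Continuous fun y : Plane => ((y i - 0 : ℝ) : ℂ)).mul cS
  have cψ1 : ∀ i, Continuous (ψ1 i) := fun i =>
    (continuous_const.mul cS).add ((by fun_prop : Continuous fun y : Plane =>
      ((y i - 0 : ℝ) : ℂ)).mul ((by fun_prop : Continuous fun y : Plane => 2 * (y i : ℂ)).mul cSS))
  have hdψ : ∀ i y, HasLineDerivAt ℝ (ψ i) (ψ1 i y) y (basisVec i) := fun i y =>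
    HasLineDerivAt.mulC (hasLineDerivAt_coordC y 0 i)
      (hasLineDerivAt_radial (hasDerivAt_innerS F δ x _) i)
  have hsub := tsupport_innerS_subset hδ h1 h2 hfF
  have hcS : HasCompactSupport fun y : Plane => (innerS F δ x (‖y‖ ^ 2) : ℂ) :=
    hasCompactSupport_innerS hδ
  have hcψ : ∀ i, HasCompactSupport (ψ i) := fun i => hcS.mul_left
  have hsψ : ∀ i, tsupport (ψ i) ⊆ Ω := fun i => tsupport_mul_subset_right.trans hsub
  have hIP := fun i => integral_mul_lineDeriv hΩo (hdw i) cw (cw1 i) (hdψ i) (cψ i) (cψ1 i)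
    (hcψ i) (hsψ i)
  have i1 : ∀ i, Integrable fun y => ψ i y * w1 i y := fun i =>
    integrable_mul_of_tsupport hΩo (cψ i) (cw1 i) (hcψ i) (hsψ i)
  have i2 : ∀ i, Integrable fun y => ψ1 i y * w y := fun i => by
    have hs1 := tsupport_lineDeriv_subset (hdψ i)
    exact integrable_mul_of_tsupport hΩo (cψ1 i) cw
      ((hcψ i).mono' (subset_tsupport _ |>.trans hs1)) (hs1.trans (hsψ i))
  have i3 := integrable_mul_of_tsupport hΩo cS (hu.continuousOn_flux F' hx ys) hcS hsub
  have i4 : ∀ i, Integrable fun y => ψ i y * w1 i y + ψ1 i y * w y := fun i => (i1 i).add (i2 i)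
  have i5 : Integrable fun y => (ψ 0 y * w1 0 y + ψ1 0 y * w y) + (ψ 1 y * w1 1 y + ψ1 1 y * w y) :=
    (i4 0).add (i4 1)
  -- The divergence of `y * innerS * u * g`, a vector field with compact support in the exterior
  -- slice, integrates to zero.
  have hz : ∀ i, ∫ y, (ψ i y * w1 i y + ψ1 i y * w y) = 0 := fun i => by
    rw [integral_add (i1 i) (i2 i), hIP i, neg_add_cancel]
  -- Removing this divergence trades the second derivative of the cutoff for the gradient of `u`.
  -- What is left carries `innerS` alone, an approximate delta function on the surface.
  have hpt : ∀ y, u x y * cutoffSource k xs ys (innerX F F' δ) (innerS F δ) (innerSS F δ) x y =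
      (innerS F δ x (‖y‖ ^ 2) : ℂ) * flux k F' u xs ys x y + (Complex.I / k) *
        ((ψ 0 y * w1 0 y + ψ1 0 y * w y) + (ψ 1 y * w1 1 y + ψ1 1 y * w y)) := by
    intro y
    have hX : innerX F F' δ x (‖y‖ ^ 2) = -F' x * innerS F δ x (‖y‖ ^ 2) := by
      rw [innerX, innerS]; ring
    simp only [cutoffSource, flux, hX, fderiv_apply_self, hψ, hψ1, hw, hw1, dotSub, ← hβ]
    have hn : ((‖y‖ ^ 2 : ℝ) : ℂ) = (y 0 : ℂ) ^ 2 + (y 1 : ℂ) ^ 2 := by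
      rw [norm_sq_plane]; push_cast; ring
    rw [hn]
    have hD : Complex.I / k = 2 * (Complex.I / (2 * k)) := by
      by_cases hk0 : k = 0
      · simp [hk0]
      · field_simp
    rw [hD]
    push_cast
    ring
  simp_rw [hpt]
  rw [integral_add i3 (i5.const_mul _), integral_const_mul, integral_add (i4 0) (i4 1), hz, hz]
  simp

end

lemma norm_sq_pol (r φ : ℝ) : ‖pol r φ‖ ^ 2 = r ^ 2 := by rw [norm_pol, sq_abs]

/-- The integrand is the derivative of `r ↦ inner₀ F δ x (r ^ 2)`, which climbs from 0 to 1. -/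
lemma integral_innerS_eq_one {F : ℝ → ℝ} {δ x : ℝ} (hδ : 0 < δ) (hF : 0 ≤ F x) :
    IntegrableOn (fun r : ℝ => 2 * r * innerS F δ x (r ^ 2)) (Set.Ioi 0) ∧
      ∫ r in Set.Ioi (0 : ℝ), 2 * r * innerS F δ x (r ^ 2) = 1 := by
  have hd : ∀ r : ℝ, HasDerivAt (fun r => inner₀ F δ x (r ^ 2)) (2 * r * innerS F δ x (r ^ 2)) r := by
    intro r
    have := (hasDerivAt_inner₀ F δ x (r ^ 2)).comp r (hasDerivAt_pow 2 r)
    refine this.congr_deriv ?_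
    push_cast; ring
  have ht : Tendsto (fun r : ℝ => inner₀ F δ x (r ^ 2)) atTop (𝓝 1) := by
    refine tendsto_const_nhds.congr' ?_
    filter_upwards [(tendsto_pow_atTop (α := ℝ) two_ne_zero).eventually_ge_atTop (F x + 2 * δ)]
      with r hr
    exact (inner_of_ge (F' := F) hδ hr).1.symm
  have h0 : ∀ r ∈ Set.Ioi (0 : ℝ), 0 ≤ 2 * r * innerS F δ x (r ^ 2) := fun r hr =>
    mul_nonneg (mul_nonneg zero_le_two (le_of_lt hr)) (div_nonneg (deriv_step_nonneg _) hδ.le)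
  have hc : ContinuousWithinAt (fun r => inner₀ F δ x (r ^ 2)) (Set.Ici 0) 0 :=
    (hd 0).continuousAt.continuousWithinAt
  refine ⟨integrableOn_Ioi_deriv_of_nonneg hc (fun r _ => hd r) h0 ht, ?_⟩
  rw [integral_Ioi_of_hasDerivAt_of_nonneg hc (fun r _ => hd r) h0 ht]
  have : inner₀ F δ x (0 ^ 2) = 0 := step_eq_zero
    ((div_nonpos_of_nonpos_of_nonneg (by linarith) hδ.le).trans zero_le_one)
  rw [this, sub_zero]

/-- A layer potential concentrates on the level set of the cutoff. -/
lemma norm_integral_innerS_sub_le {F : ℝ → ℝ} {δ x η : ℝ} {Ψ : Plane → ℂ} {G : ℝ → ℂ}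
    (hδ : 0 < δ) (hF : 0 ≤ F x) (hcont : Continuous fun y => (innerS F δ x (‖y‖ ^ 2) : ℂ) * Ψ y)
    (hG : IntegrableOn G (Set.Ioo 0 (2 * Real.pi)))
    (hη : ∀ φ ∈ Set.Ioo 0 (2 * Real.pi), ∀ r : ℝ, 0 < r → F x + δ < r ^ 2 → r ^ 2 < F x + 2 * δ →
      ‖Ψ (pol r φ) / 2 - G φ‖ ≤ η) :
    ‖(∫ y, (innerS F δ x (‖y‖ ^ 2) : ℂ) * Ψ y) - ∫ φ in Set.Ioo 0 (2 * Real.pi), G φ‖ ≤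
      2 * Real.pi * η := by
  obtain ⟨hκi, hκ1⟩ := integral_innerS_eq_one (x := x) hδ hF
  set κ : ℝ → ℝ := fun r => 2 * r * innerS F δ x (r ^ 2) with hκ
  set S : Set (ℝ × ℝ) := Set.Ioi 0 ×ˢ Set.Ioo 0 (2 * Real.pi) with hS
  have hSm : MeasurableSet S := measurableSet_Ioi.prod measurableSet_Ioo
  have hout : ∀ r : ℝ, F x + 2 * δ ≤ r ^ 2 → innerS F δ x (r ^ 2) = 0 := fun r hr =>
    (inner_of_ge (F' := F) hδ hr).2.2.1
  have i1 : IntegrableOn (fun p : ℝ × ℝ => (p.1 : ℂ) *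
      ((innerS F δ x (‖pol p.1 p.2‖ ^ 2) : ℂ) * Ψ (pol p.1 p.2))) S := by
    have hc : Continuous fun p : ℝ × ℝ => (p.1 : ℂ) *
        ((innerS F δ x (‖pol p.1 p.2‖ ^ 2) : ℂ) * Ψ (pol p.1 p.2)) :=
      (Complex.continuous_ofReal.comp continuous_fst).mul (hcont.comp continuous_pol)
    refine IntegrableOn.of_forall_sdiff_eq_zero (s := Set.Icc 0 (F x + 2 * δ + 1) ×ˢ
      Set.Icc 0 (2 * Real.pi)) (hc.continuousOn.integrableOn_compact
      (isCompact_Icc.prod isCompact_Icc)) hSm fun p hp => ?_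
    have h1 : F x + 2 * δ + 1 < p.1 := by
      by_contra h
      exact hp.2 ⟨⟨le_of_lt hp.1.1, not_lt.1 h⟩, Set.Ioo_subset_Icc_self hp.1.2⟩
    rw [norm_sq_pol, hout p.1 (by nlinarith)]
    simp
  have i2 : IntegrableOn (fun p : ℝ × ℝ => (κ p.1 : ℂ) * G p.2) S := by
    rw [hS, IntegrableOn, Measure.volume_eq_prod, ← Measure.prod_restrict]
    exact (hκi.ofReal (𝕜 := ℂ)).mul_prod hG
  have i3 : IntegrableOn (fun p : ℝ × ℝ => κ p.1 * η) S := by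
    rw [hS, IntegrableOn, Measure.volume_eq_prod, ← Measure.prod_restrict]
    exact Integrable.mul_prod (f := κ) (g := fun _ => η) hκi
      (integrableOn_const measure_Ioo_lt_top.ne)
  have e2 : ∫ φ in Set.Ioo 0 (2 * Real.pi), G φ = ∫ p in S, (κ p.1 : ℂ) * G p.2 := by
    have : ∫ r in Set.Ioi (0 : ℝ), (κ r : ℂ) = ((∫ r in Set.Ioi (0 : ℝ), κ r : ℝ) : ℂ) :=
      integral_ofReal
    rw [hS, Measure.volume_eq_prod, setIntegral_prod_mul (fun r => (κ r : ℂ)) G, this, hκ1]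
    simp
  have e3 : ∫ p in S, κ p.1 * η = 2 * Real.pi * η := by
    rw [hS, Measure.volume_eq_prod, setIntegral_prod_mul κ (fun _ => η), hκ1]
    simp [Real.pi_nonneg]
  rw [integral_plane_polar, e2, ← integral_sub i1 i2, ← e3]
  refine norm_integral_le_of_norm_le i3 ?_
  rw [ae_restrict_iff' hSm]
  refine Eventually.of_forall fun p hp => ?_
  have hp1 : 0 < p.1 := hp.1
  have hs0 : 0 ≤ κ p.1 := mul_nonneg (by positivity) (div_nonneg (deriv_step_nonneg _) hδ.le)
  -- The Jacobian `r` supplies half of the normalised weight `2 * r * innerS`, hence the division of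
  -- `Ψ` by 2.
  have e4 : (p.1 : ℂ) * ((innerS F δ x (‖pol p.1 p.2‖ ^ 2) : ℂ) * Ψ (pol p.1 p.2)) -
      (κ p.1 : ℂ) * G p.2 = (κ p.1 : ℂ) * (Ψ (pol p.1 p.2) / 2 - G p.2) := by
    rw [norm_sq_pol, hκ]; push_cast; ring
  rw [e4, norm_mul, Complex.norm_real, Real.norm_of_nonneg hs0]
  by_cases h1 : p.1 ^ 2 ≤ F x + δ
  · simp [hκ, innerS_eq_zero_of_le hδ h1]
  by_cases h2 : F x + 2 * δ ≤ p.1 ^ 2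
  · simp [hκ, hout p.1 h2]
  · exact mul_le_mul_of_nonneg_left (hη p.2 hp.2 p.1 hp1 (not_le.1 h1) (not_le.1 h2)) hs0

/-- Green's function under the conjugate boundary operator, times the radius of the surface. -/
noncomputable def surfaceKernel (k : ℂ) (f : ℝ → ℝ) (xs : ℝ) (ys : Plane) (x φ : ℝ) :
    ℂ :=
  kernel k xs ys x (pol (f x) φ) * (Complex.I * k *
    ((dotSub ys (pol (f x) φ) / (xs - x) + deriv f x * f x : ℝ) : ℂ))

section

variable {k : ℂ} {θ : ℝ} {f : ℝ → ℝ} {X₁ : ℝ} {X₂ : EReal} {u : ℝ → Plane → ℂ}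

lemma continuousOn_deriv_profile (hf : IsProfile f X₁ X₂) :
    ContinuousOn (deriv f) {x : ℝ | X₁ < x ∧ (x : EReal) < X₂} :=
  ((contDiffOn_one_iff_derivWithin (isOpen_axis X₁ X₂).uniqueDiffOn).1 hf.smooth).2.congr
    fun _ hx => (derivWithin_of_isOpen (isOpen_axis X₁ X₂) hx).symm

lemma hasDerivAt_profile (hf : IsProfile f X₁ X₂) {x : ℝ} (h1 : X₁ < x) (h2 : (x : EReal) < X₂) :
    HasDerivAt f (deriv f x) x :=
  ((hf.smooth.differentiableOn (by norm_num)).differentiableAt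
    ((isOpen_axis X₁ X₂).mem_nhds ⟨h1, h2⟩)).hasDerivAt

lemma continuousOn_profile (hf : IsProfile f X₁ X₂) :
    ContinuousOn f {x : ℝ | X₁ < x ∧ (x : EReal) < X₂} :=
  hf.continuousOn.mono fun _ hx => ⟨hx.1.le, hx.2.le⟩

lemma continuousOn_surfaceKernel (hf : IsProfile f X₁ X₂) (k : ℂ) (xs : ℝ) (ys : Plane) :
    ContinuousOn (fun q : ℝ × ℝ => surfaceKernel k f xs ys q.1 q.2)
      (axisUpTo X₁ X₂ xs ×ˢ Set.univ) := by
  have hm : Set.MapsTo (Prod.fst : ℝ × ℝ → ℝ) (axisUpTo X₁ X₂ xs ×ˢ Set.univ)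
      {x : ℝ | X₁ < x ∧ (x : EReal) < X₂} := fun q hq => ⟨hq.1.1, hq.1.2.1⟩
  have c1 : ContinuousOn (fun q : ℝ × ℝ => f q.1) (axisUpTo X₁ X₂ xs ×ˢ Set.univ) :=
    ContinuousOn.comp (g := f) (f := Prod.fst) (continuousOn_profile hf) continuousOn_fst hm
  have c2 : ContinuousOn (fun q : ℝ × ℝ => deriv f q.1) (axisUpTo X₁ X₂ xs ×ˢ Set.univ) :=
    ContinuousOn.comp (g := deriv f) (f := Prod.fst) (continuousOn_deriv_profile hf) continuousOn_fst hm
  have c3 : ContinuousOn (fun q : ℝ × ℝ => pol (f q.1) q.2) (axisUpTo X₁ X₂ xs ×ˢ Set.univ) :=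
    continuous_pol.comp_continuousOn (c1.prodMk continuousOn_snd)
  have c4 : ContinuousOn (fun q : ℝ × ℝ => kernel k xs ys q.1 (pol (f q.1) q.2))
      (axisUpTo X₁ X₂ xs ×ˢ Set.univ) :=
    (continuousOn_kernel k xs ys).comp (f := fun q : ℝ × ℝ => (q.1, pol (f q.1) q.2))
      (continuousOn_fst.prodMk c3) fun q hq => ⟨hq.1.2.2, trivial⟩
  have c5 : ContinuousOn (fun q : ℝ × ℝ => dotSub ys (pol (f q.1) q.2) / (xs - q.1))
      (axisUpTo X₁ X₂ xs ×ˢ Set.univ) :=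
    ContinuousOn.div ((continuous_dotSub ys).comp_continuousOn c3)
      (continuous_const.sub continuous_fst).continuousOn fun q hq => (sub_pos.2 hq.1.2.2).ne'
  exact c4.mul (continuousOn_const.mul
    (Complex.continuous_ofReal.comp_continuousOn (c5.add (c2.mul c1))))

lemma dotSub_pol (rs φs r φ : ℝ) :
    dotSub (pol rs φs) (pol r φ) = r * (r - rs * Real.cos (φs - φ)) := by
  have := Real.sin_sq_add_cos_sq φ
  simp only [dotSub, pol, Real.cos_sub, PiLp.toLp_apply, Matrix.cons_val_zero, Matrix.cons_val_one]
  linear_combination r ^ 2 * this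

lemma green_eq_kernel {k : ℂ} {xs x : ℝ} (hx : x < xs) (rs φs r φ : ℝ) :
    green k xs rs φs x r φ = kernel k xs (pol rs φs) x (pol r φ) := by
  rw [green, if_pos hx, kernel, norm_sq_pol_sub_pol]
  congr 2
  push_cast
  have : (xs : ℂ) - x ≠ 0 := by exact_mod_cast (sub_pos.2 hx).ne'
  field_simp

lemma hasDerivAt_green (k : ℂ) {xs x : ℝ} (hx : x < xs) (rs φs r φ : ℝ) :
    HasDerivAt (fun r => green k xs rs φs x r φ) (kernel k xs (pol rs φs) x (pol r φ) *
      (Complex.I * k * (((r - rs * Real.cos (φs - φ)) / (xs - x) : ℝ) : ℂ))) r := by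
  have h1 : HasDerivAt (fun r : ℝ => (rs ^ 2 + r ^ 2 - 2 * rs * r * Real.cos (φs - φ)) / (xs - x))
      ((2 * r - 2 * rs * Real.cos (φs - φ)) / (xs - x)) r := by
    have := (((hasDerivAt_pow 2 r).const_add (rs ^ 2)).sub
      (((hasDerivAt_id r).const_mul (2 * rs)).mul_const (Real.cos (φs - φ)))).div_const (xs - x)
    refine this.congr_deriv ?_
    push_cast; ring
  have h2 := ((h1.ofReal_comp.const_mul (Complex.I * k / 2)).cexp).const_mul
    (k / (2 * Real.pi * Complex.I * ((xs - x : ℝ) : ℂ)))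
  rw [← green_eq_kernel hx]
  have h3 : (fun r => green k xs rs φs x r φ) = fun r : ℝ => k / (2 * Real.pi * Complex.I *
      ((xs - x : ℝ) : ℂ)) * Complex.exp (Complex.I * k / 2 *
        (((rs ^ 2 + r ^ 2 - 2 * rs * r * Real.cos (φs - φ)) / (xs - x) : ℝ) : ℂ)) := by
    ext r; rw [green, if_pos hx]
  rw [h3]
  refine h2.congr_deriv ?_
  rw [green, if_pos hx]
  push_cast
  ring

lemma kirchhoffIntegrand_eq (k : ℂ) (f : ℝ → ℝ) (u : ℝ → Plane → ℂ) {xs x : ℝ} (hx : x < xs)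
    (rs φs φ : ℝ) : kirchhoffIntegrand k f u xs rs φs x φ =
      surfaceKernel k f xs (pol rs φs) x φ * surfaceField f u x φ := by
  rw [kirchhoffIntegrand, barNGreen, (hasDerivAt_green k hx rs φs (f x) φ).deriv,
    green_eq_kernel hx, surfaceKernel, dotSub_pol]
  push_cast
  ring

end

lemma tendsto_kernel (k : ℂ) {xs : ℝ} (ys : Plane) {α : Type*} {l : Filter α} {ξ : α → ℝ}
    {υ : α → Plane} {x : ℝ} {y : Plane} (hx : x < xs) (hξ : Tendsto ξ l (𝓝 x))
    (hυ : Tendsto υ l (𝓝 y)) :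
    Tendsto (fun a => kernel k xs ys (ξ a) (υ a)) l (𝓝 (kernel k xs ys x y)) := by
  have hm : Set.Iio xs ×ˢ (Set.univ : Set Plane) ∈ 𝓝 (x, y) :=
    (isOpen_Iio.prod isOpen_univ).mem_nhds (Set.mk_mem_prod hx (Set.mem_univ _))
  have hc := (continuousOn_kernel k xs ys).continuousAt hm
  have := hc.tendsto.comp (hξ.prodMk_nhds hυ)
  exact this

section

variable {k : ℂ} {θ : ℝ} {f : ℝ → ℝ} {X₁ : ℝ} {X₂ : EReal} {u : ℝ → Plane → ℂ}

lemma pol_eq_smul (r φ : ℝ) : pol r φ = r • radial φ := by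
  ext i; fin_cases i <;> simp [pol, radial]

/-- The radial derivative is written as `N[u] + i k f' u`. Then only `u`, which is continuous up to
the surface, and `N[u]`, which tends to zero there, remain; the gradient itself need not have a
limit. -/
lemma IsTotalField.flux_pol (hk : k ≠ 0) (hu : IsTotalField k θ f X₁ X₂ u) {xs x r φ : ℝ}
    (ys : Plane) (h : (x, pol r φ) ∈ offTips f X₁ X₂) :
    flux k (fun x => 2 * f x * deriv f x) u xs ys x (pol r φ) / 2 =
      u x (pol r φ) * (kernel k xs ys x (pol r φ) * (((r / 2 - f x) * deriv f x -
        dotSub ys (pol r φ) / (xs - x) / 2 : ℝ) : ℂ)) -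
      Complex.I / (2 * k) * (kernel k xs ys x (pol r φ) * (r : ℂ) * opN k f u x r φ) := by
  have h1 : fderiv ℝ (u x) (pol r φ) (pol r φ) =
      (r : ℂ) * (opN k f u x r φ + Complex.I * k * ((deriv f x : ℝ) : ℂ) * u x (pol r φ)) := by
    rw [opN, (hu.hasDerivAt_radial h).deriv, sub_add_cancel]
    conv_lhs => rw [pol_eq_smul r φ, map_smul, Complex.real_smul, ← pol_eq_smul]
  rw [flux, h1]
  push_cast
  field_simp
  ring_nf
  simp only [Complex.I_sq]
  ring

/-- The flux tends to the integrand of Kirchhoff's formula at the surface. -/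
lemma IsTotalField.tendsto_flux (hf : IsProfile f X₁ X₂) (hk : k ≠ 0)
    (hu : IsTotalField k θ f X₁ X₂ u) {xs x₀ : ℝ} (hx : x₀ ∈ axisUpTo X₁ X₂ xs) (ys : Plane)
    (φ₀ : ℝ) {l : Filter (ℝ × ℝ × ℝ)} (tx : Tendsto (fun z : ℝ × ℝ × ℝ => z.2.1) l (𝓝 x₀))
    (tt : Tendsto (fun z : ℝ × ℝ × ℝ => z.1) l (𝓝 0))
    (tφ : Tendsto (fun z : ℝ × ℝ × ℝ => z.2.2) l (𝓝 φ₀)) (epos : ∀ᶠ z in l, 0 < z.1) :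
    Tendsto (fun z : ℝ × ℝ × ℝ => flux k (fun x => 2 * f x * deriv f x) u xs ys z.2.1
        (pol (f z.2.1 + z.1) z.2.2) / 2 -
        Complex.I / (2 * k) * (surfaceKernel k f xs ys z.2.1 z.2.2 * surfaceField f u z.2.1 z.2.2))
      l (𝓝 0) := by
  have hax : x₀ ∈ {x : ℝ | X₁ < x ∧ (x : EReal) < X₂} := ⟨hx.1, hx.2.1⟩
  have hn : {x : ℝ | X₁ < x ∧ (x : EReal) < X₂} ∈ 𝓝 x₀ := (isOpen_axis X₁ X₂).mem_nhds hax
  have hno : axisUpTo X₁ X₂ xs ∈ 𝓝 x₀ := (isOpen_axisUpTo X₁ X₂ xs).mem_nhds hx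
  have eax : ∀ᶠ z in l, z.2.1 ∈ axisUpTo X₁ X₂ xs := tx.eventually hno
  have tf : Tendsto (fun z : ℝ × ℝ × ℝ => f z.2.1) l (𝓝 (f x₀)) :=
    ((continuousOn_profile hf).continuousAt hn).tendsto.comp tx
  have tf' : Tendsto (fun z : ℝ × ℝ × ℝ => deriv f z.2.1) l (𝓝 (deriv f x₀)) :=
    ((continuousOn_deriv_profile hf).continuousAt hn).tendsto.comp tx
  have tr : Tendsto (fun z : ℝ × ℝ × ℝ => f z.2.1 + z.1) l (𝓝 (f x₀)) := by
    simpa using tf.add tt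
  have tp : Tendsto (fun z : ℝ × ℝ × ℝ => pol (f z.2.1 + z.1) z.2.2) l (𝓝 (pol (f x₀) φ₀)) :=
    (continuous_pol.tendsto (f x₀, φ₀)).comp (tr.prodMk_nhds tφ)
  have tk := tendsto_kernel k ys hx.2.2 tx tp
  have hoff : ∀ᶠ z in l, (z.2.1, pol (f z.2.1 + z.1) z.2.2) ∈ offTips f X₁ X₂ := by
    filter_upwards [epos, eax] with z h1 h2
    exact mem_offTips_pol _ h2.1 h2.2.1 (hf.pos _ h2.1 h2.2.1).le (by linarith)
  have tu : Tendsto (fun z : ℝ × ℝ × ℝ => u z.2.1 (pol (f z.2.1 + z.1) z.2.2)) l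
      (𝓝 (surfaceField f u x₀ φ₀)) := by
    have h1 := hu.continuousOn (x₀, pol (f x₀) φ₀)
      (Or.inr (mem_surface_pol φ₀ hx.1 hx.2.1 (hf.pos _ hx.1 hx.2.1).le))
    refine h1.tendsto.comp (tendsto_nhdsWithin_iff.2 ⟨tx.prodMk_nhds tp, ?_⟩)
    filter_upwards [hoff] with z hz using Or.inl hz.1
  have tN : Tendsto (fun z : ℝ × ℝ × ℝ => opN k f u z.2.1 (f z.2.1 + z.1) z.2.2) l (𝓝 0) := by
    refine (hu.neumann x₀ φ₀ hx.1 hx.2.1).comp (f := fun z : ℝ × ℝ × ℝ =>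
      (z.2.1, f z.2.1 + z.1, z.2.2))
      (tendsto_nhdsWithin_iff.2 ⟨tx.prodMk_nhds (tr.prodMk_nhds tφ), ?_⟩)
    filter_upwards [epos] with z hz
    simpa using hz
  have td : Tendsto (fun z : ℝ × ℝ × ℝ => dotSub ys (pol (f z.2.1 + z.1) z.2.2)) l
      (𝓝 (dotSub ys (pol (f x₀) φ₀))) := ((continuous_dotSub ys).tendsto _).comp tp
  have tK : Tendsto (fun z : ℝ × ℝ × ℝ => surfaceKernel k f xs ys z.2.1 z.2.2) l
      (𝓝 (surfaceKernel k f xs ys x₀ φ₀)) :=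
    ((continuousOn_surfaceKernel hf k xs ys).continuousAt (x := (x₀, φ₀))
      (((isOpen_axisUpTo X₁ X₂ xs).prod isOpen_univ).mem_nhds ⟨hx, trivial⟩)).tendsto.comp
      (tx.prodMk_nhds tφ)
  have tU : Tendsto (fun z : ℝ × ℝ × ℝ => surfaceField f u z.2.1 z.2.2) l
      (𝓝 (surfaceField f u x₀ φ₀)) :=
    ((hu.continuousOn_surfaceField hf).continuousAt (x := (x₀, φ₀))
      (((isOpen_axis X₁ X₂).prod isOpen_univ).mem_nhds ⟨hax, trivial⟩)).tendsto.comp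
      (tx.prodMk_nhds tφ)
  have hxs : xs - x₀ ≠ 0 := (sub_pos.2 hx.2.2).ne'
  have tcoef : Tendsto (fun z : ℝ × ℝ × ℝ => (((f z.2.1 + z.1) / 2 - f z.2.1) * deriv f z.2.1 -
      dotSub ys (pol (f z.2.1 + z.1) z.2.2) / (xs - z.2.1) / 2 : ℝ)) l
      (𝓝 ((f x₀ / 2 - f x₀) * deriv f x₀ - dotSub ys (pol (f x₀) φ₀) / (xs - x₀) / 2)) :=
    (((tr.div_const 2).sub tf).mul tf').sub ((td.div (tx.const_sub xs) hxs).div_const 2)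
  have hmain := ((tu.mul (tk.mul tcoef.ofReal)).sub
    (((tk.mul tr.ofReal).mul tN).const_mul (Complex.I / (2 * k)))).sub
    ((tK.mul tU).const_mul (Complex.I / (2 * k)))
  refine (hmain.congr' ?_).trans (le_of_eq ?_)
  · filter_upwards [hoff] with z hz
    rw [hu.flux_pol hk ys hz]
  · congr 1
    have hxs' : (xs : ℂ) - x₀ ≠ 0 := by exact_mod_cast hxs
    rw [surfaceKernel]
    push_cast
    field_simp
    ring_nf
    simp only [Complex.I_sq]
    ring

/-- Compactness of the piece of surface over `[a, b]` makes the limit of `tendsto_flux` uniform. -/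
lemma IsTotalField.exists_flux_close (hf : IsProfile f X₁ X₂) (hk : k ≠ 0)
    (hu : IsTotalField k θ f X₁ X₂ u) {xs a b η : ℝ} (hI : Set.Icc a b ⊆ axisUpTo X₁ X₂ xs)
    (ys : Plane) (hη : 0 < η) :
    ∃ ρ > 0, ∀ x ∈ Set.Icc a b, ∀ φ ∈ Set.Ioo 0 (2 * Real.pi), ∀ r, f x < r → r < f x + ρ →
      ‖flux k (fun x => 2 * f x * deriv f x) u xs ys x (pol r φ) / 2 -
        Complex.I / (2 * k) * (surfaceKernel k f xs ys x φ * surfaceField f u x φ)‖ ≤ η := by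
  have hK : IsCompact (Set.Icc a b ×ˢ Set.Icc (0 : ℝ) (2 * Real.pi)) :=
    isCompact_Icc.prod isCompact_Icc
  have h := hK.eventually_forall_of_forall_eventually (x₀ := (0 : ℝ))
    (P := fun (t : ℝ) (q : ℝ × ℝ) => 0 < t →
      ‖flux k (fun x => 2 * f x * deriv f x) u xs ys q.1 (pol (f q.1 + t) q.2) / 2 -
        Complex.I / (2 * k) * (surfaceKernel k f xs ys q.1 q.2 * surfaceField f u q.1 q.2)‖ < η)
    (fun q hq => by
      have hle : 𝓝[{z : ℝ × ℝ × ℝ | 0 < z.1}] ((0 : ℝ), q) ≤ 𝓝 (0, q) := nhdsWithin_le_nhds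
      have := (hu.tendsto_flux hf hk (hI hq.1) ys q.2
        ((Continuous.tendsto (by fun_prop) ((0 : ℝ), q)).mono_left hle)
        ((Continuous.tendsto (by fun_prop) ((0 : ℝ), q)).mono_left hle)
        ((Continuous.tendsto (by fun_prop) ((0 : ℝ), q)).mono_left hle)
        eventually_mem_nhdsWithin).eventually (Metric.ball_mem_nhds 0 hη)
      rw [eventually_nhdsWithin_iff] at this
      filter_upwards [this] with z hz hz0
      simpa using hz hz0)
  obtain ⟨ρ, hρ, hball⟩ := Metric.eventually_nhds_iff.1 h
  refine ⟨ρ, hρ, fun x hx φ hφ r h1 h2 => ?_⟩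
  have := hball (y := r - f x) (by rw [Real.dist_eq, sub_zero, abs_of_pos] <;> linarith) (x, φ)
    ⟨hx, Set.Ioo_subset_Icc_self hφ⟩ (by linarith)
  simp only [add_sub_cancel] at this
  exact this.le

lemma mem_axis_not_exterior {x : ℝ} (h1 : X₁ < x) (h2 : (x : EReal) < X₂) {y : Plane} :
    (x, y) ∉ exterior f X₁ X₂ ↔ ‖y‖ ≤ f x := by
  constructor
  · intro h
    by_contra h3
    exact h fun _ _ => not_le.1 h3
  · exact fun h h3 => absurd (h3 h1.le h2.le) (not_lt.2 h)

/-- Dominated convergence: as `δ` tends to 0, the inner cutoff tends to the indicator function of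
the exterior slice. -/
lemma IsTotalField.tendsto_integral_inner (hf : IsProfile f X₁ X₂)
    (hu : IsTotalField k θ f X₁ X₂ u) (hk : 0 < k.im) (hdec : ScatteredDecays k θ f X₁ X₂ u)
    {xs x : ℝ} (hx : x ∈ axisUpTo X₁ X₂ xs) (ys : Plane) :
    Tendsto (fun δ : ℝ => ∫ y, u x y * (kernel k xs ys x y *
      (inner₀ (fun x => f x ^ 2) δ x (‖y‖ ^ 2) : ℂ))) (𝓝[>] 0)
      (𝓝 (planeIntegral k f X₁ X₂ u xs ys x)) := by
  have h0 := hf.pos x hx.1 hx.2.1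
  have hint := hu.integrableOn_slice hf hk hdec hx.2.2 ys hx.1.ne' hx.2.1.ne
  have hm := measurableSet_extSlice hf x
  have e : ∀ᶠ δ : ℝ in 𝓝[>] 0, ∫ y in extSlice f X₁ X₂ x, u x y * kernel k xs ys x y *
      (inner₀ (fun x => f x ^ 2) δ x (‖y‖ ^ 2) : ℂ) = ∫ y, u x y * (kernel k xs ys x y *
      (inner₀ (fun x => f x ^ 2) δ x (‖y‖ ^ 2) : ℂ)) := by
    filter_upwards [self_mem_nhdsWithin] with δ hδ
    simp_rw [mul_assoc]
    refine setIntegral_eq_integral_of_forall_compl_eq_zero fun y hy => ?_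
    have h1 : ‖y‖ ≤ f x := (mem_axis_not_exterior hx.1 hx.2.1).1 hy
    have h2 : ‖y‖ ^ 2 ≤ f x ^ 2 := pow_le_pow_left₀ (norm_nonneg _) h1 2
    have : inner₀ (fun x => f x ^ 2) δ x (‖y‖ ^ 2) = 0 := step_eq_zero
      ((div_nonpos_of_nonpos_of_nonneg (by linarith) (le_of_lt hδ)).trans zero_le_one)
    rw [this]; simp
  refine Tendsto.congr' e ?_
  refine tendsto_integral_filter_of_dominated_convergence _ ?_ ?_ hint.norm ?_
  · refine Eventually.of_forall fun δ => hint.aestronglyMeasurable.mul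
      (Continuous.aestronglyMeasurable ?_)
    have s0 : Continuous step := (contDiff_step (n := 0)).continuous
    unfold inner₀
    fun_prop
  · refine Eventually.of_forall fun δ => Eventually.of_forall fun y => ?_
    rw [norm_mul, Complex.norm_real, Real.norm_eq_abs, abs_of_nonneg (inner₀_mem _ _ _ _).1]
    exact mul_le_of_le_one_right (norm_nonneg _) (inner₀_mem _ _ _ _).2
  · rw [ae_restrict_iff' hm]
    refine Eventually.of_forall fun y hy => tendsto_const_nhds.congr' ?_
    have h1 : f x < ‖y‖ := hy hx.1.le hx.2.1.le
    have h2 : 0 < (‖y‖ ^ 2 - f x ^ 2) / 2 := by nlinarith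
    filter_upwards [Ioo_mem_nhdsGT h2] with δ hδ
    rw [(inner_of_ge (F := fun x => f x ^ 2) (F' := f) hδ.1 (by
      have := hδ.2; linarith)).1]
    simp

/-- Green's identity: the plane integrals differ by the integral over the surface in between. -/
theorem IsTotalField.surface_identity (hf : IsProfile f X₁ X₂) (hu : IsTotalField k θ f X₁ X₂ u)
    (hk : 0 < k.im) (hdec : ScatteredDecays k θ f X₁ X₂ u) {xs a b : ℝ} (hab : a ≤ b)
    (hI : Set.Icc a b ⊆ axisUpTo X₁ X₂ xs) (ys : Plane) :
    planeIntegral k f X₁ X₂ u xs ys b - planeIntegral k f X₁ X₂ u xs ys a =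
      ∫ x in a..b, ∫ φ in Set.Ioo 0 (2 * Real.pi),
        Complex.I / (2 * k) * (surfaceKernel k f xs ys x φ * surfaceField f u x φ) := by
  have hk0 : k ≠ 0 := by rintro rfl; simp at hk
  set F : ℝ → ℝ := fun x => f x ^ 2 with hFdef
  set F' : ℝ → ℝ := fun x => 2 * f x * deriv f x with hF'def
  set G : ℝ × ℝ → ℂ := fun q =>
    Complex.I / (2 * k) * (surfaceKernel k f xs ys q.1 q.2 * surfaceField f u q.1 q.2) with hG
  have hax : axisUpTo X₁ X₂ xs ⊆ {x : ℝ | X₁ < x ∧ (x : EReal) < X₂} := fun x hx => ⟨hx.1, hx.2.1⟩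
  have hGc : ContinuousOn G (axisUpTo X₁ X₂ xs ×ˢ Set.univ) :=
    continuousOn_const.mul ((continuousOn_surfaceKernel hf k xs ys).mul
      ((hu.continuousOn_surfaceField hf).mono (Set.prod_mono hax subset_rfl)))
  have hGi : IntegrableOn G (Set.Ioc a b ×ˢ Set.Ioo 0 (2 * Real.pi)) :=
    ((hGc.mono (Set.prod_mono hI (Set.subset_univ _))).integrableOn_compact
      (isCompact_Icc.prod (isCompact_Icc (a := (0 : ℝ)) (b := 2 * Real.pi)))).mono_set
      (Set.prod_mono Set.Ioc_subset_Icc_self Set.Ioo_subset_Icc_self)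
  have hGi1 : IntervalIntegrable (fun x => ∫ φ in Set.Ioo 0 (2 * Real.pi), G (x, φ)) volume a b := by
    rw [intervalIntegrable_iff_integrableOn_Ioc_of_le hab]
    rw [IntegrableOn, Measure.volume_eq_prod, ← Measure.prod_restrict] at hGi
    exact hGi.integral_prod_left
  have hGs : ∀ x ∈ Set.Icc a b, IntegrableOn (fun φ => G (x, φ)) (Set.Ioo 0 (2 * Real.pi)) := by
    intro x hx
    have : ContinuousOn (fun φ => G (x, φ)) (Set.Icc 0 (2 * Real.pi)) :=
      hGc.comp (f := fun φ : ℝ => (x, φ)) (by fun_prop) fun φ _ => ⟨hI hx, trivial⟩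
    exact (this.integrableOn_compact isCompact_Icc).mono_set Set.Ioo_subset_Icc_self
  have hfF : ∀ x ∈ axisUpTo X₁ X₂ xs, ∀ y : Plane, (x, y) ∉ exterior f X₁ X₂ → ‖y‖ ^ 2 ≤ F x :=
    fun x hx y hy => pow_le_pow_left₀ (norm_nonneg _) ((mem_axis_not_exterior hx.1 hx.2.1).1 hy) 2
  have hFd : ∀ x ∈ axisUpTo X₁ X₂ xs, HasDerivAt F (F' x) x := fun x hx =>
    ((hasDerivAt_profile hf hx.1 hx.2.1).pow 2).congr_deriv (by simp [hF'def])
  have hF'c : ContinuousOn F' (axisUpTo X₁ X₂ xs) :=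
    (continuousOn_const.mul ((continuousOn_profile hf).mono hax)).mul
      ((continuousOn_deriv_profile hf).mono hax)
  have hid := fun {δ : ℝ} (hδ : 0 < δ) => hu.green_identity_inner hf hk hdec
    (isOpen_axisUpTo X₁ X₂ xs) (fun x hx => hx.2.2) hFd hF'c hδ hfF ys hab hI
  have hL := (hu.tendsto_integral_inner hf hk hdec (hI (Set.right_mem_Icc.2 hab)) ys).sub
    (hu.tendsto_integral_inner hf hk hdec (hI (Set.left_mem_Icc.2 hab)) ys)
  refine tendsto_nhds_unique hL ?_
  obtain ⟨m, hm0, hm⟩ : ∃ m > 0, ∀ x ∈ Set.Icc a b, m ≤ f x := by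
    obtain ⟨z, hz, hmin⟩ := isCompact_Icc.exists_isMinOn (Set.nonempty_Icc.2 hab)
      ((continuousOn_profile hf).mono (hI.trans hax))
    exact ⟨f z, hf.pos z (hI hz).1 (hI hz).2.1, fun x hx => hmin hx⟩
  rw [Metric.tendsto_nhds]
  intro ε hε
  set η : ℝ := ε / (2 * Real.pi * (|b - a| + 1)) with hη
  have hη0 : 0 < η := by positivity
  obtain ⟨ρ, hρ, hclose⟩ := hu.exists_flux_close hf hk0 hI ys hη0
  -- For `δ < m * ρ` and `m ≤ f x` one has `f x ^ 2 + 2 * δ < (f x + ρ) ^ 2`, so the derivative of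
  -- the cutoff lives in the layer where `hclose` applies.
  have hδ0 : 0 < m * ρ := by positivity
  filter_upwards [Ioo_mem_nhdsGT hδ0] with δ hδ
  obtain ⟨hcont, heq⟩ := hid hδ.1
  rw [heq, dist_eq_norm, ← intervalIntegral.integral_sub
    ((hcont.mono (Set.uIcc_of_le hab).subset).intervalIntegrable) hGi1]
  have hb : ∀ x ∈ Set.uIoc a b, ‖(∫ y, u x y *
      cutoffSource k xs ys (innerX F F' δ) (innerS F δ) (innerSS F δ) x y) -
      ∫ φ in Set.Ioo 0 (2 * Real.pi), G (x, φ)‖ ≤ 2 * Real.pi * η := by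
    intro x hx
    rw [Set.uIoc_of_le hab] at hx
    have hx' := Set.Ioc_subset_Icc_self hx
    have hxa := hI hx'
    have h1 : x ≠ X₁ := hxa.1.ne'
    have h2 : (x : EReal) ≠ X₂ := hxa.2.1.ne
    rw [hu.integral_source_eq_flux hf hδ.1 hxa.2.2 h1 h2 ys (hfF x hxa)]
    refine norm_integral_innerS_sub_le hδ.1 (sq_nonneg _) ?_ (hGs x hx') fun φ hφ r hr h3 h4 => ?_
    · exact ContinuousOn.continuous_of_tsupport_subset
        ((continuous_innerS F δ x).continuousOn.mul (hu.continuousOn_flux F' hxa.2.2 ys))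
        (isOpen_slice hf x) (tsupport_mul_subset_left.trans
          (tsupport_innerS_subset hδ.1 h1 h2 (hfF x hxa)))
    · have hfx := hf.pos x hxa.1 hxa.2.1
      have hmx := hm x hx'
      have hδ2 := hδ.2
      have hδ1 := hδ.1
      simp only [hFdef] at h3 h4
      have h5 : f x < r := lt_of_pow_lt_pow_left₀ 2 hr.le (by linarith)
      have h6 : r < f x + ρ := by
        refine lt_of_pow_lt_pow_left₀ 2 (by linarith) ?_
        nlinarith [mul_le_mul_of_nonneg_right hmx hρ.le]
      exact hclose x hx' φ hφ r h5 h6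
  refine (intervalIntegral.norm_integral_le_of_norm_le_const hb).trans_lt ?_
  have hp := Real.pi_pos
  have : 2 * Real.pi * η * (|b - a| + 1) = ε := by rw [hη]; field_simp
  have h7 : 0 < 2 * Real.pi * η := by positivity
  nlinarith

end

/-! ### Bounds for the kernel of Kirchhoff's formula, and integrability -/

section

variable {k : ℂ} {θ : ℝ} {f : ℝ → ℝ} {X₁ : ℝ} {X₂ : EReal} {u : ℝ → Plane → ℂ}

lemma barNGreen_eq (k : ℂ) (f : ℝ → ℝ) {xs x : ℝ} (hx : x < xs) (rs φs φ : ℝ) :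
    barNGreen k f xs rs φs x φ = kernel k xs (pol rs φs) x (pol (f x) φ) *
      (Complex.I * k * (((f x - rs * Real.cos (φs - φ)) / (xs - x) + deriv f x : ℝ) : ℂ)) := by
  rw [barNGreen, (hasDerivAt_green k hx rs φs (f x) φ).deriv, green_eq_kernel hx]
  push_cast
  ring

/-- The slope is also put over the denominator `xs - x`, so that a single factor `1 / (xs - x)`
collects the singularity. -/
lemma norm_barNGreen_le {xs x R C D : ℝ} (hx : x < xs) (hR : |f x| ≤ R) (hC : |deriv f x| ≤ C)
    (hD : xs - x ≤ D) (rs φs φ : ℝ) :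
    ‖barNGreen k f xs rs φs x φ‖ ≤ ‖kernel k xs (pol rs φs) x (pol (f x) φ)‖ / (xs - x) *
      (‖k‖ * (R + |rs| + C * D)) := by
  have hs : 0 < xs - x := sub_pos.2 hx
  have hC0 : 0 ≤ C := (abs_nonneg _).trans hC
  have h1 : |(f x - rs * Real.cos (φs - φ)) / (xs - x) + deriv f x| ≤
      (R + |rs| + C * D) / (xs - x) := by
    have h2 : |f x - rs * Real.cos (φs - φ)| ≤ R + |rs| := by
      refine (abs_sub _ _).trans (add_le_add hR ?_)
      rw [abs_mul]
      exact mul_le_of_le_one_right (abs_nonneg _) (Real.abs_cos_le_one _)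
    have h3 : |deriv f x| ≤ C * D / (xs - x) := by
      rw [le_div_iff₀ hs]
      exact mul_le_mul hC hD hs.le hC0
    refine (abs_add_le _ _).trans ?_
    rw [abs_div, abs_of_pos hs, add_div]
    exact add_le_add (div_le_div_of_nonneg_right h2 hs.le) h3
  rw [barNGreen_eq k f hx, norm_mul, norm_mul, norm_mul, Complex.norm_I, one_mul,
    Complex.norm_real, Real.norm_eq_abs]
  calc _ ≤ ‖kernel k xs (pol rs φs) x (pol (f x) φ)‖ *
        (‖k‖ * ((R + |rs| + C * D) / (xs - x))) := by gcongr
    _ = _ := by ring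

/-- Away from the observation plane the kernel of Kirchhoff's formula is bounded, uniformly in the
wavenumber. -/
lemma exists_barNGreen_bound_of_le (hf : IsProfile f X₁ X₂) {xs d : ℝ} (hd : 0 < d)
    (rs φs K : ℝ) : ∃ M : ℝ, ∀ k : ℂ, 0 ≤ k.im → ‖k‖ ≤ K → ∀ x ∈ axisUpTo X₁ X₂ xs, d ≤ xs - x →
      ∀ φ, ‖barNGreen k f xs rs φs x φ‖ ≤ M := by
  obtain ⟨R, hR0, hR⟩ := exists_profile_bound hf xs
  obtain ⟨C, hC⟩ := hf.slope
  refine ⟨K / (2 * Real.pi * d) / d * (K * (R + |rs| + |C| * |xs - X₁|)),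
    fun k hk hkK x hx hdx φ => ?_⟩
  have hpi := Real.pi_pos
  have hK0 : 0 ≤ K := (norm_nonneg k).trans hkK
  refine (norm_barNGreen_le (D := |xs - X₁|) (C := |C|) hx.2.2 (R := R) ?_ ?_ ?_ rs φs φ).trans ?_
  · rw [abs_of_pos (hf.pos x hx.1 hx.2.1)]; exact hR x hx
  · exact (hC x hx.1 hx.2.1).trans (le_abs_self C)
  · exact (by linarith [hx.1] : xs - x ≤ xs - X₁).trans (le_abs_self _)
  · have := norm_kernel_le hk hd hdx (pol rs φs) (pol (f x) φ)
    gcongr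
    exact this.trans (by gcongr)

lemma exp_neg_div_sq_le {a d : ℝ} (ha : 0 < a) (hd : 0 < d) :
    Real.exp (-(a / d)) / d ^ 2 ≤ 2 / a ^ 2 := by
  have h1 := Real.quadratic_le_exp_of_nonneg (x := a / d) (by positivity)
  have h2 : (a / d) ^ 2 / 2 ≤ Real.exp (a / d) := by
    have : 0 ≤ a / d := by positivity
    linarith
  rw [Real.exp_neg, div_le_div_iff₀ (by positivity) (by positivity), inv_mul_le_iff₀ (Real.exp_pos _)]
  calc a ^ 2 = (a / d) ^ 2 / 2 * (2 * d ^ 2) := by field_simp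
    _ ≤ _ := by gcongr

/-- At distance `c` from the observation point the Gaussian absorbs the two negative powers of `xs -
x`. -/
lemma norm_kernel_div_le {xs x c : ℝ} (hk : 0 < k.im) (hx : x < xs) (hc : 0 < c) {ys y : Plane}
    (hy : c ≤ ‖y - ys‖) :
    ‖kernel k xs ys x y‖ / (xs - x) ≤ ‖k‖ / (2 * Real.pi) * (2 / (k.im * c ^ 2 / 2) ^ 2) := by
  have hs : 0 < xs - x := sub_pos.2 hx
  have hpi := Real.pi_pos
  have h2 : Real.exp (-(k.im / (2 * (xs - x)) * ‖y - ys‖ ^ 2)) ≤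
      Real.exp (-((k.im * c ^ 2 / 2) / (xs - x))) := by
    refine Real.exp_le_exp.2 (neg_le_neg ?_)
    calc (k.im * c ^ 2 / 2) / (xs - x) = k.im / (2 * (xs - x)) * c ^ 2 := by field_simp
      _ ≤ _ := by gcongr
  have h3 := exp_neg_div_sq_le (a := k.im * c ^ 2 / 2) (by positivity) hs
  rw [norm_kernel k hx]
  calc ‖k‖ / (2 * Real.pi * (xs - x)) * Real.exp (-(k.im / (2 * (xs - x)) * ‖y - ys‖ ^ 2)) / (xs - x)
      = ‖k‖ / (2 * Real.pi) *
        (Real.exp (-(k.im / (2 * (xs - x)) * ‖y - ys‖ ^ 2)) / (xs - x) ^ 2) := by field_simp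
    _ ≤ ‖k‖ / (2 * Real.pi) * (Real.exp (-((k.im * c ^ 2 / 2) / (xs - x))) / (xs - x) ^ 2) := by
        gcongr
    _ ≤ _ := by gcongr

/-- The only danger is the observation plane. Near it the surface keeps a positive distance from the
observation point, which lies outside the closed body, and Im k > 0 makes the kernel bounded there.
-/
lemma exists_barNGreen_bound (hf : IsProfile f X₁ X₂) (hk : 0 < k.im) {xs rs φs : ℝ} (hrs : 0 ≤ rs)
    (h : (xs, pol rs φs) ∈ exterior f X₁ X₂) :
    ∃ M : ℝ, ∀ x ∈ axisUpTo X₁ X₂ xs, ∀ φ, ‖barNGreen k f xs rs φs x φ‖ ≤ M := by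
  -- near the observation plane the surface stays away from the observation point
  obtain ⟨d, hd, c, hc, hdc⟩ : ∃ d > 0, ∃ c > 0, ∀ x ∈ axisUpTo X₁ X₂ xs, xs - x < d → ∀ φ,
      c ≤ ‖pol (f x) φ - pol rs φs‖ := by
    by_cases h1 : X₁ ≤ xs
    swap
    · exact ⟨1, one_pos, 1, one_pos, fun x hx => absurd (hx.1.trans hx.2.2) (by linarith)⟩
    by_cases h2 : (xs : EReal) ≤ X₂
    swap
    -- Behind the body no point of the surface is near the plane `xs`, and the value of `c` is
    -- irrelevant.
    · have hX : (X₂ : EReal) < xs := not_le.1 h2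
      obtain ⟨b, hb1, hb2⟩ := EReal.lt_iff_exists_real_btwn.1 hX
      refine ⟨xs - b, sub_pos.2 (EReal.coe_lt_coe_iff.1 hb2), 1, one_pos, fun x hx hlt => ?_⟩
      have : (x : EReal) < b := hx.2.1.trans hb1
      have := EReal.coe_lt_coe_iff.1 this
      linarith
    have h3 : f xs < rs := by
      have := h h1 h2
      rwa [norm_pol, abs_of_nonneg hrs] at this
    have h4 := (hf.continuousOn xs ⟨h1, h2⟩).eventually
      (Iio_mem_nhds (by linarith : f xs < (f xs + rs) / 2))
    obtain ⟨d, hd, hball⟩ := Metric.mem_nhdsWithin_iff.1 h4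
    refine ⟨d, hd, (rs - f xs) / 2, by linarith, fun x hx hlt φ => ?_⟩
    have h5 : f x < (f xs + rs) / 2 := by
      refine hball ⟨?_, hx.1.le, hx.2.1.le⟩
      rw [Metric.mem_ball, Real.dist_eq, abs_sub_comm, abs_of_pos (sub_pos.2 hx.2.2)]
      exact hlt
    have h6 := norm_sub_norm_le (pol rs φs) (pol (f x) φ)
    rw [norm_pol, norm_pol, abs_of_nonneg hrs, abs_of_pos (hf.pos x hx.1 hx.2.1),
      norm_sub_rev] at h6
    linarith
  obtain ⟨M, hM⟩ := exists_barNGreen_bound_of_le hf hd rs φs ‖k‖ (xs := xs)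
  obtain ⟨R, hR0, hR⟩ := exists_profile_bound hf xs
  obtain ⟨C, hC⟩ := hf.slope
  set B := ‖k‖ / (2 * Real.pi) * (2 / (k.im * c ^ 2 / 2) ^ 2) *
    (‖k‖ * (R + |rs| + |C| * |xs - X₁|)) with hB
  refine ⟨max M B, fun x hx φ => ?_⟩
  by_cases hdx : d ≤ xs - x
  · exact (hM k hk.le le_rfl x hx hdx φ).trans (le_max_left _ _)
  refine le_trans ?_ (le_max_right _ _)
  refine (norm_barNGreen_le (D := |xs - X₁|) (C := |C|) hx.2.2 (R := R) ?_ ?_ ?_ rs φs φ).trans ?_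
  · rw [abs_of_pos (hf.pos x hx.1 hx.2.1)]; exact hR x hx
  · exact (hC x hx.1 hx.2.1).trans (le_abs_self C)
  · exact (by linarith [hx.1] : xs - x ≤ xs - X₁).trans (le_abs_self _)
  · have := norm_kernel_div_le hk hx.2.2 hc (hdc x hx (not_le.1 hdx) φ)
    rw [hB]
    gcongr

/-- The integrand of Kirchhoff's formula is integrable where its kernel is bounded. -/
lemma IsTotalField.integrableOn_kirchhoff (hf : IsProfile f X₁ X₂)
    (hu : IsTotalField k θ f X₁ X₂ u) {xs rs φs M : ℝ}
    (hM : ∀ x ∈ axisUpTo X₁ X₂ xs, ∀ φ, ‖barNGreen k f xs rs φs x φ‖ ≤ M) :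
    IntegrableOn (fun q : ℝ × ℝ => kirchhoffIntegrand k f u xs rs φs q.1 q.2)
      (axisUpTo X₁ X₂ xs ×ˢ Set.Ioc 0 (2 * Real.pi)) := by
  have hm : MeasurableSet (axisUpTo X₁ X₂ xs ×ˢ Set.Ioc 0 (2 * Real.pi)) :=
    (isOpen_axisUpTo X₁ X₂ xs).measurableSet.prod measurableSet_Ioc
  have hc : ContinuousOn (fun q : ℝ × ℝ => kirchhoffIntegrand k f u xs rs φs q.1 q.2)
      (axisUpTo X₁ X₂ xs ×ˢ Set.univ) := by
    refine ((continuousOn_surfaceKernel hf k xs (pol rs φs)).mul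
      ((hu.continuousOn_surfaceField hf).mono (Set.prod_mono (fun x hx => ⟨hx.1, hx.2.1⟩)
        subset_rfl))).congr fun q hq => ?_
    exact kirchhoffIntegrand_eq k f u hq.1.2.2 rs φs q.2
  refine Integrable.mono' ((hu.integrableOn_surface hf xs).norm.const_mul M)
    ((hc.mono (Set.prod_mono subset_rfl (Set.subset_univ _))).aestronglyMeasurable hm) ?_
  rw [ae_restrict_iff' hm]
  refine Eventually.of_forall fun q hq => ?_
  rw [kirchhoffIntegrand, mul_assoc, norm_mul]
  exact mul_le_mul_of_nonneg_right (hM q.1 hq.1 q.2) (norm_nonneg _)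

/-- The integral in Kirchhoff's formula as an iterated integral, first over the circles. -/
lemma kirchhoff_eq {xs rs φs : ℝ}
    (h : IntegrableOn (fun q : ℝ × ℝ => kirchhoffIntegrand k f u xs rs φs q.1 q.2)
      (axisUpTo X₁ X₂ xs ×ˢ Set.Ioc 0 (2 * Real.pi))) :
    IntegrableOn (fun x => ∫ φ in Set.Ioo 0 (2 * Real.pi), Complex.I / (2 * k) *
        (surfaceKernel k f xs (pol rs φs) x φ * surfaceField f u x φ)) (axisUpTo X₁ X₂ xs) ∧
      kirchhoff k f X₁ X₂ u xs rs φs = ∫ x in axisUpTo X₁ X₂ xs, ∫ φ in Set.Ioo 0 (2 * Real.pi),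
        Complex.I / (2 * k) * (surfaceKernel k f xs (pol rs φs) x φ * surfaceField f u x φ) := by
  have hm := (isOpen_axisUpTo X₁ X₂ xs).measurableSet
  rw [IntegrableOn, Measure.volume_eq_prod, ← Measure.prod_restrict] at h
  have e : ∀ x ∈ axisUpTo X₁ X₂ xs, ∫ φ in Set.Ioo 0 (2 * Real.pi), Complex.I / (2 * k) *
        (surfaceKernel k f xs (pol rs φs) x φ * surfaceField f u x φ) = Complex.I / (2 * k) *
        ∫ φ in Set.Ioc 0 (2 * Real.pi), kirchhoffIntegrand k f u xs rs φs x φ := by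
    intro x hx
    rw [integral_const_mul, integral_Ioc_eq_integral_Ioo]
    simp_rw [kirchhoffIntegrand_eq k f u hx.2.2]
  constructor
  · exact ((integrableOn_congr_fun e hm).2 (h.integral_prod_left.const_mul _))
  · rw [setIntegral_congr_fun hm e, integral_const_mul, kirchhoff,
      intervalIntegral.integral_of_le Real.two_pi_pos.le, integral_integral_swap]
    exact h.swap

end

/-- The plane integrals are controlled only on some planes near each end. As the primitive of an
integrable function is continuous, these determine the whole integral. -/
lemma setIntegral_Ioo_eq_of_approx {S : ℝ → ℂ} {a e : ℝ} {T : ℂ} (hae : a < e)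
    (hS : IntegrableOn S (Set.Ioo a e))
    (h : ∀ ε > 0, ∃ x ∈ Set.Icc a e, ∃ y ∈ Set.Icc a e, x < a + ε ∧ e - ε < y ∧
      ‖(∫ t in x..y, S t) - T‖ < ε) : ∫ t in Set.Ioo a e, S t = T := by
  have hi : IntegrableOn S (Set.uIcc a e) := by
    rw [Set.uIcc_of_le hae.le, integrableOn_Icc_iff_integrableOn_Ioo]; exact hS
  have hP := intervalIntegral.continuousOn_primitive_interval hi
  rw [Set.uIcc_of_le hae.le] at hP
  set P : ℝ → ℂ := fun x => ∫ t in a..x, S t with hPdef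
  have hpos : ∀ n : ℕ, (0 : ℝ) < 1 / ((n : ℝ) + 1) := fun n => by positivity
  choose x hx y hy hxa hye hT using fun n : ℕ => h (1 / ((n : ℝ) + 1)) (hpos n)
  have h0 := tendsto_one_div_add_atTop_nhds_zero_nat (𝕜 := ℝ)
  have tx : Tendsto x atTop (𝓝 a) :=
    tendsto_of_tendsto_of_tendsto_of_le_of_le tendsto_const_nhds (by simpa using h0.const_add a)
      (fun n => (hx n).1) fun n => (hxa n).le
  have ty : Tendsto y atTop (𝓝 e) :=
    tendsto_of_tendsto_of_tendsto_of_le_of_le (by simpa using h0.const_sub e) tendsto_const_nhds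
      (fun n => (hye n).le) fun n => (hy n).2
  have tPx : Tendsto (fun n => P (x n)) atTop (𝓝 (P a)) :=
    (hP a (Set.left_mem_Icc.2 hae.le)).tendsto.comp
      (tendsto_nhdsWithin_iff.2 ⟨tx, Eventually.of_forall hx⟩)
  have tPy : Tendsto (fun n => P (y n)) atTop (𝓝 (P e)) :=
    (hP e (Set.right_mem_Icc.2 hae.le)).tendsto.comp
      (tendsto_nhdsWithin_iff.2 ⟨ty, Eventually.of_forall hy⟩)
  have hii : ∀ z ∈ Set.Icc a e, IntervalIntegrable S volume a z := fun z hz =>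
    (hi.mono_set (Set.uIcc_subset_uIcc_left (by rwa [Set.uIcc_of_le hae.le]))).intervalIntegrable
  have e1 : ∀ n, ∫ t in x n..y n, S t = P (y n) - P (x n) := fun n =>
    (intervalIntegral.integral_interval_sub_left (hii _ (hy n)) (hii _ (hx n))).symm
  have t1 : Tendsto (fun n => ∫ t in x n..y n, S t) atTop (𝓝 (P e - P a)) := by
    simp_rw [e1]; exact tPy.sub tPx
  have t2 : Tendsto (fun n => ∫ t in x n..y n, S t) atTop (𝓝 T) := by
    rw [tendsto_iff_norm_sub_tendsto_zero]
    exact squeeze_zero (fun _ => norm_nonneg _) (fun n => (hT n).le) h0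
  have h3 := tendsto_nhds_unique t1 t2
  simp only [hPdef, intervalIntegral.integral_same, sub_zero] at h3
  rw [← h3, intervalIntegral.integral_of_le hae.le, integral_Ioc_eq_integral_Ioo]

/-! ### Kirchhoff's formula -/

section

variable {k : ℂ} {θ : ℝ} {f : ℝ → ℝ} {X₁ : ℝ} {X₂ : EReal} {u : ℝ → Plane → ℂ}

lemma continuous_uIn (k : ℂ) (θ : ℝ) : Continuous fun p : ℝ × Plane => uIn k θ p.1 p.2 := by
  unfold uIn; fun_prop

/-- Continuity of `u` outside the body carries the initial condition into the plane `x = X₁`. -/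
lemma IsTotalField.eq_uIn_of_le (hf : IsProfile f X₁ X₂) (hu : IsTotalField k θ f X₁ X₂ u) {x : ℝ}
    (hx : x ≤ X₁) {y : Plane} (h : (x, y) ∈ exterior f X₁ X₂) : u x y = uIn k θ x y := by
  have h1 : ContinuousAt (fun p : ℝ × Plane => u p.1 p.2) (x, y) :=
    hu.continuousOn_ext.continuousAt ((isOpen_exterior hf).mem_nhds h)
  have t0 : Tendsto (fun z : ℝ => (z, y)) (𝓝[<] x) (𝓝 (x, y)) :=
    (Continuous.tendsto (by fun_prop) x).mono_left nhdsWithin_le_nhds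
  have t1 := h1.tendsto.comp t0
  have t2 := ((continuous_uIn k θ).tendsto (x, y)).comp t0
  refine tendsto_nhds_unique t1 (t2.congr' ?_)
  filter_upwards [self_mem_nhdsWithin] with z hz
  exact (sub_eq_zero.1 (hu.initial z (lt_of_lt_of_le hz hx) y)).symm

/-- The plane integral behind a point of the axis reproduces the field. -/
lemma IsTotalField.exists_planeIntegral_close (hf : IsProfile f X₁ X₂)
    (hu : IsTotalField k θ f X₁ X₂ u) (hk : 0 < k.im) (hdec : ScatteredDecays k θ f X₁ X₂ u)
    {xs e : ℝ} {ys : Plane} (h : (xs, ys) ∈ exterior f X₁ X₂)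
    (he : (e = xs) ∨ ((e : EReal) = X₂ ∧ e < xs)) {ε : ℝ} (hε : 0 < ε) :
    ∃ x ∈ Set.Ioo (e - ε) e, ‖planeIntegral k f X₁ X₂ u xs ys x - u xs ys‖ < ε := by
  rcases he with rfl | ⟨he, hlt⟩
  · exact hu.approx_identity hf hk hdec h hε
  -- Cross the rear tip from `x` to `x'`, then propagate freely from `x'` to a plane `z` just in
  -- front of the observation point.
  obtain ⟨x, hx, x', hx', h1⟩ := hu.tip_crossing hf hk hdec (Or.inr he) hlt ys
    (ε := min (ε / 2) (xs - e)) (lt_min (by linarith) (by linarith))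
  have hx1 := hx.1
  have hx2 := hx'.2
  have hm1 := min_le_left (ε / 2) (xs - e)
  have hm2 := min_le_right (ε / 2) (xs - e)
  obtain ⟨z, hz, h2⟩ := hu.approx_identity hf hk hdec h (ε := min (ε / 2) (xs - x'))
    (lt_min (by linarith) (by linarith))
  have hz1 := hz.1
  have hm3 := min_le_left (ε / 2) (xs - x')
  have hm4 := min_le_right (ε / 2) (xs - x')
  have h3 := hu.planeIntegral_const hf hk hdec (J := Set.Ioo e xs) (xs := xs) (a := x') (b := z)
    isOpen_Ioo (fun t ht => ht.2)
    (fun t ht y _ h5 => absurd h5 (by rw [← he, EReal.coe_le_coe_iff]; exact not_le.2 ht.1)) ys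
    (by linarith) (fun t ht => ⟨hx'.1.trans_le ht.1, ht.2.trans_lt hz.2⟩)
  refine ⟨x, ⟨by linarith, hx.2⟩, ?_⟩
  rw [h3] at h2
  have h4 := norm_sub_le_norm_sub_add_norm_sub (planeIntegral k f X₁ X₂ u xs ys x)
    (planeIntegral k f X₁ X₂ u xs ys x') (u xs ys)
  rw [norm_sub_rev] at h1
  linarith

/-- Kirchhoff's formula for an absorbing medium. -/
theorem IsTotalField.eq_kirchhoff (hf : IsProfile f X₁ X₂) (hu : IsTotalField k θ f X₁ X₂ u)
    (hk : 0 < k.im) (hdec : ScatteredDecays k θ f X₁ X₂ u) {xs rs φs : ℝ} (hrs : 0 ≤ rs)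
    (h : (xs, pol rs φs) ∈ exterior f X₁ X₂) :
    u xs (pol rs φs) = kirchhoff k f X₁ X₂ u xs rs φs + uIn k θ xs (pol rs φs) := by
  obtain ⟨M, hM⟩ := exists_barNGreen_bound hf hk hrs h
  obtain ⟨hSi, hK⟩ := kirchhoff_eq (hu.integrableOn_kirchhoff hf hM)
  rcases le_or_gt xs X₁ with hle | hlt
  · have : axisUpTo X₁ X₂ xs = ∅ :=
      Set.eq_empty_of_forall_notMem fun x hx => absurd (hx.1.trans hx.2.2) (not_lt.2 hle)
    rw [hK, this, setIntegral_empty, zero_add]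
    exact hu.eq_uIn_of_le hf hle h
  -- `e` is the smaller of `xs` and `X₂`: the integration stops at the observation plane or at the
  -- rear tip.
  obtain ⟨e, hae, hax, he⟩ : ∃ e : ℝ, X₁ < e ∧ axisUpTo X₁ X₂ xs = Set.Ioo X₁ e ∧
      (e = xs ∨ ((e : EReal) = X₂ ∧ e < xs)) := by
    rcases le_or_gt (xs : EReal) X₂ with h2 | h2
    · refine ⟨xs, hlt, ?_, Or.inl rfl⟩
      ext x
      exact ⟨fun hx => ⟨hx.1, hx.2.2⟩, fun hx =>
        ⟨hx.1, (EReal.coe_lt_coe_iff.2 hx.2).trans_le h2, hx.2⟩⟩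
    · have hb : ((X₂.toReal : ℝ) : EReal) = X₂ :=
        EReal.coe_toReal h2.ne_top (ne_bot_of_gt hf.lt)
      have hb1 : X₁ < X₂.toReal := EReal.coe_lt_coe_iff.1 (by rw [hb]; exact hf.lt)
      have hb2 : X₂.toReal < xs := EReal.coe_lt_coe_iff.1 (by rw [hb]; exact h2)
      refine ⟨X₂.toReal, hb1, ?_, Or.inr ⟨hb, hb2⟩⟩
      ext x
      refine ⟨fun hx => ⟨hx.1, EReal.coe_lt_coe_iff.1 (by rw [hb]; exact hx.2.1)⟩, fun hx =>
        ⟨hx.1, ?_, hx.2.trans hb2⟩⟩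
      rw [← hb]
      exact EReal.coe_lt_coe_iff.2 hx.2
  rw [hK]
  rw [← sub_eq_iff_eq_add]
  rw [hax] at hSi ⊢
  refine (setIntegral_Ioo_eq_of_approx hae hSi fun ε hε => ?_).symm
  -- The second entry keeps the plane behind the front tip from passing the plane near `e`.
  have hlt' : 0 < min (ε / 2) ((e - X₁) / 2) := lt_min (by linarith) (by linarith)
  have hm1 := min_le_left (ε / 2) ((e - X₁) / 2)
  have hm2 := min_le_right (ε / 2) ((e - X₁) / 2)
  obtain ⟨z, hz, x, hx, h1⟩ := hu.tip_crossing hf hk hdec (Or.inl rfl) hlt (pol rs φs) hlt'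
  obtain ⟨y, hy, h2⟩ := hu.exists_planeIntegral_close hf hk hdec h he hlt'
  rw [hu.planeIntegral_front hk (hz.2.trans hlt) hz.2] at h1
  have hx2 := hx.2
  have hy1 := hy.1
  have hxy : x ≤ y := by linarith
  have h3 := hu.surface_identity hf hk hdec hxy (xs := xs)
    (by rw [hax]; exact fun t ht => ⟨hx.1.trans_le ht.1, ht.2.trans_lt hy.2⟩) (pol rs φs)
  refine ⟨x, ⟨hx.1.le, hxy.trans hy.2.le⟩, y, ⟨hx.1.le.trans hxy, hy.2.le⟩, by linarith,
    by linarith, ?_⟩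
  rw [← h3]
  have h4 : planeIntegral k f X₁ X₂ u xs (pol rs φs) y - planeIntegral k f X₁ X₂ u xs (pol rs φs) x -
      (u xs (pol rs φs) - uIn k θ xs (pol rs φs)) =
      (planeIntegral k f X₁ X₂ u xs (pol rs φs) y - u xs (pol rs φs)) -
      (planeIntegral k f X₁ X₂ u xs (pol rs φs) x - uIn k θ xs (pol rs φs)) := by ring
  rw [h4]
  refine (norm_sub_le _ _).trans_lt ?_
  linarith

/-- Kirchhoff's formula in the limit of vanishing absorption. -/
theorem IsAbsorptionLimit.tendsto_kirchhoff (hf : IsProfile f X₁ X₂) (hk : 0 ≤ k.im)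
    {v : ℝ → ℝ → Plane → ℂ} (hv : IsAbsorptionLimit k θ f X₁ X₂ v u) {xs rs φs : ℝ} (hrs : 0 ≤ rs)
    (h : (xs, pol rs φs) ∈ exterior f X₁ X₂) :
    Tendsto (fun ε : ℝ => kirchhoff (k + Complex.I * ε) f X₁ X₂ (v ε) xs rs φs +
      uIn k θ xs (pol rs φs)) (𝓝[>] 0) (𝓝 (u xs (pol rs φs))) := by
  have h1 : Tendsto (fun ε : ℝ => v ε xs (pol rs φs)) (𝓝[>] 0) (𝓝 (u xs (pol rs φs))) :=
    (hv.2 ‖(xs, pol rs φs)‖).tendsto_at (x := (xs, pol rs φs)) ⟨Or.inl h, by simp⟩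
  have h2 : Tendsto (fun ε : ℝ => uIn (k + Complex.I * ε) θ xs (pol rs φs)) (𝓝[>] 0)
      (𝓝 (uIn k θ xs (pol rs φs))) := by
    have : Continuous fun ε : ℝ => uIn (k + Complex.I * ε) θ xs (pol rs φs) := by
      unfold uIn; fun_prop
    simpa using (this.tendsto 0).mono_left nhdsWithin_le_nhds
  have h3 := (h1.sub h2).add_const (uIn k θ xs (pol rs φs))
  rw [sub_add_cancel] at h3
  -- For each `ε` the integral is the scattered part of `v ε`, by the formula for absorbing media;
  -- the convergence needed is that of the fields, not of the integrals.
  refine h3.congr' ?_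
  filter_upwards [hv.1, self_mem_nhdsWithin] with ε hε hε0
  have hk' : 0 < (k + Complex.I * (ε : ℝ)).im := by
    have : 0 < ε := hε0
    simp; linarith
  rw [hε.1.eq_kirchhoff hf hk' hε.2 hrs h]
  ring

end

/-! ### The field behind a finite body, with or without absorption -/

lemma restrict_Ioo_prod (a b : ℝ) (t : Set ℝ) :
    (volume : Measure (ℝ × ℝ)).restrict (Set.Ioo a b ×ˢ t) =
      (volume : Measure (ℝ × ℝ)).restrict (Set.Ioc a b ×ˢ t) := by
  rw [Measure.volume_eq_prod, ← Measure.prod_restrict, ← Measure.prod_restrict,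
    restrict_Ioo_eq_restrict_Ioc]

lemma integral_iterated_eq {g : ℝ × ℝ → ℂ} {a b c d : ℝ} (hab : a ≤ b) (hcd : c ≤ d)
    (hg : IntegrableOn g (Set.Ioo a b ×ˢ Set.Ioc c d)) :
    ∫ φ in c..d, ∫ x in a..b, g (x, φ) = ∫ q in Set.Ioo a b ×ˢ Set.Ioc c d, g q := by
  rw [IntegrableOn, Measure.volume_eq_prod, ← Measure.prod_restrict] at hg
  rw [Measure.volume_eq_prod, ← Measure.prod_restrict, integral_prod _ hg,
    intervalIntegral.integral_of_le hcd]
  have h : ∀ φ, ∫ x in a..b, g (x, φ) = ∫ x in Set.Ioo a b, g (x, φ) := fun φ => by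
    rw [intervalIntegral.integral_of_le hab, integral_Ioc_eq_integral_Ioo]
  simp_rw [h]
  exact (integral_integral_swap (f := fun x φ => g (x, φ)) hg).symm

section

variable {k : ℂ} {θ : ℝ} {f : ℝ → ℝ} {X₁ b : ℝ} {u : ℝ → Plane → ℂ}

lemma axisUpTo_of_lt {xs : ℝ} (hb : b < xs) : axisUpTo X₁ (b : EReal) xs = Set.Ioo X₁ b := by
  ext x
  exact ⟨fun h => ⟨h.1, EReal.coe_lt_coe_iff.1 h.2.1⟩, fun h =>
    ⟨h.1, EReal.coe_lt_coe_iff.2 h.2, h.2.trans hb⟩⟩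

lemma mem_exterior_of_lt {xs : ℝ} (hb : b < xs) (y : Plane) : (xs, y) ∈ exterior f X₁ (b : EReal) :=
  fun _ h => absurd (EReal.coe_le_coe_iff.1 h) (not_le.2 hb)

lemma IsProfile.lt_rear (hf : IsProfile f X₁ (b : EReal)) : X₁ < b := EReal.coe_lt_coe_iff.1 hf.lt

lemma IsTotalField.integrableOn_kirchhoff_behind (hf : IsProfile f X₁ (b : EReal)) (hk : 0 ≤ k.im)
    (hu : IsTotalField k θ f X₁ (b : EReal) u) {xs : ℝ} (hb : b < xs) (rs φs : ℝ) :
    IntegrableOn (fun q : ℝ × ℝ => kirchhoffIntegrand k f u xs rs φs q.1 q.2)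
      (Set.Ioo X₁ b ×ˢ Set.Ioc 0 (2 * Real.pi)) := by
  obtain ⟨M, hM⟩ := exists_barNGreen_bound_of_le hf (xs := xs) (sub_pos.2 hb) rs φs ‖k‖
  rw [← axisUpTo_of_lt hb]
  exact hu.integrableOn_kirchhoff hf fun x hx => hM k hk le_rfl x hx
    (by rw [axisUpTo_of_lt hb] at hx; linarith [hx.2])

lemma IsTotalField.kirchhoff_behind (hf : IsProfile f X₁ (b : EReal)) (hk : 0 ≤ k.im)
    (hu : IsTotalField k θ f X₁ (b : EReal) u) {xs : ℝ} (hb : b < xs) (rs φs : ℝ) :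
    kirchhoff k f X₁ b u xs rs φs = Complex.I / (2 * k) *
      ∫ q in Set.Ioo X₁ b ×ˢ Set.Ioc 0 (2 * Real.pi),
        kirchhoffIntegrand k f u xs rs φs q.1 q.2 := by
  rw [← integral_iterated_eq hf.lt_rear.le Real.two_pi_pos.le
    (hu.integrableOn_kirchhoff_behind hf hk hb rs φs), kirchhoff, axisUpTo_of_lt hb]
  simp_rw [intervalIntegral.integral_of_le hf.lt_rear.le, integral_Ioc_eq_integral_Ioo]

/-- Behind a finite body the integral depends continuously on a vanishing absorption. -/
lemma IsAbsorptionLimit.tendsto_kirchhoff_behind (hf : IsProfile f X₁ (b : EReal)) (hk : k ≠ 0)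
    (hkim : 0 ≤ k.im) (hu : IsTotalField k θ f X₁ (b : EReal) u) {v : ℝ → ℝ → Plane → ℂ}
    (hv : IsAbsorptionLimit k θ f X₁ (b : EReal) v u) {xs : ℝ} (hb : b < xs) (rs φs : ℝ) :
    Tendsto (fun ε : ℝ => kirchhoff (k + Complex.I * ε) f X₁ b (v ε) xs rs φs) (𝓝[>] 0)
      (𝓝 (kirchhoff k f X₁ b u xs rs φs)) := by
  have hkε : Tendsto (fun ε : ℝ => k + Complex.I * (ε : ℂ)) (𝓝[>] 0) (𝓝 k) := by
    have : Continuous fun ε : ℝ => k + Complex.I * (ε : ℂ) := by fun_prop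
    simpa using (this.tendsto 0).mono_left nhdsWithin_le_nhds
  have him : ∀ ε : ℝ, 0 < ε → 0 ≤ (k + Complex.I * (ε : ℂ)).im := fun ε hε => by
    simp; linarith
  obtain ⟨M, hM⟩ := exists_barNGreen_bound_of_le hf (xs := xs) (sub_pos.2 hb) rs φs (‖k‖ + 1)
  obtain ⟨R, hR0, hR⟩ := exists_profile_bound hf xs
  have hax := axisUpTo_of_lt (X₁ := X₁) hb
  set P : Set (ℝ × ℝ) := Set.Ioo X₁ b ×ˢ Set.Ioc 0 (2 * Real.pi) with hP
  have hPm : MeasurableSet P := measurableSet_Ioo.prod measurableSet_Ioc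
  have hsurf : ∀ q ∈ P, (q.1, pol (f q.1) q.2) ∈
      (exterior f X₁ (b : EReal) ∪ surface f X₁ (b : EReal)) ∩
        Metric.closedBall 0 (max (max |X₁| |b|) R) := by
    intro q hq
    have hq1 : q.1 ∈ axisUpTo X₁ (b : EReal) xs := hax ▸ hq.1
    have h0 := hf.pos q.1 hq1.1 hq1.2.1
    refine ⟨Or.inr (mem_surface_pol q.2 hq1.1 hq1.2.1 h0.le), ?_⟩
    rw [mem_closedBall_zero_iff, Prod.norm_def]
    refine max_le ((abs_le_max_abs_abs hq.1.1.le hq.1.2.le).trans (le_max_left _ _)) ?_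
    rw [norm_pol, abs_of_pos h0]
    exact (hR _ hq1).trans (le_max_right _ _)
  have hunif := hv.2 (max (max |X₁| |b|) R)
  -- On the surface `‖v ε‖ ≤ ‖u‖ + 1` eventually, by uniform convergence, and the kernel is bounded
  -- by `M` uniformly in `ε`. This gives a majorant that does not depend on `ε`.
  have hdom : Integrable (fun q : ℝ × ℝ => |M| * (‖surfaceField f u q.1 q.2 * (f q.1 : ℂ)‖ + R))
      (volume.restrict P) := by
    have h1 := hu.integrableOn_surface hf xs
    rw [hax] at h1
    refine (h1.norm.add (integrableOn_const ?_)).const_mul _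
    rw [Measure.volume_eq_prod, Measure.prod_prod]
    exact (ENNReal.mul_lt_top measure_Ioo_lt_top measure_Ioc_lt_top).ne
  have hlim : Tendsto (fun ε : ℝ => ∫ q in P,
      kirchhoffIntegrand (k + Complex.I * ε) f (v ε) xs rs φs q.1 q.2) (𝓝[>] 0)
      (𝓝 (∫ q in P, kirchhoffIntegrand k f u xs rs φs q.1 q.2)) := by
    refine tendsto_integral_filter_of_dominated_convergence _ ?_ ?_ hdom ?_
    · filter_upwards [hv.1, self_mem_nhdsWithin] with ε hε hε0
      exact (hε.1.integrableOn_kirchhoff_behind hf (him ε hε0) hb rs φs).aestronglyMeasurable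
    · filter_upwards [Metric.tendstoUniformlyOn_iff.1 hunif 1 one_pos, self_mem_nhdsWithin,
        hkε.norm.eventually (Iio_mem_nhds (lt_add_one ‖k‖))] with ε hε hε0 hkn
      rw [ae_restrict_iff' hPm]
      refine Eventually.of_forall fun q hq => ?_
      have hq1 : q.1 ∈ axisUpTo X₁ (b : EReal) xs := hax ▸ hq.1
      have h0 := hf.pos q.1 hq1.1 hq1.2.1
      have hN := (hM _ (him ε hε0) (le_of_lt hkn) q.1 hq1 (by linarith [hq.1.2]) q.2).trans
        (le_abs_self M)
      have hU : ‖surfaceField f (v ε) q.1 q.2‖ ≤ ‖surfaceField f u q.1 q.2‖ + 1 := by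
        have h1 := hε _ (hsurf q hq)
        rw [dist_comm, dist_eq_norm] at h1
        have h2 := norm_sub_norm_le (surfaceField f (v ε) q.1 q.2) (surfaceField f u q.1 q.2)
        have h3 : ‖surfaceField f (v ε) q.1 q.2 - surfaceField f u q.1 q.2‖ < 1 := h1
        linarith
      rw [kirchhoffIntegrand, mul_assoc, norm_mul, norm_mul, norm_mul, Complex.norm_real,
        Real.norm_of_nonneg h0.le]
      gcongr
      nlinarith [hR _ hq1]
    · rw [ae_restrict_iff' hPm]
      refine Eventually.of_forall fun q hq => ?_
      have hqxs : q.1 < xs := hq.1.2.trans hb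
      have h1 : Tendsto (fun ε : ℝ => surfaceField f (v ε) q.1 q.2) (𝓝[>] 0)
          (𝓝 (surfaceField f u q.1 q.2)) := hunif.tendsto_at (hsurf q hq)
      have h2 : Continuous fun κ : ℂ => barNGreen κ f xs rs φs q.1 q.2 := by
        simp_rw [barNGreen_eq _ f hqxs]
        unfold kernel
        fun_prop
      exact (((h2.tendsto k).comp hkε).mul h1).mul_const _
  have hcoef : Tendsto (fun ε : ℝ => Complex.I / (2 * (k + Complex.I * (ε : ℂ)))) (𝓝[>] 0)
      (𝓝 (Complex.I / (2 * k))) :=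
    tendsto_const_nhds.div (hkε.const_mul 2) (mul_ne_zero two_ne_zero hk)
  rw [hu.kirchhoff_behind hf hkim hb rs φs]
  refine (hcoef.mul hlim).congr' ?_
  filter_upwards [hv.1, self_mem_nhdsWithin] with ε hε hε0
  rw [hε.1.kirchhoff_behind hf (him ε hε0) hb rs φs]

/-- Kirchhoff's formula behind a finite body. -/
theorem IsTotalField.eq_kirchhoff_behind (hf : IsProfile f X₁ (b : EReal)) (hk : k ≠ 0)
    (hu : IsTotalField k θ f X₁ (b : EReal) u) (hrad : Radiates k θ f X₁ (b : EReal) u)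
    {xs rs φs : ℝ} (hb : b < xs) (hrs : 0 ≤ rs) :
    u xs (pol rs φs) - uIn k θ xs (pol rs φs) = kirchhoff k f X₁ b u xs rs φs := by
  have hE := mem_exterior_of_lt (f := f) (X₁ := X₁) hb (pol rs φs)
  rcases hrad with ⟨him, hdec⟩ | ⟨him, v, hv⟩
  · rw [hu.eq_kirchhoff hf him hdec hrs hE]
    ring
  -- The integrals for `k + i ε` converge both to the scattered field and to the integral for `k`.
  · have h1 := hv.tendsto_kirchhoff hf him.ge hrs hE
    have h2 := (hv.tendsto_kirchhoff_behind hf hk him.ge hu hb rs φs).add_const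
      (uIn k θ xs (pol rs φs))
    rw [tendsto_nhds_unique h1 h2]
    ring

end

/-! ### The far field -/

lemma kernel_eq_farAmplitude (k : ℂ) {x L : ℝ} (hL : L ≠ 0) (hx : x < L) (θs φs r φ : ℝ) :
    kernel k L (pol (L * θs) φs) x (pol r φ) = farAmplitude k θs L *
      Complex.exp (Complex.I * k *
        ((-θs * r * Real.cos (φs - φ) + x * θs ^ 2 / 2 : ℝ) : ℂ)) *
      ((1 + x / (L - x) : ℝ) : ℂ) * Complex.exp (Complex.I * k *
        (((r ^ 2 + x * (θs ^ 2 * x - 2 * θs * r * Real.cos (φs - φ))) / 2 / (L - x) : ℝ) : ℂ)) := by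
  have hs : L - x ≠ 0 := (sub_pos.2 hx).ne'
  have hs' : (L : ℂ) - x ≠ 0 := by exact_mod_cast hs
  have hL' : (L : ℂ) ≠ 0 := by exact_mod_cast hL
  -- By `L² / (L - x) = L + x + x² / (L - x)` and `L / (L - x) = 1 + x / (L - x)` the exponent
  -- splits exactly into the phase of the amplitude, the phase of the directivity and a remainder of
  -- order `1 / (L - x)`.
  have e1 : Complex.exp (Complex.I * k / (2 * ((L - x : ℝ) : ℂ)) *
        (((L * θs) ^ 2 + r ^ 2 - 2 * (L * θs) * r * Real.cos (φs - φ) : ℝ) : ℂ)) =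
      Complex.exp (Complex.I * k * ((L * θs ^ 2 / 2 : ℝ) : ℂ)) * Complex.exp (Complex.I * k *
        ((-θs * r * Real.cos (φs - φ) + x * θs ^ 2 / 2 : ℝ) : ℂ)) * Complex.exp (Complex.I * k *
        (((r ^ 2 + x * (θs ^ 2 * x - 2 * θs * r * Real.cos (φs - φ))) / 2 / (L - x) : ℝ) : ℂ)) := by
    rw [← Complex.exp_add, ← Complex.exp_add]
    congr 1
    push_cast
    field_simp
    ring
  have e2 : k / (2 * Real.pi * Complex.I * ((L - x : ℝ) : ℂ)) =
      k / (2 * Real.pi * Complex.I * (L : ℂ)) * ((1 + x / (L - x) : ℝ) : ℂ) := by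
    have hpi : (Real.pi : ℂ) ≠ 0 := by exact_mod_cast Real.pi_ne_zero
    push_cast
    field_simp
    ring
  rw [kernel, norm_sq_pol_sub_pol, e1, e2, farAmplitude]
  ring

/-- The expansion of a product of three factors close to `1`, `1` and `a`. -/
lemma norm_expansion_le {x s X : ℝ} {w a b : ℂ} {W A B : ℝ} (hs : 0 ≤ s) (hs1 : s ≤ 1)
    (hx : |x| ≤ X) (hw : ‖w‖ ≤ W * s) (ha : ‖a‖ ≤ A) (hb : ‖b‖ ≤ B) (hW : 0 ≤ W) :
    ‖((1 + x * s : ℝ) : ℂ) * (1 + w) * (a - b * s) - a‖ ≤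
      ((1 + X) * (1 + W) * B + A * (X + W + X * W)) * s := by
  have hX : 0 ≤ X := (abs_nonneg x).trans hx
  have hA : 0 ≤ A := (norm_nonneg a).trans ha
  have hB : 0 ≤ B := (norm_nonneg b).trans hb
  have h1 : ‖((1 + x * s : ℝ) : ℂ)‖ ≤ 1 + X := by
    rw [Complex.norm_real, Real.norm_eq_abs]
    refine (abs_add_le _ _).trans ?_
    rw [abs_one, abs_mul, abs_of_nonneg hs]
    have := mul_le_of_le_one_right (abs_nonneg x) hs1
    linarith
  have h2 : ‖1 + w‖ ≤ 1 + W := by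
    refine (norm_add_le _ _).trans ?_
    rw [norm_one]
    have := mul_le_of_le_one_right hW hs1
    linarith
  have hsn : ‖(s : ℂ)‖ = s := by rw [Complex.norm_real, Real.norm_of_nonneg hs]
  have hxs : ‖((x * s : ℝ) : ℂ)‖ ≤ X * s := by
    rw [Complex.norm_real, Real.norm_eq_abs, abs_mul, abs_of_nonneg hs]
    gcongr
  have e : ((1 + x * s : ℝ) : ℂ) * (1 + w) * (a - b * s) - a =
      -(((1 + x * s : ℝ) : ℂ) * (1 + w) * (b * s)) +
        a * (((x * s : ℝ) : ℂ) + w + ((x * s : ℝ) : ℂ) * w) := by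
    push_cast; ring
  have h3 : ‖((x * s : ℝ) : ℂ) * w‖ ≤ X * W * s := by
    rw [norm_mul]
    calc _ ≤ (X * s) * (W * s) := by gcongr
      _ = X * W * s * s := by ring
      _ ≤ _ := mul_le_of_le_one_right (by positivity) hs1
  rw [e]
  refine (norm_add_le _ _).trans ?_
  rw [norm_neg, norm_mul, norm_mul, norm_mul, hsn, norm_mul]
  have h4 : ‖((x * s : ℝ) : ℂ) + w + ((x * s : ℝ) : ℂ) * w‖ ≤ X * s + W * s + X * W * s :=
    (norm_add_le _ _).trans (add_le_add ((norm_add_le _ _).trans (add_le_add hxs hw)) h3)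
  calc _ ≤ (1 + X) * (1 + W) * (B * s) + A * (X * s + W * s + X * W * s) := by gcongr
    _ = _ := by ring

section

variable {k : ℂ} {θ : ℝ} {f : ℝ → ℝ} {X₁ b : ℝ} {u : ℝ → Plane → ℂ}

/-- The part of the integrand of the directivity that does not depend on the field. -/
noncomputable def directivityKernel (k : ℂ) (f : ℝ → ℝ) (θs φs x φ : ℝ) : ℂ :=
  Complex.exp (Complex.I * k * ((-θs * f x * Real.cos (φs - φ) + x * θs ^ 2 / 2 : ℝ) : ℂ)) *
    ((θs * Real.cos (φs - φ) - deriv f x : ℝ) : ℂ)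

lemma directivityIntegrand_eq (k : ℂ) (f : ℝ → ℝ) (u : ℝ → Plane → ℂ) (θs φs x φ : ℝ) :
    directivityIntegrand k f u θs φs x φ =
      directivityKernel k f θs φs x φ * (surfaceField f u x φ * (f x : ℂ)) := by
  rw [directivityIntegrand, directivityKernel, ← Real.cos_neg (φ - φs), neg_sub]
  ring

lemma norm_directivityKernel_le {x R C X : ℝ} (hR : |f x| ≤ R) (hC : |deriv f x| ≤ C)
    (hx : |x| ≤ X) (k : ℂ) (θs φs φ : ℝ) :
    ‖Complex.exp (Complex.I * k *
      ((-θs * f x * Real.cos (φs - φ) + x * θs ^ 2 / 2 : ℝ) : ℂ))‖ ≤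
        Real.exp (‖k‖ * (|θs| * R + X * θs ^ 2)) ∧
      ‖((θs * Real.cos (φs - φ) - deriv f x : ℝ) : ℂ)‖ ≤ |θs| + C := by
  have hR0 : 0 ≤ R := (abs_nonneg _).trans hR
  have hX0 : 0 ≤ X := (abs_nonneg _).trans hx
  constructor
  · rw [Complex.norm_exp]
    refine Real.exp_le_exp.2 ((Complex.re_le_norm _).trans ?_)
    rw [norm_mul, norm_mul, Complex.norm_I, one_mul, Complex.norm_real, Real.norm_eq_abs]
    refine mul_le_mul_of_nonneg_left ((abs_add_le _ _).trans (add_le_add ?_ ?_)) (norm_nonneg _)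
    · rw [abs_mul, abs_mul, abs_neg]
      calc _ ≤ |θs| * R * 1 := by gcongr; exact Real.abs_cos_le_one _
        _ = _ := mul_one _
    · rw [abs_div, abs_mul, abs_of_nonneg (sq_nonneg θs), abs_two]
      have : 0 ≤ |x| * θs ^ 2 := by positivity
      calc |x| * θs ^ 2 / 2 ≤ |x| * θs ^ 2 := by linarith
        _ ≤ _ := by gcongr
  · rw [Complex.norm_real, Real.norm_eq_abs]
    refine (abs_sub _ _).trans (add_le_add ?_ hC)
    rw [abs_mul]
    exact mul_le_of_le_one_right (abs_nonneg _) (Real.abs_cos_le_one _)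

lemma exists_profile_bounds (hf : IsProfile f X₁ (b : EReal)) :
    ∃ R C : ℝ, ∀ x ∈ Set.Ioo X₁ b, |f x| ≤ R ∧ |deriv f x| ≤ C := by
  obtain ⟨R, hR0, hR⟩ := exists_profile_bound hf (b + 1)
  obtain ⟨C, hC⟩ := hf.slope
  refine ⟨R, C, fun x hx => ?_⟩
  have hx' : x ∈ axisUpTo X₁ (b : EReal) (b + 1) := by rwa [axisUpTo_of_lt (lt_add_one b)]
  refine ⟨?_, hC x hx'.1 hx'.2.1⟩
  rw [abs_of_pos (hf.pos x hx'.1 hx'.2.1)]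
  exact hR x hx'

/-- Over a finite body the kernel of the directivity is bounded, and the field is integrable over
the surface. -/
lemma IsTotalField.integrableOn_directivity (hf : IsProfile f X₁ (b : EReal))
    (hu : IsTotalField k θ f X₁ (b : EReal) u) (θs φs : ℝ) :
    IntegrableOn (fun q : ℝ × ℝ => directivityIntegrand k f u θs φs q.1 q.2)
      (Set.Ioo X₁ b ×ˢ Set.Ioc 0 (2 * Real.pi)) := by
  obtain ⟨R, C, hRC⟩ := exists_profile_bounds hf
  have hUi := hu.integrableOn_surface hf (b + 1)
  rw [axisUpTo_of_lt (lt_add_one b)] at hUi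
  have hm : MeasurableSet (Set.Ioo X₁ b ×ˢ Set.Ioc 0 (2 * Real.pi)) :=
    measurableSet_Ioo.prod measurableSet_Ioc
  have hmaps : Set.MapsTo (Prod.fst : ℝ × ℝ → ℝ) (Set.Ioo X₁ b ×ˢ Set.Ioc 0 (2 * Real.pi))
      {x : ℝ | X₁ < x ∧ (x : EReal) < (b : EReal)} := fun q hq =>
    ⟨hq.1.1, EReal.coe_lt_coe_iff.2 hq.1.2⟩
  have c1 := ContinuousOn.comp (g := f) (f := Prod.fst) (continuousOn_profile hf)
    continuousOn_fst hmaps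
  have c2 := ContinuousOn.comp (g := deriv f) (f := Prod.fst) (continuousOn_deriv_profile hf)
    continuousOn_fst hmaps
  have c3 : ContinuousOn (fun q : ℝ × ℝ => directivityKernel k f θs φs q.1 q.2)
      (Set.Ioo X₁ b ×ˢ Set.Ioc 0 (2 * Real.pi)) := by
    have c4 : Continuous fun q : ℝ × ℝ => Real.cos (φs - q.2) := by fun_prop
    refine ContinuousOn.mul (ContinuousOn.cexp (continuousOn_const.mul
      (Complex.continuous_ofReal.comp_continuousOn ?_)))
      (Complex.continuous_ofReal.comp_continuousOn ?_)
    · exact ((continuousOn_const.mul c1).mul c4.continuousOn).add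
        (by fun_prop : Continuous fun q : ℝ × ℝ => q.1 * θs ^ 2 / 2).continuousOn
    · exact (continuousOn_const.mul c4.continuousOn).sub c2
  simp_rw [directivityIntegrand_eq]
  refine Integrable.mono' (hUi.norm.const_mul
    (Real.exp (‖k‖ * (|θs| * R + max |X₁| |b| * θs ^ 2)) * (|θs| + C)))
    ((c3.aestronglyMeasurable hm).mul hUi.aestronglyMeasurable) ?_
  rw [ae_restrict_iff' hm]
  refine Eventually.of_forall fun q hq => ?_
  obtain ⟨h1, h2⟩ := norm_directivityKernel_le (hRC _ hq.1).1 (hRC _ hq.1).2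
    (abs_le_max_abs_abs hq.1.1.le hq.1.2.le) k θs φs q.2
  rw [norm_mul, directivityKernel, norm_mul]
  gcongr

/-- The kernel of Kirchhoff's formula far behind the body. -/
lemma exists_far_kernel_bound (hf : IsProfile f X₁ (b : EReal)) (hk : k ≠ 0) (θs φs : ℝ) :
    ∃ K L₀ : ℝ, 0 < L₀ ∧ b < L₀ ∧ ∀ L, L₀ ≤ L → ∀ x ∈ Set.Ioo X₁ b, ∀ φ,
      ‖Complex.I / (2 * k) * barNGreen k f L (L * θs) φs x φ -
        farAmplitude k θs L * (1 / 2 * directivityKernel k f θs φs x φ)‖ ≤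
      ‖farAmplitude k θs L / (L : ℂ)‖ * K := by
  obtain ⟨R, C, hRC⟩ := exists_profile_bounds hf
  set X := max |X₁| |b| with hX
  have hX0 : 0 ≤ X := (abs_nonneg _).trans (le_max_left _ _)
  obtain ⟨x₀, hx₀⟩ := Set.nonempty_Ioo.2 hf.lt_rear
  have hR0 : 0 ≤ R := (abs_nonneg _).trans (hRC _ hx₀).1
  have hC0 : 0 ≤ C := (abs_nonneg _).trans (hRC _ hx₀).2
  set Q := R ^ 2 + X * (θs ^ 2 * X + 2 * |θs| * R) with hQ
  have hQ0 : 0 ≤ Q := by positivity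
  set E := Real.exp (‖k‖ * (|θs| * R + X * θs ^ 2)) with hE
  set W := 2 * (‖k‖ * Q) with hW
  have hW0 : 0 ≤ W := by positivity
  set K₀ := (1 + X) * (1 + W) * (R + X * |θs|) + (|θs| + C) * (X + W + X * W) with hK₀
  have hK0 : 0 ≤ K₀ := by positivity
  -- This lower bound for `L` ensures `L - x ≥ 1`, `L - x ≥ L / 2`, and that the remaining exponent
  -- has modulus at most 1, where `‖exp z - 1‖ ≤ 2 * ‖z‖`; hence the factors 2 here and in `W`.
  refine ⟨E * (K₀ * 2), 2 * X + 1 + 2 * (‖k‖ * Q), by positivity, ?_, fun L hL x hx φ => ?_⟩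
  · have h1 : b ≤ X := (le_abs_self b).trans (le_max_right _ _)
    have : 0 ≤ ‖k‖ * Q := by positivity
    linarith
  have hkQ : 0 ≤ ‖k‖ * Q := by positivity
  obtain ⟨hfR, hfC⟩ := hRC x hx
  have hxX : |x| ≤ X := abs_le_max_abs_abs hx.1.le hx.2.le
  have hxX' : x ≤ X := (le_abs_self x).trans hxX
  have hL0 : 0 < L := by linarith
  have hxL : x < L := by linarith
  have hsL : 0 < L - x := sub_pos.2 hxL
  have hsL1 : 1 ≤ L - x := by linarith
  have hsLk : ‖k‖ * Q ≤ L - x := by linarith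
  set s : ℝ := 1 / (L - x) with hs
  have hs0 : 0 ≤ s := by positivity
  have hs1 : s ≤ 1 := by rw [hs, div_le_one hsL]; exact hsL1
  have hs2 : s ≤ 2 / L := by
    rw [hs, div_le_div_iff₀ hsL hL0]; linarith
  set c := Real.cos (φs - φ) with hc
  have hc1 : |c| ≤ 1 := Real.abs_cos_le_one _
  set q := (f x ^ 2 + x * (θs ^ 2 * x - 2 * θs * f x * c)) / 2 with hq
  have hqQ : |q| ≤ Q := by
    rw [hq, abs_div, abs_two]
    have h1 : |f x ^ 2 + x * (θs ^ 2 * x - 2 * θs * f x * c)| ≤ Q := by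
      refine (abs_add_le _ _).trans (add_le_add ?_ ?_)
      · rw [abs_pow]; gcongr
      · rw [abs_mul]
        refine mul_le_mul hxX ((abs_sub _ _).trans (add_le_add ?_ ?_)) (abs_nonneg _) hX0
        · rw [abs_mul, abs_of_nonneg (sq_nonneg θs)]; gcongr
        · rw [abs_mul, abs_mul, abs_mul, abs_two]
          calc _ ≤ 2 * |θs| * R * 1 := by gcongr
            _ = _ := mul_one _
    have := abs_nonneg (f x ^ 2 + x * (θs ^ 2 * x - 2 * θs * f x * c))
    linarith
  set w : ℂ := Complex.exp (Complex.I * k * ((q / (L - x) : ℝ) : ℂ)) - 1 with hw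
  have hwb : ‖w‖ ≤ W * s := by
    have h1 : ‖Complex.I * k * ((q / (L - x) : ℝ) : ℂ)‖ ≤ ‖k‖ * Q * s := by
      rw [norm_mul, norm_mul, Complex.norm_I, one_mul, Complex.norm_real, Real.norm_eq_abs,
        abs_div, abs_of_pos hsL, hs, mul_one_div, mul_div_assoc]
      gcongr
    have h2 : ‖k‖ * Q * s ≤ 1 := by
      rw [hs, mul_one_div, div_le_one hsL]; exact hsLk
    refine (Complex.norm_exp_sub_one_le (h1.trans h2)).trans ?_
    rw [hW]
    linarith
  obtain ⟨hE1, ha⟩ := norm_directivityKernel_le hfR hfC hxX k θs φs φ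
  have hb : ‖((f x - x * θs * c : ℝ) : ℂ)‖ ≤ R + X * |θs| := by
    rw [Complex.norm_real, Real.norm_eq_abs]
    refine (abs_sub _ _).trans (add_le_add hfR ?_)
    rw [abs_mul, abs_mul]
    calc _ ≤ X * |θs| * 1 := by gcongr
      _ = _ := mul_one _
  have hexp := norm_expansion_le hs0 hs1 hxX hwb ha hb hW0
  have hsC : (L : ℂ) - x ≠ 0 := by exact_mod_cast hsL.ne'
  have key : Complex.I / (2 * k) * barNGreen k f L (L * θs) φs x φ -
      farAmplitude k θs L * (1 / 2 * directivityKernel k f θs φs x φ) =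
      farAmplitude k θs L * (Complex.exp (Complex.I * k *
        ((-θs * f x * Real.cos (φs - φ) + x * θs ^ 2 / 2 : ℝ) : ℂ)) * (1 / 2 *
      (((1 + x * s : ℝ) : ℂ) * (1 + w) * (((θs * Real.cos (φs - φ) - deriv f x : ℝ) : ℂ) -
        ((f x - x * θs * c : ℝ) : ℂ) * s) - ((θs * Real.cos (φs - φ) - deriv f x : ℝ) : ℂ)))) := by
    -- This rests on `(f - L θ c) / (L - x) = -θ c + (f - x θ c) / (L - x)`: the leading term is the
    -- obliquity factor of the directivity.
    have h1 : Complex.I / (2 * k) * (Complex.I * k *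
        (((f x - L * θs * c) / (L - x) + deriv f x : ℝ) : ℂ)) =
        1 / 2 * (((θs * c - deriv f x : ℝ) : ℂ) - ((f x - x * θs * c : ℝ) : ℂ) * s) := by
      rw [hs]
      push_cast
      field_simp
      rw [Complex.I_sq]
      ring
    have h2 : 1 + w = Complex.exp (Complex.I * k * ((q / (L - x) : ℝ) : ℂ)) := by rw [hw]; ring
    rw [barNGreen_eq k f hxL, ← hc, mul_left_comm, h1, kernel_eq_farAmplitude k hL0.ne' hxL, ← hc,
      ← hq, h2, directivityKernel, ← hc, hs, mul_one_div]
    ring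
  have hLn : ‖(L : ℂ)‖ = L := by rw [Complex.norm_real, Real.norm_of_nonneg hL0.le]
  rw [key, norm_mul, norm_mul, norm_mul, norm_div _ (L : ℂ), hLn]
  have h3 : ‖(1 / 2 : ℂ)‖ ≤ 1 := by norm_num
  calc _ ≤ ‖farAmplitude k θs L‖ * (E * (1 * (K₀ * (2 / L)))) := by
        gcongr
        exact hexp.trans (by gcongr)
    _ = _ := by ring

/-- The far field of a finite body. -/
theorem IsTotalField.far_field (hf : IsProfile f X₁ (b : EReal)) (hk : k ≠ 0) (hkim : 0 ≤ k.im)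
    (hu : IsTotalField k θ f X₁ (b : EReal) u) (hrad : Radiates k θ f X₁ (b : EReal) u)
    {θs φs : ℝ} (hθs : 0 ≤ θs) :
    (fun L : ℝ => u L (pol (L * θs) φs) - uIn k θ L (pol (L * θs) φs) -
        farAmplitude k θs L * directivity k f X₁ b u θs φs)
      =O[atTop] (fun L : ℝ => farAmplitude k θs L / (L : ℂ)) := by
  obtain ⟨K, L₀, hL₀, hbL₀, hK⟩ := exists_far_kernel_bound hf hk θs φs
  set P : Set (ℝ × ℝ) := Set.Ioo X₁ b ×ˢ Set.Ioc 0 (2 * Real.pi) with hP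
  have hPm : MeasurableSet P := measurableSet_Ioo.prod measurableSet_Ioc
  have hUi := hu.integrableOn_surface hf (b + 1)
  rw [axisUpTo_of_lt (lt_add_one b)] at hUi
  have hdi := hu.integrableOn_directivity hf θs φs
  have hT : directivity k f X₁ b u θs φs =
      1 / 2 * ∫ q in P, directivityIntegrand k f u θs φs q.1 q.2 := by
    rw [directivity, hP, ← integral_iterated_eq hf.lt_rear.le Real.two_pi_pos.le hdi]
  -- The amplitude decays exponentially in `L` when Im k > 0 and `θs ≠ 0`, so the error is estimated
  -- relative to it throughout.
  refine Asymptotics.IsBigO.of_bound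
    (K * ∫ q in P, ‖surfaceField f u q.1 q.2 * (f q.1 : ℂ)‖) ?_
  filter_upwards [eventually_ge_atTop L₀] with L hL
  have hbL : b < L := hbL₀.trans_le hL
  have hki := hu.integrableOn_kirchhoff_behind hf hkim hbL (L * θs) φs
  rw [hu.eq_kirchhoff_behind hf hk hrad hbL (mul_nonneg (hL₀.le.trans hL) hθs),
    hu.kirchhoff_behind hf hkim hbL, hT, ← integral_const_mul, ← integral_const_mul,
    ← integral_const_mul, ← integral_sub (hki.const_mul _) ((hdi.const_mul _).const_mul _)]
  have hb : (K * ∫ q in P, ‖surfaceField f u q.1 q.2 * (f q.1 : ℂ)‖) *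
      ‖farAmplitude k θs L / (L : ℂ)‖ = ∫ q in P, ‖farAmplitude k θs L / (L : ℂ)‖ * K *
        ‖surfaceField f u q.1 q.2 * (f q.1 : ℂ)‖ := by
    rw [integral_const_mul]; ring
  rw [hb]
  refine norm_integral_le_of_norm_le (hUi.norm.const_mul _) ?_
  rw [ae_restrict_iff' hPm]
  refine Eventually.of_forall fun q hq => ?_
  have e : Complex.I / (2 * k) * kirchhoffIntegrand k f u L (L * θs) φs q.1 q.2 -
      farAmplitude k θs L * (1 / 2 * directivityIntegrand k f u θs φs q.1 q.2) =
      (Complex.I / (2 * k) * barNGreen k f L (L * θs) φs q.1 q.2 -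
        farAmplitude k θs L * (1 / 2 * directivityKernel k f θs φs q.1 q.2)) *
      (surfaceField f u q.1 q.2 * (f q.1 : ℂ)) := by
    rw [kirchhoffIntegrand, directivityIntegrand_eq]; ring
  rw [e, norm_mul]
  exact mul_le_mul_of_nonneg_right (hK L hL q.1 hq.1 q.2) (norm_nonneg _)

end

end ParabolicScattering

/-! ### The theorem -/

open ParabolicScattering in
theorem mainTheorem3 (f : ℝ → ℝ) (X₁ : ℝ) (X₂ : EReal) (hf : IsProfile f X₁ X₂)
    (k : ℂ) (hk : 0 < k.re) (θ : ℝ) (u : ℝ → Plane → ℂ)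
    (hu : IsTotalField k θ f X₁ X₂ u) (hrad : Radiates k θ f X₁ X₂ u) :
    -- reconstruction at every point outside the body, in the absorbing case
    (0 < k.im → ∀ xs rs φs : ℝ, 0 ≤ rs → (xs, pol rs φs) ∈ exterior f X₁ X₂ →
      IntegrableOn (fun q : ℝ × ℝ => kirchhoffIntegrand k f u xs rs φs q.1 q.2)
        (axisUpTo X₁ X₂ xs ×ˢ Set.Ioc 0 (2 * Real.pi)) ∧
      u xs (pol rs φs) = kirchhoff k f X₁ X₂ u xs rs φs + uIn k θ xs (pol rs φs)) ∧
    -- the same without absorption, where the integral is the limit as the absorption vanishes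
    (∀ v : ℝ → ℝ → Plane → ℂ, IsAbsorptionLimit k θ f X₁ X₂ v u →
      ∀ xs rs φs : ℝ, 0 ≤ rs → (xs, pol rs φs) ∈ exterior f X₁ X₂ →
        Tendsto (fun ε : ℝ => kirchhoff (k + Complex.I * ε) f X₁ X₂ (v ε) xs rs φs +
          uIn k θ xs (pol rs φs)) (𝓝[>] 0) (𝓝 (u xs (pol rs φs)))) ∧
    -- a finite body: the scattered field behind it, and the far field, with or without absorption
    (∀ b : ℝ, X₂ = (b : EReal) →
      (∀ xs rs φs : ℝ, b < xs → 0 ≤ rs →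
        IntegrableOn (fun q : ℝ × ℝ => kirchhoffIntegrand k f u xs rs φs q.1 q.2)
          (Set.Ioc X₁ b ×ˢ Set.Ioc 0 (2 * Real.pi)) ∧
        u xs (pol rs φs) - uIn k θ xs (pol rs φs) =
          Complex.I / (2 * k) * ∫ φ in (0 : ℝ)..(2 * Real.pi), ∫ x in X₁..b,
            kirchhoffIntegrand k f u xs rs φs x φ) ∧
      (∀ θs φs : ℝ, 0 ≤ θs →
        IntegrableOn (fun q : ℝ × ℝ => directivityIntegrand k f u θs φs q.1 q.2)
          (Set.Ioc X₁ b ×ˢ Set.Ioc 0 (2 * Real.pi)) ∧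
        (fun L : ℝ => u L (pol (L * θs) φs) - uIn k θ L (pol (L * θs) φs) -
            farAmplitude k θs L * directivity k f X₁ b u θs φs)
          =O[atTop] (fun L : ℝ => farAmplitude k θs L / (L : ℂ)))) := by
  have hk0 : k ≠ 0 := by rintro rfl; simp at hk
  have hkim : 0 ≤ k.im := hrad.elim (fun h => h.1.le) fun h => h.1.ge
  refine ⟨fun him xs rs φs hrs hE => ?_, fun v hv xs rs φs hrs hE =>
    hv.tendsto_kirchhoff hf hkim hrs hE, ?_⟩
  · have hdec : ScatteredDecays k θ f X₁ X₂ u := by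
      rcases hrad with h | h
      · exact h.2
      · exact absurd h.1 him.ne'
    obtain ⟨M, hM⟩ := exists_barNGreen_bound hf him hrs hE
    exact ⟨hu.integrableOn_kirchhoff hf hM, hu.eq_kirchhoff hf him hdec hrs hE⟩
  · rintro b rfl
    have hIoc : ∀ g : ℝ × ℝ → ℂ, IntegrableOn g (Set.Ioo X₁ b ×ˢ Set.Ioc 0 (2 * Real.pi)) →
        IntegrableOn g (Set.Ioc X₁ b ×ˢ Set.Ioc 0 (2 * Real.pi)) := fun g hg => by
      rwa [IntegrableOn, ← restrict_Ioo_prod]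
    refine ⟨fun xs rs φs hb hrs => ?_, fun θs φs hθs =>
      ⟨hIoc _ (hu.integrableOn_directivity hf θs φs), hu.far_field hf hk0 hkim hrad hθs⟩⟩
    have hi := hu.integrableOn_kirchhoff_behind hf hkim hb rs φs
    refine ⟨hIoc _ hi, ?_⟩
    rw [hu.eq_kirchhoff_behind hf hk0 hrad hb hrs, hu.kirchhoff_behind hf hkim hb,
      integral_iterated_eq hf.lt_rear.le Real.two_pi_pos.le hi]
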